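/- Let $\mathbf k$ be a field of characteristic $0$ and let $Q$ be a quiver with vertex set $I$ (neither is assumed finite); write $t(a),h(a)$ for the tail and head of an edge. Let $\overline Q=Q\sqcup Q^*$ be its double, with reversal $a\mapsto a^*$, $(a^*)^*=a$; put $[a,a^*]=1$ if $a\in Q$ and $[a,a^*]=-1$ if $a\in Q^*$. A *necklace* is a closed path in $\overline Q$ up to rotation, paths of length $0$ (the vertex idempotents) included. Let $L$ be the $\mathbf k$-vector space with basis the necklaces; $(\mathrm{Sym}\,L)[\mathrm h]$ is then a free $\mathbf k[\mathrm h]$-module on the finite collections $P_1\&\cdots\& P_m$ of necklaces, $\&$ being the symmetric product. All tensor products are over $\mathbf k[\mathrm h]$. *Cutting and gluing.* Let $P$ be a collection with set $X$ of edge occurrences, $\mathrm{pr}:X\to\overline Q$ the underlying edge and $x\mapsto x+1$ the next occurrence on the same necklace. A *cutting* $(I,\phi)$ is a subset $I\subset X$ with an involution $\phi$ of $I$ such that $\mathrm{pr}(\phi(x))=\mathrm{pr}(x)^*$. Cutting and gluing along it gives the collection with one necklace for each orbit of $f:X\to X$, $f(x)=\phi(x)+1$ for $x\in I$ and $f(x)=x+1$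 for $x\notin I$, namely the cyclic product along the orbit of $\mathrm{pr}(x)$ for $x\notin I$ and of the idempotent at $t(\mathrm{pr}(x))$ for $x\in I$, together with the vertex idempotents already in $P$. *Moyal bialgebra.* For collections $P,R$ with edge occurrences $X,Y$, $$P*_{\mathrm h}R=\sum \Bigl(\frac{\mathrm h}{2}\Bigr)^{\#I_X}(-1)^{\#(I_Y\cap \mathrm{pr}^{-1}(Q))}\,PR_{I_X,I_Y,\phi},$$ the sum over all $I_X\subset X$, $I_Y\subset Y$ and bijections $\phi:I_X\to I_Y$ with $\mathrm{pr}(\phi(x))=\mathrm{pr}(x)^*$, where $PR_{I_X,I_Y,\phi}$ is obtained from $P\& R$ by cutting and gluing along $I_X\sqcup I_Y$ with the involution $\phi\sqcup\phi^{-1}$. The coproduct is $$\Delta_{\mathrm h}(P)=\sum_{(I,\phi)}\Bigl(\frac{\mathrm h}{2}\Bigr)^{\#I/2}\sum_{c} s(c,I,\phi)\,P^{(1)}_{I,\phi,c}\otimes P^{(2)}_{I,\phi,c},$$ the sum over all cuttings of $P$ and all assignments $c$ of a component $1$ or $2$ to each necklace of the resulting collection, where $P^{(i)}_{I,\phi,c}$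 is the product of the necklaces assigned to $i$, and $s(c,I,\phi)=\prod_{x\in I,\ \mathrm{pr}(x)\in Q}(c(x+1)-c(x))$, with $c(x)$ the component of the orbit of $x$. The unit is the empty collection $1$, and the counit is $1$ on the empty collection and $0$ on all others. *The algebra $A_{\mathrm h}(Q)$.* It is the $\mathbf k[\mathrm h]$-module spanned by the collections $P_H$ of necklaces whose edge occurrences carry pairwise distinct heights $H(x)\in\mathbb N$, modulo: (i) only the order of the heights matters; (ii) if $H(x)<H(y)$ with no height strictly in between, and $H'$ is $H$ with the heights of $x$ and $y$ exchanged, then $P_H=P_{H'}$ if $\mathrm{pr}(y)\neq\mathrm{pr}(x)^*$, and $P_H-P_{H'}=[\mathrm{pr}(x),\mathrm{pr}(y)]\,\mathrm h\,P''$ if $\mathrm{pr}(y)=\mathrm{pr}(x)^*$, where $P''$ results from $P_H$ by cutting and gluing along $\{x,y\}$ (the other edges keep their heights). Its product $P_H\cdot R_{H'}$ is the collection $P\& R$ with all heights of $R$ moved above those of $P$. Its coproduct is $$\Delta(P_H)=\sum_{(I,\phi)}\mathrm h^{\#I/2}\,s_H(I,\phi)\sum_c P^{(1)}_{I,\phi,c}\otimes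 P^{(2)}_{I,\phi,c},$$ the sum over those $c$ with $c(x)=1$ and $c(x+1)=2$ whenever $x\in I$ and $H(x)<H(\phi(x))$, the remaining edges keeping their heights, where $s_H(I,\phi)$ is the product over these $x$ of $1$ if $\mathrm{pr}(x)\in Q$ and $-1$ if $\mathrm{pr}(x)\in Q^*$. The unit is the class of the empty collection, and the counit is $1$ on the empty collection and $0$ on all others. Let $\Phi_W:(\mathrm{Sym}\,L)[\mathrm h]\to A_{\mathrm h}(Q)$ be the $\mathbf k[\mathrm h]$-linear map $\Phi_W(P)=\frac1{N!}\sum_H P_H$, the sum over all bijections $H$ from the set of the $N$ edge occurrences of $P$ to $\{1,\dots,N\}$. **Theorem.** These formulas give well-defined operations that make $A_{\mathrm h}(Q)$ a Hopf algebra over $\mathbf k[\mathrm h]$, with a (necessarily unique) antipode $S_A$. The map $\Phi_W$ is a $\mathbf k[\mathrm h]$-linear bijection that carries $*_{\mathrm h}$, $1$, $\Delta_{\mathrm h}$ and the counit to the product, unit, coproduct and counit of $A_{\mathrm h}(Q)$. The transported antipode $S=\Phi_W^{-1}\circ S_A\circ\Phi_W$ is given by $$S(P_1\& P_2\&\cdots\&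 P_m)=(-1)^m\,P_1\& P_2\&\cdots\& P_m$$ for all necklaces $P_1,\dots,P_m$ (vertex idempotents included). With $*_{\mathrm h}$, $\Delta_{\mathrm h}$, the unit and counit above, and the antipode $S$, the module $(\mathrm{Sym}\,L)[\mathrm h]$ is a Hopf algebra over $\mathbf k[\mathrm h]$, and $S^2=\mathrm{Id}$. Moreover $S$ is diagonalizable: the collections of necklaces form a $\mathbf k[\mathrm h]$-basis of eigenvectors; the eigenvalues are $1$ and, if $I\neq\emptyset$, also $-1$; the eigenspace for $1$ (resp. $-1$) is spanned by the collections with an even (resp. odd) number of necklaces. -/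

import Mathlib

open scoped TensorProduct Polynomial

universe u v w

namespace NecklaceMoyal

/-! ### Closed paths, necklaces and diagrams over a set of edges -/

/-- A set `E` of edges with vertex set `V`: every edge has a tail `src` and a head `tgt`. -/
class EdgeSet (E : Type w) (V : outParam (Type u)) where
  /-- the tail of an edge -/
  src : E → V
  /-- the head of an edge -/
  tgt : E → V

section General

variable {E : Type w} {V : Type u} [EdgeSet E V]

/-- `IsPath a l b`: the word `l` of edges, read from left to right, is a path from `a` to `b`. -/
def IsPath : V → List E → V → Prop
  | a, [], b => a = b
  | a, e :: l, b => EdgeSet.src e = a ∧ IsPath (EdgeSet.tgt e) l b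

theorem IsPath.append {a b c : V} {l m : List E} (h : IsPath a l b) (h' : IsPath b m c) :
    IsPath a (l ++ m) c := by
  induction l generalizing a with
  | nil => cases h; exact h'
  | cons e l ih => exact ⟨h.1, ih h.2⟩

variable (E) in
/-- A closed path (a path of length zero is the trivial path at its base vertex). -/
structure ClosedPath where
  /-- the initial vertex -/
  base : V
  /-- the successive edges -/
  word : List E
  closed : IsPath base word base

/-- Two closed paths that differ only in the choice of the initial edge. -/
def ClosedPath.Rotated (p q : ClosedPath E) : Prop :=
  ∃ l₁ l₂ : List E, IsPath p.base l₁ q.base ∧ IsPath q.base l₂ p.base ∧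
    p.word = l₁ ++ l₂ ∧ q.word = l₂ ++ l₁

variable (E) in
/-- Necklaces: closed paths up to rotation. The trivial closed paths give the vertex idempotents. -/
def Necklace : Type (max u w) := Quot (ClosedPath.Rotated (E := E))

/-- Initial vertex of a label, which is an edge or a vertex (idempotent). -/
def labelSrc : E ⊕ V → V
  | .inl e => EdgeSet.src e
  | .inr a => a

/-- Final vertex of a label. -/
def labelTgt : E ⊕ V → V
  | .inl e => EdgeSet.tgt e
  | .inr a => a

variable (E) in
/-- A collection of closed paths presented by its set `ι` of places. Every place carries an edge
or a vertex idempotent, and `next` is the "`+1`" operation going to the next place of the same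
closed path. The places that carry an edge are the abstract edges of the collection. -/
structure Diagram (ι : Type) where
  /-- the edge or the idempotent at a place -/
  label : ι → E ⊕ V
  /-- the following place, cyclically -/
  next : Equiv.Perm ι
  compat : ∀ x, labelTgt (label x) = labelSrc (label (next x))

namespace Diagram

variable {ι κ : Type}

/-- `x` is an abstract edge. -/
def IsEdge (D : Diagram E ι) (x : ι) : Prop := ∃ a : E, D.label x = .inl a

/-- The product in the path algebra of the labels at `x, x+1, …, x+n-1`: idempotents drop out. -/
def wordFrom (D : Diagram E ι) (x : ι) (n : ℕ) : List E :=
  ((List.range n).map fun i => D.label (D.next^[i] x)).filterMap Sum.getLeft?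

theorem isPath_wordFrom (D : Diagram E ι) (x : ι) (n : ℕ) :
    IsPath (labelSrc (D.label x)) (D.wordFrom x n) (labelSrc (D.label (D.next^[n] x))) := by
  induction n with
  | zero => exact rfl
  | succ n ih =>
    have h := D.compat (D.next^[n] x)
    rw [← Function.iterate_succ_apply' (f := D.next)] at h
    have e : D.wordFrom x (n + 1) =
        D.wordFrom x n ++ [D.label (D.next^[n] x)].filterMap Sum.getLeft? := by
      simp [wordFrom, List.range_succ]
    rw [e]
    refine ih.append ?_
    rw [← h]
    cases D.label (D.next^[n] x) with
    | inl a => exact ⟨rfl, rfl⟩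
    | inr a => exact rfl

/-- The closed path that starts at the place `x`. -/
noncomputable def closedPathAt (D : Diagram E ι) (x : ι) : ClosedPath E where
  base := labelSrc (D.label x)
  word := D.wordFrom x (Function.minimalPeriod D.next x)
  closed := by
    have h := D.isPath_wordFrom x (Function.minimalPeriod D.next x)
    rwa [Function.iterate_minimalPeriod] at h

/-- The necklace through the place `x`. -/
noncomputable def necklaceAt (D : Diagram E ι) (x : ι) : Necklace E := Quot.mk _ (D.closedPathAt x)

/-- The collection of necklaces of a diagram: one necklace for every orbit of `next`. -/
noncomputable def collection [Finite ι] (D : Diagram E ι) : Multiset (Necklace E) :=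
  letI : Fintype (Quotient (Equiv.Perm.SameCycle.setoid D.next)) := Fintype.ofFinite _
  (Finset.univ : Finset (Quotient (Equiv.Perm.SameCycle.setoid D.next))).val.map
    fun o => D.necklaceAt o.out

/-- Juxtaposition of two diagrams. -/
def sum (D : Diagram E ι) (D' : Diagram E κ) : Diagram E (ι ⊕ κ) where
  label := Sum.elim D.label D'.label
  next := Equiv.sumCongr D.next D'.next
  compat := by
    rintro (x | x)
    · exact D.compat x
    · exact D'.compat x

/-- The part of a diagram that lies over a `next`-stable set of places. -/
def restrict (D : Diagram E ι) (p : ι → Prop) (hp : ∀ x, p (D.next x) ↔ p x) :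
    Diagram E {x // p x} where
  label x := D.label x.1
  next := D.next.subtypePerm hp
  compat x := D.compat x.1

/-- The places of one closed path: its base vertex, followed by its edges. -/
def pathLabel (p : ClosedPath E) : Fin (p.word.length + 1) → E ⊕ V :=
  Fin.cases (.inr p.base) fun j => .inl (p.word.get j)

theorem pathLabel_aux {a b : V} {l : List E} (h : IsPath a l b) (j : Fin (l.length + 1)) :
    labelTgt ((Fin.cases (.inr a) (fun i => .inl (l.get i)) j : E ⊕ V)) =
      if hj : (j : ℕ) < l.length then EdgeSet.src (l.get ⟨j, hj⟩) else b := by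
  induction l generalizing a with
  | nil =>
    have hj : j = 0 := Fin.ext (by have := j.2; simp at this; simp)
    subst hj
    simpa [labelTgt, IsPath] using h
  | cons e l ih =>
    refine Fin.cases ?_ (fun i => ?_) j
    · simpa [labelTgt] using h.1.symm
    · have := ih h.2 i
      refine Fin.cases ?_ (fun m => ?_) i
      · have h0 := ih h.2 0
        simp only [Fin.cases_zero, labelTgt] at h0
        simp only [Fin.cases_succ, labelTgt]
        cases l <;> simpa using h0
      · have h0 := ih h.2 m.succ
        simp only [Fin.cases_succ, labelTgt] at h0 ⊢
        simpa using h0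

theorem pathLabel_compat (p : ClosedPath E) (j : Fin (p.word.length + 1)) :
    labelTgt (pathLabel p j) = labelSrc (pathLabel p (finRotate _ j)) := by
  have h := pathLabel_aux p.closed j
  unfold pathLabel
  rw [h]
  split_ifs with hj
  · have e : finRotate (p.word.length + 1) j = Fin.succ ⟨j, hj⟩ := by
      apply Fin.ext
      have h1 : finRotate (p.word.length + 1) ⟨(j : ℕ), j.2⟩ = _ := finRotate_of_lt hj
      exact congrArg Fin.val h1
    rw [e]
    rfl
  · have hl : j = Fin.last _ := Fin.ext (by have := j.2; simp; omega)
    rw [hl, finRotate_last]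
    rfl

/-- The diagram of a list of closed paths. -/
def ofPaths (L : List (ClosedPath E)) :
    Diagram E (Σ i : Fin L.length, Fin ((L.get i).word.length + 1)) where
  label x := pathLabel (L.get x.1) x.2
  next := Equiv.sigmaCongrRight fun _ => finRotate _
  compat x := pathLabel_compat (L.get x.1) x.2

end Diagram

/-- Chosen representatives of the necklaces of a collection. -/
noncomputable def repr (s : Multiset (Necklace E)) : List (ClosedPath E) := s.toList.map Quot.out

/-- The set of places of a collection of necklaces. -/
abbrev Places (s : Multiset (Necklace E)) : Type :=
  Σ i : Fin (repr s).length, Fin (((repr s).get i).word.length + 1)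

/-- A diagram whose collection of necklaces is `s`. -/
noncomputable def diagram (s : Multiset (Necklace E)) : Diagram E (Places s) :=
  Diagram.ofPaths (repr s)

end General

/-! ### The double of a quiver; cutting and gluing -/

section Quiver

/-- The edges of the double quiver: `inl e` is `e ∈ Q` and `inr e` is the reverse edge `e*`. -/
def DEdge (V : Type u) [Quiver.{v} V] : Type (max u v) := Quiver.Total V ⊕ Quiver.Total V

variable {V : Type u} [Quiver.{v} V]

/-- Edge reversal. -/
def DEdge.star : DEdge V → DEdge V
  | .inl e => .inr e
  | .inr e => .inl e

/-- The edge belongs to the original quiver `Q`. -/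
def DEdge.InQ : DEdge V → Prop
  | .inl _ => True
  | .inr _ => False

/-- The number `[a, a*]`, which is `1` if `a ∈ Q` and `-1` otherwise. -/
def DEdge.sign : DEdge V → ℤ
  | .inl _ => 1
  | .inr _ => -1

instance : EdgeSet (DEdge V) V where
  src a := Sum.elim (fun e => e.left) (fun e => e.right) a
  tgt a := Sum.elim (fun e => e.right) (fun e => e.left) a

theorem DEdge.tgt_star (a : DEdge V) : EdgeSet.tgt a.star = EdgeSet.src a := by
  cases a <;> rfl

/-- Edges with a height. -/
instance : EdgeSet (DEdge V × ℕ) V where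
  src a := EdgeSet.src a.1
  tgt a := EdgeSet.tgt a.1

namespace Diagram

variable {ι κ : Type}

/-- The place carries an edge of `Q`. -/
def IsQ (D : Diagram (DEdge V) ι) (x : ι) : Prop := ∃ a : DEdge V, D.label x = .inl a ∧ a.InQ

/-- The sign of the edge at a place (`1` if there is none). -/
def signAt (D : Diagram (DEdge V) ι) (x : ι) : ℤ := Sum.elim DEdge.sign (fun _ => 1) (D.label x)

/-- Cutting data: the pairs `(I, φ)` of a set `I` of abstract edges and a fixed point free
involution `φ` of `I` matching each edge with a copy of the reverse edge.
`φ` is extended by the identity, so that `I = {x | φ x ≠ x}`. -/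
structure IsCutting (D : Diagram (DEdge V) ι) (φ : Equiv.Perm ι) : Prop where
  invol : ∀ x, φ (φ x) = x
  rev : ∀ x, φ x ≠ x → ∃ a : DEdge V, D.label x = .inl a ∧ D.label (φ x) = .inl a.star

open scoped Classical in
/-- Label after cutting: each cut edge becomes the idempotent at its tail. -/
noncomputable def cutLabel (D : Diagram (DEdge V) ι) (φ : Equiv.Perm ι) (x : ι) : DEdge V ⊕ V :=
  if φ x = x then D.label x else .inr (labelSrc (D.label x))

theorem labelSrc_cutLabel (D : Diagram (DEdge V) ι) (φ : Equiv.Perm ι) (x : ι) :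
    labelSrc (D.cutLabel φ x) = labelSrc (D.label x) := by
  unfold cutLabel
  split_ifs <;> rfl

/-- Cutting and gluing along `(I, φ)`: the new successor map is `x ↦ φ x + 1` on `I` and
`x ↦ x + 1` elsewhere. -/
noncomputable def cut (D : Diagram (DEdge V) ι) (φ : Equiv.Perm ι) (hφ : D.IsCutting φ) :
    Diagram (DEdge V) ι where
  label := D.cutLabel φ
  next := φ.trans D.next
  compat x := by
    rw [labelSrc_cutLabel, Equiv.trans_apply, ← D.compat]
    unfold cutLabel
    split_ifs with h
    · rw [h]
    · obtain ⟨a, h1, h2⟩ := hφ.rev x h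
      rw [h1, h2]
      exact a.tgt_star.symm

theorem isEdge_of_cut {D : Diagram (DEdge V) ι} {φ : Equiv.Perm ι} {hφ : D.IsCutting φ} {x : ι}
    (h : (D.cut φ hφ).IsEdge x) : D.IsEdge x := by
  obtain ⟨a, ha⟩ := h
  have ha : D.cutLabel φ x = .inl a := ha
  unfold cutLabel at ha
  split_ifs at ha
  exact ⟨a, ha⟩

open scoped Classical in
/-- The number `#I / 2` of pairs that are cut: each contains exactly one edge of `Q`. -/
noncomputable def numPairs [Fintype ι] (D : Diagram (DEdge V) ι) (φ : Equiv.Perm ι) : ℕ :=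
  (Finset.univ.filter fun x => φ x ≠ x ∧ D.IsQ x).card

end Diagram

end Quiver

/-! ### The Moyal product and coproduct on `(Sym L)[h]` -/

section Moyal

/-- `(Sym L)[h]`, where `L` has the necklaces as a basis and the parameter `h` is the polynomial
variable of the coefficient ring. -/
abbrev SymL (k : Type w) [Field k] (V : Type u) [Quiver.{v} V] : Type (max u v w) :=
  MvPolynomial (Necklace (DEdge V)) k[X]

variable (k : Type w) [Field k] {V : Type u} [Quiver.{v} V]

/-- The symmetric product `P₁ & ⋯ & P_m` of a collection of necklaces. -/
noncomputable def coll (s : Multiset (Necklace (DEdge V))) : SymL k V :=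
  (s.map MvPolynomial.X).prod

/-- The linear map on `(Sym L)[h]` with prescribed values on collections of necklaces. -/
noncomputable def linExt {M : Type*} [AddCommGroup M] [Module k[X] M]
    (F : Multiset (Necklace (DEdge V)) → M) : SymL k V →ₗ[k[X]] M :=
  (MvPolynomial.basisMonomials (Necklace (DEdge V)) k[X]).constr k[X]
    fun d => F (Finsupp.toMultiset d)

/-- The element `h / 2`. -/
noncomputable def halfH : k[X] := Polynomial.C (2⁻¹ : k) * Polynomial.X

/-- `φ` pairs places of the first collection with places of the second one only. -/
def Crossing {ι κ : Type} (φ : Equiv.Perm (ι ⊕ κ)) : Prop :=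
  (∀ x : ι, φ (.inl x) ≠ .inl x → ∃ y : κ, φ (.inl x) = .inr y) ∧
    ∀ y : κ, φ (.inr y) ≠ .inr y → ∃ x : ι, φ (.inr y) = .inl x

open scoped Classical in
/-- The sign `(-1)^{#(I_Y ∩ Q)}`. -/
noncomputable def crossSign {ι κ : Type} [Fintype κ] (D : Diagram (DEdge V) κ)
    (φ : Equiv.Perm (ι ⊕ κ)) : ℤ :=
  (-1) ^ (Finset.univ.filter fun y : κ => φ (.inr y) ≠ .inr y ∧ D.IsQ y).card

open scoped Classical in
/-- Moyal product of two collections: the sum over all `(I_X, I_Y, φ)` of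
`(h/2)^{#I_X} (-1)^{#(I_Y ∩ Q)}` times the result of cutting and gluing. -/
noncomputable def moyalMulColl (s t : Multiset (Necklace (DEdge V))) : SymL k V :=
  ∑ φ : {φ : Equiv.Perm (Places s ⊕ Places t) //
      ((diagram s).sum (diagram t)).IsCutting φ ∧ Crossing φ},
    (halfH k ^ ((diagram s).sum (diagram t)).numPairs φ.1 *
        ((crossSign (diagram t) φ.1 : ℤ) : k[X])) •
      coll k (((diagram s).sum (diagram t)).cut φ.1 φ.2.1).collection

/-- The Moyal product on `(Sym L)[h]`. -/
noncomputable def moyalMul : SymL k V →ₗ[k[X]] SymL k V →ₗ[k[X]] SymL k V :=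
  linExt k fun s => linExt k fun t => moyalMulColl k s t

/-- Component assignments for a diagram: each necklace is assigned to the first (`0`) or to the
second (`1`) tensor factor. -/
def Components {ι : Type} (D : Diagram (DEdge V) ι) : Type :=
  {c : ι → Fin 2 // ∀ x, c (D.next x) = c x}

noncomputable instance {ι : Type} [Finite ι] (D : Diagram (DEdge V) ι) :
    Fintype (Components D) :=
  Fintype.ofFinite {c : ι → Fin 2 // ∀ x, c (D.next x) = c x}

/-- The part of a diagram consisting of the necklaces that are assigned to the factor `i`. -/
def Diagram.part {ι : Type} (D : Diagram (DEdge V) ι) (c : Components D) (i : Fin 2) :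
    Diagram (DEdge V) {x // c.1 x = i} :=
  D.restrict (fun x => c.1 x = i) fun x => by rw [c.2 x]

open scoped Classical in
/-- The sign `s(c, I, φ)`: for every `x ∈ I` that is an edge of `Q`, a factor `1`, `0`, `-1`
according to the components `c x` of the start and `c (x + 1)` of the target of `x`. -/
noncomputable def compSign {ι : Type} [Fintype ι] (D : Diagram (DEdge V) ι) (φ : Equiv.Perm ι)
    (c : ι → Fin 2) : ℤ :=
  ∏ x ∈ Finset.univ.filter fun x => φ x ≠ x ∧ D.IsQ x,
    (((c (D.next x) : ℕ) : ℤ) - ((c x : ℕ) : ℤ))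

open scoped Classical in
/-- Moyal coproduct of a collection of necklaces. -/
noncomputable def moyalComulColl (s : Multiset (Necklace (DEdge V))) :
    SymL k V ⊗[k[X]] SymL k V :=
  ∑ φ : {φ : Equiv.Perm (Places s) // (diagram s).IsCutting φ},
    ∑ c : Components ((diagram s).cut φ.1 φ.2),
      (halfH k ^ (diagram s).numPairs φ.1 *
          ((compSign (diagram s) φ.1 c.1 : ℤ) : k[X])) •
        (coll k (((diagram s).cut φ.1 φ.2).part c 0).collection ⊗ₜ[k[X]]
          coll k (((diagram s).cut φ.1 φ.2).part c 1).collection)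

/-- The Moyal coproduct on `(Sym L)[h]`. -/
noncomputable def moyalComul : SymL k V →ₗ[k[X]] SymL k V ⊗[k[X]] SymL k V :=
  linExt k fun s => moyalComulColl k s

/-- The counit: `1` on the empty collection and `0` on all other collections. -/
noncomputable def moyalCounit : SymL k V →ₗ[k[X]] k[X] :=
  linExt k fun s => open scoped Classical in if s = 0 then 1 else 0

end Moyal

/-! ### The algebra `A_h(Q)` -/

section Ah

/-- A collection of closed paths in the double quiver whose abstract edges carry pairwise distinct
heights. (The value of `height` at the places of idempotents is irrelevant.) -/
structure HDiagram (V : Type u) [Quiver.{v} V] (ι : Type) extends Diagram (DEdge V) ι where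
  /-- the height of an abstract edge -/
  height : ι → ℕ
  height_inj : ∀ x y, toDiagram.IsEdge x → toDiagram.IsEdge y → height x = height y → x = y

variable {V : Type u} [Quiver.{v} V]

namespace HDiagram

variable {ι κ : Type}

/-- The same collection as a collection of closed paths whose edges are pairs `(a, h)`. -/
def heighted (D : HDiagram V ι) : Diagram (DEdge V × ℕ) ι where
  label x := Sum.map (fun a => (a, D.height x)) id (D.label x)
  next := D.next
  compat x := by
    have h := D.compat x
    have e1 : ∀ (l : DEdge V ⊕ V) (n : ℕ),
        labelSrc (Sum.map (fun a => (a, n)) id l : (DEdge V × ℕ) ⊕ V) = labelSrc l := by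
      rintro (l | l) n <;> rfl
    have e2 : ∀ (l : DEdge V ⊕ V) (n : ℕ),
        labelTgt (Sum.map (fun a => (a, n)) id l : (DEdge V × ℕ) ⊕ V) = labelTgt l := by
      rintro (l | l) n <;> rfl
    rw [e1, e2, h]

/-- Cutting and gluing; the remaining edges keep their heights. -/
noncomputable def cut (D : HDiagram V ι) (φ : Equiv.Perm ι) (hφ : D.IsCutting φ) :
    HDiagram V ι where
  toDiagram := D.toDiagram.cut φ hφ
  height := D.height
  height_inj x y hx hy h :=
    D.height_inj x y (Diagram.isEdge_of_cut hx) (Diagram.isEdge_of_cut hy) h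

/-- The sub-collection assigned to the factor `i`; its edges keep their heights. -/
def part (D : HDiagram V ι) (c : Components D.toDiagram) (i : Fin 2) :
    HDiagram V {x // c.1 x = i} where
  toDiagram := D.toDiagram.part c i
  height x := D.height x.1
  height_inj x y hx hy h := Subtype.ext (D.height_inj x.1 y.1 hx hy h)

/-- Place `D'` above `D`. -/
def stack [Fintype ι] (D : HDiagram V ι) (D' : HDiagram V κ) : HDiagram V (ι ⊕ κ) where
  toDiagram := D.toDiagram.sum D'.toDiagram
  height := Sum.elim D.height fun y => D'.height y + (Finset.univ.sup D.height + 1)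
  height_inj := by
    rintro (x | x) (y | y) hx hy h
    · exact congrArg _ (D.height_inj x y hx hy h)
    · have := Finset.le_sup (f := D.height) (Finset.mem_univ x)
      simp only [Sum.elim_inl, Sum.elim_inr] at h
      omega
    · have := Finset.le_sup (f := D.height) (Finset.mem_univ y)
      simp only [Sum.elim_inl, Sum.elim_inr] at h
      omega
    · simp only [Sum.elim_inr] at h
      exact congrArg _ (D'.height_inj x y hx hy (by omega))

/-- The empty collection. -/
def empty : HDiagram V Empty where
  label := Empty.elim
  next := 1
  compat x := x.elim
  height := Empty.elim
  height_inj x := x.elim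

end HDiagram

variable (V) in
/-- Collections of necklaces with pairwise distinct heights on their edges. -/
def HCollection : Type (max u v) :=
  {M : Multiset (Necklace (DEdge V × ℕ)) //
    ∃ (ι : Type) (_ : Fintype ι) (D : HDiagram V ι), M = D.heighted.collection}

/-- The collection with heights that is presented by a diagram with heights. -/
noncomputable def HDiagram.hcoll {ι : Type} [Fintype ι] (D : HDiagram V ι) : HCollection V :=
  ⟨D.heighted.collection, ι, inferInstance, D, rfl⟩

variable (k : Type w) [Field k]

open Finsupp in
/-- The defining relations of `A_h(Q)`. -/
inductive AhRel : (HCollection V →₀ k[X]) → Prop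
  /-- Only the order of the heights matters. -/
  | reorder {ι : Type} [Fintype ι] (D D' : HDiagram V ι) (h : D'.toDiagram = D.toDiagram)
      (hlt : ∀ x y, D.IsEdge x → D.IsEdge y → (D.height x < D.height y ↔ D'.height x < D'.height y)) :
      AhRel (single D.hcoll 1 - single D'.hcoll 1)
  /-- Exchanging the heights of two edges `x`, `y` of consecutive heights that are not reverse
  to each other changes nothing. -/
  | commute {ι : Type} [Fintype ι] (D D' : HDiagram V ι) (h : D'.toDiagram = D.toDiagram)
      (x y : ι) (a b : DEdge V) (hx : D.label x = .inl a) (hy : D.label y = .inl b)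
      (hlt : D.height x < D.height y)
      (hcons : ∀ z, D.IsEdge z → ¬ (D.height x < D.height z ∧ D.height z < D.height y))
      (hDx : D'.height x = D.height y) (hDy : D'.height y = D.height x)
      (hDz : ∀ z, z ≠ x → z ≠ y → D'.height z = D.height z)
      (hab : b ≠ a.star) :
      AhRel (single D.hcoll 1 - single D'.hcoll 1)
  /-- Exchanging the heights of two edges `x`, `y` of consecutive heights that are reverse to each
  other: the difference is `[a, a*] h` times the result of cutting out `x` and `y` and gluing. -/
  | exchange {ι : Type} [Fintype ι] (D D' : HDiagram V ι) (h : D'.toDiagram = D.toDiagram)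
      (x y : ι) (a : DEdge V) (hx : D.label x = .inl a) (hy : D.label y = .inl a.star)
      (hlt : D.height x < D.height y)
      (hcons : ∀ z, D.IsEdge z → ¬ (D.height x < D.height z ∧ D.height z < D.height y))
      (hDx : D'.height x = D.height y) (hDy : D'.height y = D.height x)
      (hDz : ∀ z, z ≠ x → z ≠ y → D'.height z = D.height z)
      (φ : Equiv.Perm ι) (hφ : D.IsCutting φ) (hφx : φ x = y) (hφy : φ y = x)
      (hφz : ∀ z, z ≠ x → z ≠ y → φ z = z) :
      AhRel (single D.hcoll 1 - single D'.hcoll 1 -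
        single (D.cut φ hφ).hcoll ((a.sign : k[X]) * Polynomial.X))

/-- The `k[h]`-module `A_h(Q)`: spanned by the collections of necklaces with distinct heights,
modulo the defining relations. -/
abbrev Ah (k : Type w) [Field k] (V : Type u) [Quiver.{v} V] : Type (max u v w) :=
  (HCollection V →₀ k[X]) ⧸ Submodule.span k[X] {r : HCollection V →₀ k[X] | AhRel k r}

/-- The class in `A_h(Q)` of a collection with heights. -/
noncomputable def HDiagram.cls {ι : Type} [Fintype ι] (D : HDiagram V ι) : Ah k V :=
  Submodule.Quotient.mk (Finsupp.single D.hcoll 1)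

open scoped Classical in
/-- The sign of a cutting of a collection with heights: a factor `1` or `-1` for every pair,
according to whether the lower edge of the pair is in `Q` or not. -/
noncomputable def HDiagram.cutSign {ι : Type} [Fintype ι] (D : HDiagram V ι)
    (φ : Equiv.Perm ι) : ℤ :=
  ∏ x ∈ Finset.univ.filter fun x => φ x ≠ x ∧ D.height x < D.height (φ x), D.signAt x

/-- The component assignment is compatible with the heights: for every cut pair, the start of the
lower edge is in the first component and its target is in the second one. -/
def HDiagram.Compatible {ι : Type} (D : HDiagram V ι) (φ : Equiv.Perm ι) (c : ι → Fin 2) : Prop :=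
  ∀ x, φ x ≠ x → D.height x < D.height (φ x) → c x = 0 ∧ c (D.next x) = 1

open scoped Classical in
/-- The coproduct in `A_h(Q)` of the class of a collection with heights. -/
noncomputable def HDiagram.comulCls {ι : Type} [Fintype ι] (D : HDiagram V ι) :
    Ah k V ⊗[k[X]] Ah k V :=
  ∑ φ : {φ : Equiv.Perm ι // D.IsCutting φ},
    ∑ c : Components (D.cut φ.1 φ.2).toDiagram,
      if D.Compatible φ.1 c.1 then
        ((D.cutSign φ.1 : k[X]) * Polynomial.X ^ D.numPairs φ.1) •
          (((D.cut φ.1 φ.2).part c 0).cls k ⊗ₜ[k[X]] ((D.cut φ.1 φ.2).part c 1).cls k)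
      else 0

/-- The unit of `A_h(Q)`: the class of the empty collection. -/
noncomputable def Ah.one (k : Type w) [Field k] (V : Type u) [Quiver.{v} V] : Ah k V := (HDiagram.empty : HDiagram V Empty).cls k

open scoped Classical in
/-- `mul`, `comul`, `counit` are the product, the coproduct and the counit of `A_h(Q)`:
the product stacks the second collection above the first one, the coproduct is the sum over all
cuttings and compatible component assignments, and the counit is `1` on the empty collection and
`0` on all others. As the classes span `A_h(Q)`, this determines the three maps. -/
structure IsAhStructure (mul : Ah k V →ₗ[k[X]] Ah k V →ₗ[k[X]] Ah k V)
    (comul : Ah k V →ₗ[k[X]] Ah k V ⊗[k[X]] Ah k V) (counit : Ah k V →ₗ[k[X]] k[X]) : Prop where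
  mul_cls : ∀ {ι κ : Type} [Fintype ι] [Fintype κ] (D : HDiagram V ι) (D' : HDiagram V κ),
    mul (D.cls k) (D'.cls k) = (D.stack D').cls k
  comul_cls : ∀ {ι : Type} [Fintype ι] (D : HDiagram V ι), comul (D.cls k) = D.comulCls k
  counit_cls : ∀ {ι : Type} [Fintype ι] (D : HDiagram V ι),
    counit (D.cls k) = if IsEmpty ι then 1 else 0

/-! ### The symmetrization map -/

/-- Height assignments of a collection: bijections from its `N` abstract edges to `{1, …, N}`
(here `i : Fin N` stands for the height `i + 1`). -/
abbrev HeightAssignment {ι : Type} (D : Diagram (DEdge V) ι) : Type :=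
  {x // D.IsEdge x} ≃ Fin (Nat.card {x // D.IsEdge x})

open scoped Classical in
/-- The collection `P_H` with heights given by a height assignment `H`. -/
noncomputable def Diagram.withHeights {ι : Type} (D : Diagram (DEdge V) ι)
    (H : HeightAssignment D) : HDiagram V ι where
  toDiagram := D
  height x := if hx : D.IsEdge x then (H ⟨x, hx⟩ : ℕ) + 1 else 0
  height_inj x y hx hy h := by
    rw [dif_pos hx, dif_pos hy] at h
    have := H.injective (Fin.ext (Nat.succ_injective h))
    exact congrArg Subtype.val this

open scoped Classical in
/-- The symmetrization map on a collection: the average of `P_H` over all height assignments. -/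
noncomputable def phiWColl (s : Multiset (Necklace (DEdge V))) : Ah k V :=
  Polynomial.C (((Nat.card {x // (diagram s).IsEdge x}).factorial : k)⁻¹) •
    ∑ H : HeightAssignment (diagram s), ((diagram s).withHeights H).cls k

/-- The symmetrization map `Φ_W : (Sym L)[h] → A_h(Q)`. -/
noncomputable def phiW : SymL k V →ₗ[k[X]] Ah k V := linExt k fun s => phiWColl k s

end Ah

/-! ### Hopf algebra structures -/

/-- The linear maps `mul`, `comul`, `counit`, `S` and the element `one` make the `R`-module `M`
a Hopf algebra with antipode `S`: `M` is identified with a Hopf algebra over `R` whose structure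
maps are the given ones. -/
def IsHopf {R : Type v} [CommRing R] {M : Type u} [AddCommGroup M] [Module R M]
    (mul : M →ₗ[R] M →ₗ[R] M) (one : M) (comul : M →ₗ[R] M ⊗[R] M) (counit : M →ₗ[R] R)
    (S : M →ₗ[R] M) : Prop :=
  ∃ (H : Type u) (_ : Ring H) (_ : HopfAlgebra R H) (e : M ≃ₗ[R] H),
    (∀ x y, e (mul x y) = e x * e y) ∧ e one = 1 ∧
    (∀ x, CoalgebraStruct.comul (R := R) (e x) =
      TensorProduct.map (e : M →ₗ[R] H) (e : M →ₗ[R] H) (comul x)) ∧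
    (∀ x, CoalgebraStruct.counit (R := R) (e x) = counit x) ∧
    ∀ x, HopfAlgebra.antipode R (e x) = e (S x)

end NecklaceMoyal

open NecklaceMoyal

/-! All structure maps are weighted sums over cuttings. Give each ordered pair of places of a
diagram a weight `A x y`, let the weight of a cutting be the product of `A x (φ x)` over its edges
`x` in `Q` (each cut pair has exactly one), and add up the cut collections with these weights: this
is `cutColl`. Expanding the product of the factors `A + B` shows that cutting with weights `A` and
then with weights `B` is cutting once with weights `A + B` (`Diagram.cutSum_cutSum`). The Moyal
product has weight h/2 from the first factor to the second and -h/2 backwards (`crossWeight`). The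
coproduct is a sum over colourings `c` of the places by the two tensor factors, with weight h/2 (c y
- c x) (`compWeight`). Associativity and coassociativity thereby reduce to identities between weight
functions.

The comparison with `A_h(Q)` is a Wick formula. A collection with heights is sent to the sum over
its cuttings with weight h/2 or -h/2 according to the order of the two heights (`HDiagram.wick`).
Exchanging consecutive reverse edges changes a single factor by h/2 - (-h/2) = h, which is the
defining relation (`wick_exchange`). Averaging over all height assignments kills every nontrivial
cutting, so the Wick map is a left inverse of `Φ_W` (`wickMap_average`). Modulo diagrams with fewer
edges the class does not depend on the heights, so `Φ_W` is onto (`phiW_surjective`). The operations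
of `A_h(Q)` are then defined by transport, and the prescribed formulas for them follow from
`wick_stack` and `map_wickMap_comulCls`, again by adding weights.

Multiplicativity of the coproduct does not hold weight by weight. The two weights differ only on
pairs joining the two factors with different colours, and a conservation law for the number of
places of each colour excludes these (`apply_eq_of_cutAt_sum`).

For the antipode, applying (-1)^m to one tensor factor and multiplying back gives each cutting `θ` a
coefficient that is a signed count of two-colourings. Only colourings that alternate along the pairs
of `θ` contribute. Their constraints form a graph in which every place has two neighbours, hence a
union of cycles. Exchanging the colours on the cycle through a fixed place is an involution that
reverses the sign (`Alternating.sign_flip`), so the coefficient vanishes unless the diagram is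
empty.

A collection remembers a diagram only up to rotation and up to places carrying idempotents, so each
formula must be shown independent of the diagram. This is handled by contractions, which delete
idempotent places. Inserting an idempotent before every place gives a diagram that contracts both to
the given one and to the standard diagram of its collection, so contraction invariance suffices
(`Diagram.eq_of_contraction_invariant`). -/

namespace NecklaceMoyal

/-! ### Contractions of diagrams: deleting places that carry idempotents -/

section Contraction

variable {E : Type w} {V : Type u} [EdgeSet E V]

theorem IsPath.right_unique {a b c : V} {l : List E} (h : IsPath a l b) (h' : IsPath a l c) :
    b = c := by
  induction l generalizing a with
  | nil => exact Eq.trans (Eq.symm h) h'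
  | cons e l ih => exact ih h.2 h'.2

theorem ClosedPath.ext {p q : ClosedPath E} (h : p.base = q.base) (h' : p.word = q.word) :
    p = q := by
  cases p; cases q; cases h; cases h'; rfl

theorem ClosedPath.Rotated.symm {p q : ClosedPath E} (h : p.Rotated q) : q.Rotated p := by
  obtain ⟨l, m, h1, h2, h3, h4⟩ := h
  exact ⟨m, l, h2, h1, h4, h3⟩

namespace Diagram

variable {ι κ : Type}

theorem wordFrom_succ (D : Diagram E ι) (x : ι) (n : ℕ) :
    D.wordFrom x (n + 1) =
      D.wordFrom x n ++ (Sum.getLeft? (D.label (D.next^[n] x))).toList := by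
  simp only [wordFrom, List.range_succ, List.map_append, List.map_cons, List.map_nil,
    List.filterMap_append]
  cases D.label (D.next^[n] x) <;> rfl

theorem wordFrom_add (D : Diagram E ι) (x : ι) (m n : ℕ) :
    D.wordFrom x (m + n) = D.wordFrom x m ++ D.wordFrom (D.next^[m] x) n := by
  induction n with
  | zero => simp [wordFrom]
  | succ n ih =>
    rw [← add_assoc, wordFrom_succ, ih, wordFrom_succ, List.append_assoc,
      ← Function.iterate_add_apply, add_comm n m]

theorem minimalPeriod_pos [Finite ι] (D : Diagram E ι) (x : ι) :
    0 < Function.minimalPeriod D.next x :=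
  Function.minimalPeriod_pos_of_mem_periodicPts (D.next.injective.mem_periodicPts x)

theorem minimalPeriod_iterate [Finite ι] (D : Diagram E ι) (x : ι) (m : ℕ) :
    Function.minimalPeriod D.next (D.next^[m] x) = Function.minimalPeriod D.next x :=
  Function.minimalPeriod_apply_iterate (D.next.injective.mem_periodicPts x) m

theorem rotated_closedPathAt [Finite ι] (D : Diagram E ι) (x : ι) {m : ℕ}
    (hm : m ≤ Function.minimalPeriod D.next x) :
    (D.closedPathAt x).Rotated (D.closedPathAt (D.next^[m] x)) := by
  obtain ⟨n, hn⟩ := Nat.exists_eq_add_of_le hm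
  have h : D.next^[n] (D.next^[m] x) = x := by
    rw [← Function.iterate_add_apply, add_comm n m, ← hn, Function.iterate_minimalPeriod]
  refine ⟨D.wordFrom x m, D.wordFrom (D.next^[m] x) n, D.isPath_wordFrom x m, ?_, ?_, ?_⟩
  · have := D.isPath_wordFrom (D.next^[m] x) n
    rwa [h] at this
  · exact (congrArg (D.wordFrom x) hn).trans (D.wordFrom_add x m n)
  · refine (congrArg (D.wordFrom _) ((D.minimalPeriod_iterate x m).trans hn)).trans ?_
    rw [add_comm m n, wordFrom_add, h]

theorem necklaceAt_next [Finite ι] (D : Diagram E ι) (x : ι) :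
    D.necklaceAt (D.next x) = D.necklaceAt x :=
  (Quot.sound (D.rotated_closedPathAt x (m := 1) (D.minimalPeriod_pos x))).symm

theorem necklaceAt_iterate [Finite ι] (D : Diagram E ι) (x : ι) (n : ℕ) :
    D.necklaceAt (D.next^[n] x) = D.necklaceAt x := by
  induction n with
  | zero => rfl
  | succ n ih => rw [Function.iterate_succ_apply', necklaceAt_next, ih]

theorem exists_iterate_eq [Finite ι] {f : Equiv.Perm ι} {x y : ι} (h : f.SameCycle x y) :
    ∃ n, f^[n] x = y := by
  obtain ⟨n, -, h⟩ := h.exists_pow_eq'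
  exact ⟨n, by rw [← h, Equiv.Perm.coe_pow]⟩

theorem sameCycle_iterate (f : Equiv.Perm ι) (x : ι) (n : ℕ) : f.SameCycle x (f^[n] x) :=
  ⟨n, by rw [zpow_natCast, Equiv.Perm.coe_pow]⟩

theorem necklaceAt_congr [Finite ι] (D : Diagram E ι) {x y : ι} (h : D.next.SameCycle x y) :
    D.necklaceAt y = D.necklaceAt x := by
  obtain ⟨n, rfl⟩ := exists_iterate_eq h
  exact D.necklaceAt_iterate x n

/-- The cycle through a place. -/
def cycleOf (D : Diagram E ι) (x : ι) : Quotient (Equiv.Perm.SameCycle.setoid D.next) :=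
  Quotient.mk _ x

theorem cycleOf_eq_iff {D : Diagram E ι} {x y : ι} :
    D.cycleOf x = D.cycleOf y ↔ D.next.SameCycle x y :=
  Quotient.eq

theorem necklaceAt_out [Finite ι] (D : Diagram E ι) (x : ι) :
    D.necklaceAt (D.cycleOf x).out = D.necklaceAt x := by
  refine (D.necklaceAt_congr (cycleOf_eq_iff.1 ?_)).symm.symm
  exact (Quotient.out_eq (D.cycleOf x)).symm

/-- The collection of a diagram, computed with one place on every cycle. -/
theorem collection_eq_map [Finite ι] (D : Diagram E ι) {α : Type*} [Fintype α] (e : α → ι)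
    (he : Function.Bijective fun a => D.cycleOf (e a)) :
    D.collection = (Finset.univ : Finset α).val.map fun a => D.necklaceAt (e a) := by
  unfold collection
  let : Fintype (Quotient (Equiv.Perm.SameCycle.setoid D.next)) := Fintype.ofFinite _
  rw [← Multiset.map_univ_val_equiv (Equiv.ofBijective _ he), Multiset.map_map]
  exact Multiset.map_congr rfl fun a _ => D.necklaceAt_out (e a)

theorem card_collection [Finite ι] (D : Diagram E ι) :
    D.collection.card = Nat.card (Quotient (Equiv.Perm.SameCycle.setoid D.next)) := by
  unfold collection
  let : Fintype (Quotient (Equiv.Perm.SameCycle.setoid D.next)) := Fintype.ofFinite _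
  rw [Multiset.card_map, Nat.card_eq_fintype_card]
  rfl

theorem collection_eq_zero_iff [Finite ι] (D : Diagram E ι) : D.collection = 0 ↔ IsEmpty ι := by
  rw [← Multiset.card_eq_zero, card_collection, Nat.card_eq_zero, or_iff_left]
  · exact ⟨fun h => ⟨fun x => h.elim (D.cycleOf x)⟩,
      fun h => ⟨fun q => h.elim q.out⟩⟩
  · rw [not_infinite_iff_finite]; infer_instance

/-- A contraction of `D` to `D₀`: the diagram `D₀` arises from `D` by removing places that carry
idempotents, where at least one place of every cycle is kept. The map `ret` sends a place to the
first remaining place at or after it. -/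
structure Contraction (D₀ : Diagram E κ) (D : Diagram E ι) where
  /-- inclusion of the remaining places -/
  emb : κ → ι
  /-- the first remaining place -/
  ret : ι → κ
  ret_emb : ∀ x, ret (emb x) = x
  label_emb : ∀ x, D.label (emb x) = D₀.label x
  ret_next_emb : ∀ x, ret (D.next (emb x)) = D₀.next x
  ret_next : ∀ y, (∀ x, emb x ≠ y) → ret (D.next y) = ret y
  not_isEdge : ∀ y, (∀ x, emb x ≠ y) → ¬ D.IsEdge y
  reach : ∀ y, ∃ n x, D.next^[n] y = emb x

/-- An isomorphism of diagrams is a contraction. -/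
def Contraction.ofEquiv {D₀ : Diagram E κ} {D : Diagram E ι} (e : κ ≃ ι)
    (hl : ∀ x, D.label (e x) = D₀.label x) (hn : ∀ x, D.next (e x) = e (D₀.next x)) :
    Contraction D₀ D where
  emb := e
  ret := e.symm
  ret_emb := e.symm_apply_apply
  label_emb := hl
  ret_next_emb x := by rw [hn, e.symm_apply_apply]
  ret_next y hy := absurd (e.apply_symm_apply y) (hy _)
  not_isEdge y hy := absurd (e.apply_symm_apply y) (hy _)
  reach y := ⟨0, e.symm y, (e.apply_symm_apply y).symm⟩

namespace Contraction

variable {D₀ : Diagram E κ} {D : Diagram E ι} (C : Contraction D₀ D)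

include C

theorem emb_injective : Function.Injective C.emb := Function.LeftInverse.injective C.ret_emb

theorem isEdge_emb (x : κ) : D.IsEdge (C.emb x) ↔ D₀.IsEdge x := by
  unfold IsEdge
  rw [C.label_emb]

theorem exists_of_isEdge {y : ι} (h : D.IsEdge y) : ∃ x, C.emb x = y := by
  by_contra! h'
  exact C.not_isEdge y h' h

theorem ret_next_of_emb {y : ι} (h : C.emb (C.ret y) = y) :
    C.ret (D.next y) = D₀.next (C.ret y) := by
  rw [← C.ret_next_emb, h]

theorem ret_next_of_not {y : ι} (h : C.emb (C.ret y) ≠ y) : C.ret (D.next y) = C.ret y := by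
  refine C.ret_next y fun x hx => h ?_
  rw [← hx, C.ret_emb]

theorem emb_ret_of_isEdge {y : ι} (h : D.IsEdge y) : C.emb (C.ret y) = y := by
  obtain ⟨x, rfl⟩ := C.exists_of_isEdge h
  rw [C.ret_emb]

theorem exists_iterate_eq_emb_ret (y : ι) : ∃ n, D.next^[n] y = C.emb (C.ret y) := by
  obtain ⟨n, x, h⟩ := C.reach y
  induction n generalizing y with
  | zero =>
    refine ⟨0, ?_⟩
    have h : y = C.emb x := h
    rw [h, C.ret_emb]
    rfl
  | succ n ih =>
    by_cases hy : C.emb (C.ret y) = y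
    · exact ⟨0, hy.symm⟩
    · obtain ⟨m, hm⟩ := ih (D.next y) h
      exact ⟨m + 1, by rw [Function.iterate_succ_apply, hm, C.ret_next_of_not hy]⟩

theorem exists_iterate_eq_emb_next (x : κ) : ∃ n, D.next^[n] (C.emb x) = C.emb (D₀.next x) := by
  obtain ⟨n, h⟩ := C.exists_iterate_eq_emb_ret (D.next (C.emb x))
  exact ⟨n + 1, by rw [Function.iterate_succ_apply, h, C.ret_next_emb]⟩

/-- The number of remaining places that are passed in `n` steps. -/
noncomputable def visits (x : κ) : ℕ → ℕ
  | 0 => 0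
  | n + 1 => open scoped Classical in
    visits x n + if C.emb (C.ret (D.next^[n] (C.emb x))) = D.next^[n] (C.emb x) then 1 else 0

/-- Seen through `ret`, a walk in `D` advances exactly when it leaves a remaining place and stands
still otherwise. Thus `n` steps upstairs become as many steps in `D₀` as remaining places were left.
-/
theorem ret_iterate (x : κ) (n : ℕ) :
    C.ret (D.next^[n] (C.emb x)) = D₀.next^[C.visits x n] x := by
  induction n with
  | zero => exact C.ret_emb x
  | succ n ih =>
    rw [Function.iterate_succ_apply', visits]
    split_ifs with h
    · rw [C.ret_next_of_emb h, ih, ← Function.iterate_succ_apply' (f := D₀.next)]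
    · rw [C.ret_next_of_not h, ih, add_zero]

theorem wordFrom_emb (x : κ) (n : ℕ) :
    D.wordFrom (C.emb x) n = D₀.wordFrom x (C.visits x n) := by
  induction n with
  | zero => rfl
  | succ n ih =>
    rw [wordFrom_succ, visits, ih]
    split_ifs with h
    · rw [wordFrom_succ, ← C.ret_iterate, ← C.label_emb, h]
    · have h' := mt C.emb_ret_of_isEdge h
      cases hl : D.label (D.next^[n] (C.emb x)) with
      | inl a => exact absurd ⟨a, hl⟩ h'
      | inr a => simp

theorem visits_mono (x : κ) : Monotone (C.visits x) :=
  monotone_nat_of_le_succ fun n => by rw [visits]; exact Nat.le_add_right _ _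

theorem exists_visits_eq (x : κ) {n i : ℕ} (h : i < C.visits x n) :
    ∃ j < n, C.visits x j = i ∧ C.emb (D₀.next^[i] x) = D.next^[j] (C.emb x) := by
  induction n with
  | zero => exact absurd h (Nat.not_lt_zero _)
  | succ n ih =>
    by_cases hi : i < C.visits x n
    · obtain ⟨j, hj, h'⟩ := ih hi
      exact ⟨j, hj.trans n.lt_succ_self, h'⟩
    · rw [visits] at h
      split_ifs at h with hc
      · have hi : C.visits x n = i := by omega
        refine ⟨n, n.lt_succ_self, hi, ?_⟩
        rw [← hi, ← C.ret_iterate, hc]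
      · omega

/-- One turn in `D` gives a period of `x` in `D₀`. If it exceeded the minimal period, the walk would
meet `emb x` again within the turn, hence at time 0, when no visit has been counted yet. -/
theorem visits_minimalPeriod [Finite ι] [Finite κ] (x : κ) :
    C.visits x (Function.minimalPeriod D.next (C.emb x)) = Function.minimalPeriod D₀.next x := by
  set n := Function.minimalPeriod D.next (C.emb x) with hn
  have hn0 : 0 < n := D.minimalPeriod_pos _
  have h1 : 0 < C.visits x n := by
    refine lt_of_lt_of_le ?_ (C.visits_mono x hn0)
    simp [visits, C.ret_emb]
  have h2 : Function.IsPeriodicPt D₀.next (C.visits x n) x := by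
    have := C.ret_iterate x n
    rw [hn, Function.iterate_minimalPeriod, C.ret_emb, ← hn] at this
    exact this.symm
  refine le_antisymm ?_ (h2.minimalPeriod_le h1)
  by_contra! h3
  obtain ⟨j, hj, hv, hj'⟩ := C.exists_visits_eq x h3
  rw [Function.iterate_minimalPeriod] at hj'
  have : j = 0 := Function.iterate_injOn_Iio_minimalPeriod (f := D.next) (x := C.emb x)
    (by exact hj) (by exact hn0) hj'.symm
  rw [this] at hv
  exact (D₀.minimalPeriod_pos x).ne hv

theorem necklaceAt_emb [Finite ι] [Finite κ] (x : κ) :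
    D.necklaceAt (C.emb x) = D₀.necklaceAt x := by
  refine congrArg (Quot.mk _) (ClosedPath.ext (congrArg labelSrc (C.label_emb x)) ?_)
  exact (C.wordFrom_emb x _).trans (congrArg _ (C.visits_minimalPeriod x))

theorem sameCycle_emb_iff [Finite ι] [Finite κ] {x y : κ} :
    D.next.SameCycle (C.emb x) (C.emb y) ↔ D₀.next.SameCycle x y := by
  constructor
  · intro h
    obtain ⟨n, hn⟩ := exists_iterate_eq h
    have := C.ret_iterate x n
    rw [hn, C.ret_emb] at this
    rw [this]
    exact sameCycle_iterate _ _ _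
  · intro h
    obtain ⟨n, rfl⟩ := exists_iterate_eq h
    clear h
    induction n with
    | zero => exact Equiv.Perm.SameCycle.refl _ _
    | succ n ih =>
      obtain ⟨m, hm⟩ := C.exists_iterate_eq_emb_next (D₀.next^[n] x)
      rw [Function.iterate_succ_apply', ← hm]
      exact ih.trans (sameCycle_iterate _ _ _)

/-- Every cycle of `D` contains a remaining place, so the cycles of both diagrams correspond, and
deleted idempotents do not change the words read along them. -/
theorem collection_eq [Finite ι] [Finite κ] : D.collection = D₀.collection := by
  let : Fintype (Quotient (Equiv.Perm.SameCycle.setoid D₀.next)) := Fintype.ofFinite _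
  rw [D.collection_eq_map
    fun o : Quotient (Equiv.Perm.SameCycle.setoid D₀.next) => C.emb o.out]
  · unfold collection
    exact Multiset.map_congr rfl fun o _ => C.necklaceAt_emb _
  · constructor
    · intro o o' h
      have := C.sameCycle_emb_iff.1 (cycleOf_eq_iff.1 h)
      rw [← Quotient.out_eq o, ← Quotient.out_eq o']
      exact Quotient.sound this
    · intro q
      refine ⟨D₀.cycleOf (C.ret q.out), ?_⟩
      refine Eq.trans (cycleOf_eq_iff.2 ?_) (Quotient.out_eq q)
      obtain ⟨n, hn⟩ := C.exists_iterate_eq_emb_ret q.out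
      have h1 : D.next.SameCycle q.out (C.emb (C.ret q.out)) := by
        rw [← hn]; exact sameCycle_iterate _ _ _
      refine Equiv.Perm.SameCycle.trans ?_ h1.symm
      exact C.sameCycle_emb_iff.2 (cycleOf_eq_iff.1 (Quotient.out_eq _))

end Contraction

end Diagram

end Contraction

/-! ### Every diagram is equivalent to the standard diagram of its collection -/

section Normalization

variable {E : Type w} {V : Type u} [EdgeSet E V]

/-- The necklace of a closed path. -/
def Necklace.mk (p : ClosedPath E) : Necklace E := Quot.mk _ p

namespace Diagram

variable {ι κ : Type}

/-- The diagram `D` with an idempotent inserted in front of every place. -/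
def pad (D : Diagram E ι) : Diagram E (ι × Bool) where
  label x := if x.2 then D.label x.1 else .inr (labelSrc (D.label x.1))
  next :=
    { toFun := fun x => if x.2 then (D.next x.1, false) else (x.1, true)
      invFun := fun x => if x.2 then (x.1, false) else (D.next.symm x.1, true)
      left_inv := by rintro ⟨x, _ | _⟩ <;> simp
      right_inv := by rintro ⟨x, _ | _⟩ <;> simp }
  compat := by
    rintro ⟨x, _ | _⟩
    · rfl
    · exact D.compat x

theorem pad_next_true (D : Diagram E ι) (x : ι) : D.pad.next (x, true) = (D.next x, false) := rfl

theorem pad_next_false (D : Diagram E ι) (x : ι) : D.pad.next (x, false) = (x, true) := rfl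

theorem pad_iterate (D : Diagram E ι) (x : ι) (n : ℕ) :
    D.pad.next^[2 * n] (x, false) = (D.next^[n] x, false) := by
  induction n with
  | zero => rfl
  | succ n ih =>
    rw [mul_add, mul_one, Function.iterate_succ_apply', Function.iterate_succ_apply', ih,
      Function.iterate_succ_apply', pad_next_false, pad_next_true]

/-- The padded diagram contracts to the original one. -/
def contractionPad (D : Diagram E ι) : Contraction D D.pad where
  emb x := (x, true)
  ret x := x.1
  ret_emb _ := rfl
  label_emb _ := rfl
  ret_next_emb _ := rfl
  ret_next := by
    rintro ⟨y, _ | _⟩ h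
    · rfl
    · exact absurd rfl (h y)
  not_isEdge := by
    rintro ⟨y, _ | _⟩ h ⟨a, ha⟩
    · cases ha
    · exact absurd rfl (h y)
  reach := by
    rintro ⟨y, _ | _⟩
    · exact ⟨1, y, rfl⟩
    · exact ⟨0, y, rfl⟩

theorem length_wordFrom_mono (D : Diagram E ι) (x : ι) :
    Monotone fun n => (D.wordFrom x n).length :=
  monotone_nat_of_le_succ fun n => by
    simp only [wordFrom_succ, List.length_append]; exact Nat.le_add_right _ _

theorem length_wordFrom_succ_of_isEdge (D : Diagram E ι) {x : ι} {n : ℕ}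
    (h : D.IsEdge (D.next^[n] x)) :
    (D.wordFrom x (n + 1)).length = (D.wordFrom x n).length + 1 := by
  obtain ⟨a, ha⟩ := h
  simp [wordFrom_succ, ha]

theorem wordFrom_succ_of_not_isEdge (D : Diagram E ι) {x : ι} {n : ℕ}
    (h : ¬ D.IsEdge (D.next^[n] x)) : D.wordFrom x (n + 1) = D.wordFrom x n := by
  rw [wordFrom_succ]
  cases hl : D.label (D.next^[n] x) with
  | inl a => exact absurd ⟨a, hl⟩ h
  | inr a => simp

/-- The place of the `j`-th edge of the word that is read from a place. -/
theorem exists_place_of_lt_length (D : Diagram E ι) (x : ι) {n j : ℕ}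
    (h : j < (D.wordFrom x n).length) :
    ∃ q < n, (D.wordFrom x q).length = j ∧ D.label (D.next^[q] x) = .inl (D.wordFrom x n)[j] := by
  induction n with
  | zero => exact absurd h (Nat.not_lt_zero _)
  | succ n ih =>
    by_cases hj : j < (D.wordFrom x n).length
    · obtain ⟨q, hq, h1, h2⟩ := ih hj
      refine ⟨q, hq.trans n.lt_succ_self, h1, h2.trans (congrArg _ ?_)⟩
      simp only [wordFrom_succ, List.getElem_append_left hj]
    · by_cases he : D.IsEdge (D.next^[n] x)
      · have hl := D.length_wordFrom_succ_of_isEdge he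
        have hj' : j = (D.wordFrom x n).length := by omega
        subst hj'
        obtain ⟨a, ha⟩ := he
        refine ⟨n, n.lt_succ_self, rfl, ?_⟩
        simp [wordFrom_succ, ha]
      · exact absurd (by rwa [D.wordFrom_succ_of_not_isEdge he] at h) hj

theorem eq_of_length_wordFrom_eq (D : Diagram E ι) {x : ι} {m n : ℕ}
    (h : (D.wordFrom x m).length = (D.wordFrom x n).length) (hm : D.IsEdge (D.next^[m] x))
    (hn : D.IsEdge (D.next^[n] x)) : m = n := by
  have h1 := D.length_wordFrom_succ_of_isEdge hm
  have h2 := D.length_wordFrom_succ_of_isEdge hn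
  rcases lt_trichotomy m n with h' | h' | h'
  · have : (D.wordFrom x (m + 1)).length ≤ (D.wordFrom x n).length := D.length_wordFrom_mono x h'
    omega
  · exact h'
  · have : (D.wordFrom x (n + 1)).length ≤ (D.wordFrom x m).length := D.length_wordFrom_mono x h'
    omega

/-- The closed paths read from the places of one cycle are closed under rotation. Hence every
representative of the necklace, not just some rotation of it, is literally read from some place. -/
theorem exists_iterate_of_mk_eq [Finite ι] (D : Diagram E ι) (x : ι) {p : ClosedPath E}
    (h : Necklace.mk p = D.necklaceAt x) : ∃ m, D.closedPathAt (D.next^[m] x) = p := by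
  have step : ∀ p q : ClosedPath E, p.Rotated q →
      (∃ m, D.closedPathAt (D.next^[m] x) = p) → ∃ m, D.closedPathAt (D.next^[m] x) = q := by
    rintro p q ⟨l₁, l₂, h1, h2, h3, h4⟩ ⟨m, hm⟩
    set y := D.next^[m] x with hy
    set n := Function.minimalPeriod D.next y with hn
    have hw : D.wordFrom y n = l₁ ++ l₂ := by rw [← h3, ← hm]; rfl
    -- Each step adds at most one letter, so every prefix of the word is read after some number of
    -- steps. Idempotents make this number non-unique, but the vertex reached is determined by the
    -- prefix.
    obtain ⟨q', hq', hl⟩ : ∃ k ≤ n, D.wordFrom y k = l₁ := by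
      clear_value n
      clear hn h3 h4 h2
      induction n generalizing l₂ with
      | zero =>
        refine ⟨0, le_rfl, ?_⟩
        have : ([] : List E) = l₁ ++ l₂ := hw
        have := List.append_eq_nil_iff.1 this.symm
        rw [this.1]; rfl
      | succ n ih =>
        rcases List.eq_nil_or_concat l₂ with rfl | ⟨l', a, rfl⟩
        · exact ⟨n + 1, le_rfl, by rw [hw, List.append_nil]⟩
        · by_cases he : D.IsEdge (D.next^[n] y)
          · obtain ⟨b, hb⟩ := he
            rw [wordFrom_succ, hb, List.concat_eq_append, ← List.append_assoc] at hw
            obtain ⟨k, hk, h⟩ := ih l' (List.append_inj_left' hw rfl)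
            exact ⟨k, hk.trans n.le_succ, h⟩
          · rw [D.wordFrom_succ_of_not_isEdge he] at hw
            obtain ⟨k, hk, h⟩ := ih _ hw
            exact ⟨k, hk.trans n.le_succ, h⟩
    obtain ⟨r, hr⟩ := Nat.exists_eq_add_of_le hq'
    refine ⟨q' + m, ClosedPath.ext ?_ ?_⟩
    · have := D.isPath_wordFrom y q'
      have hb : labelSrc (D.label y) = p.base := congrArg ClosedPath.base hm
      rw [hl, hb] at this
      rw [Function.iterate_add_apply]
      exact this.right_unique h1
    · change D.wordFrom _ _ = _
      rw [Function.iterate_add_apply, ← hy, minimalPeriod_iterate, ← hn, hr, add_comm, wordFrom_add,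
        h4]
      have e : D.next^[r] (D.next^[q'] y) = y := by
        rw [← Function.iterate_add_apply, add_comm, ← hr, hn, Function.iterate_minimalPeriod]
      rw [e, hl]
      rw [hr, wordFrom_add, hl] at hw
      rw [List.append_cancel_left hw]
  -- Equality in `Quot` is the generated equivalence relation; no proof that `Rotated` is transitive
  -- is needed.
  have key : ∀ p q : ClosedPath E, Relation.EqvGen ClosedPath.Rotated p q →
      ((∃ m, D.closedPathAt (D.next^[m] x) = p) ↔ ∃ m, D.closedPathAt (D.next^[m] x) = q) := by
    intro p q h
    induction h with
    | rel p q h => exact ⟨step p q h, step q p h.symm⟩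
    | refl p => exact Iff.rfl
    | symm p q _ ih => exact ih.symm
    | trans p q r _ _ ih ih' => exact ih.trans ih'
  exact (key p _ (Quot.eqvGen_exact h)).2 ⟨0, rfl⟩

theorem ofPaths_next_iterate (L : List (ClosedPath E)) (i : Fin L.length) {n : ℕ}
    (hn : n < (L.get i).word.length + 1) :
    (ofPaths L).next^[n] ⟨i, 0⟩ = ⟨i, ⟨n, hn⟩⟩ := by
  induction n with
  | zero => rfl
  | succ n ih =>
    rw [Function.iterate_succ_apply', ih (Nat.lt_of_succ_lt hn)]
    exact congrArg (Sigma.mk i) (finRotate_of_lt (Nat.lt_of_succ_lt_succ hn))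

theorem minimalPeriod_ofPaths (L : List (ClosedPath E)) (i : Fin L.length) :
    Function.minimalPeriod (ofPaths L).next ⟨i, 0⟩ = (L.get i).word.length + 1 := by
  apply le_antisymm
  · refine Function.IsPeriodicPt.minimalPeriod_le (Nat.succ_pos _) ?_
    change (ofPaths L).next^[_ + 1] _ = _
    rw [Function.iterate_succ_apply', ofPaths_next_iterate L i (Nat.lt_succ_self _)]
    exact congrArg (Sigma.mk i) finRotate_last
  · by_contra! h
    have h1 := ofPaths_next_iterate L i h
    rw [Function.iterate_minimalPeriod] at h1
    have h2 : (0 : ℕ) = _ :=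
      congrArg (fun x : Σ i : Fin L.length, Fin ((L.get i).word.length + 1) => (x.2 : ℕ)) h1
    exact ((ofPaths L).minimalPeriod_pos ⟨i, 0⟩).ne h2

theorem closedPathAt_ofPaths (L : List (ClosedPath E)) (i : Fin L.length) :
    (ofPaths L).closedPathAt ⟨i, 0⟩ = L.get i := by
  refine ClosedPath.ext rfl ?_
  change (ofPaths L).wordFrom _ _ = _
  rw [minimalPeriod_ofPaths]
  have : ∀ n ≤ (L.get i).word.length,
      (ofPaths L).wordFrom ⟨i, 0⟩ (n + 1) = (L.get i).word.take n := by
    intro n hn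
    induction n with
    | zero => rfl
    | succ n ih =>
      rw [wordFrom_succ, ih (Nat.le_of_succ_le hn),
        ofPaths_next_iterate L i (Nat.succ_lt_succ hn), List.take_add_one]
      congr 1
      rw [List.getElem?_eq_getElem hn]
      rfl
  rw [this _ le_rfl, List.take_length]

theorem collection_ofPaths (L : List (ClosedPath E)) :
    (ofPaths L).collection = (L.map Necklace.mk : List (Necklace E)) := by
  rw [(ofPaths L).collection_eq_map
    fun i : Fin L.length => (⟨i, 0⟩ : Σ i : Fin L.length, Fin ((L.get i).word.length + 1))]
  · have h : ∀ i : Fin L.length, (ofPaths L).necklaceAt ⟨i, 0⟩ = Necklace.mk (L.get i) :=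
      fun i => congrArg Necklace.mk (closedPathAt_ofPaths L i)
    simp only [h]
    rw [Fin.univ_val_map]
    conv_rhs => rw [← List.ofFn_get L]
    rw [List.map_ofFn]
    rfl
  · constructor
    · intro i j h
      obtain ⟨n, hn⟩ := exists_iterate_eq (cycleOf_eq_iff.1 h)
      have : ∀ n (y : Σ i : Fin L.length, Fin ((L.get i).word.length + 1)),
          ((ofPaths L).next^[n] y).1 = y.1 := by
        intro n y
        induction n with
        | zero => rfl
        | succ n ih => rw [Function.iterate_succ_apply', ← ih]; rfl
      exact (this n ⟨i, 0⟩).symm.trans (congrArg Sigma.fst hn)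
    · intro q
      refine ⟨q.out.1, Eq.trans (cycleOf_eq_iff.2 ?_) (Quotient.out_eq q)⟩
      have := ofPaths_next_iterate L q.out.1 q.out.2.2
      exact ⟨q.out.2, by rw [zpow_natCast, Equiv.Perm.coe_pow]; exact this⟩

end Diagram

theorem mk_repr (s : Multiset (Necklace E)) : (repr s).map Necklace.mk = s.toList := by
  refine (List.map_map ..).trans ?_
  conv_rhs => rw [← List.map_id s.toList]
  exact List.map_congr_left fun n _ => Quot.out_eq n

theorem collection_diagram (s : Multiset (Necklace E)) : (diagram s).collection = s := by
  rw [diagram, Diagram.collection_ofPaths, mk_repr, Multiset.coe_toList]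

/-- Equal multisets of values mean fibres of equal cardinality; bijections between the fibres are
glued. -/
theorem exists_equiv_of_map_univ_eq {α β γ : Type*} [Fintype α] [Fintype β] {f : α → γ}
    {g : β → γ} (h : (Finset.univ : Finset α).val.map f = (Finset.univ : Finset β).val.map g) :
    ∃ e : α ≃ β, ∀ a, g (e a) = f a := by
  classical
  have hc : ∀ c, Nonempty ({a // f a = c} ≃ {b // g b = c}) := by
    intro c
    refine ⟨Fintype.equivOfCardEq ?_⟩
    have := congrArg (Multiset.count c) h
    rw [Multiset.count_map, Multiset.count_map] at this
    rw [Fintype.card_subtype, Fintype.card_subtype]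
    simp only [eq_comm (a := c)] at this
    exact this
  exact ⟨Equiv.ofFiberEquiv fun c => (hc c).some, fun a => Equiv.ofFiberEquiv_map _ a⟩

namespace Diagram

variable {ι : Type}

/-- The list of closed paths `L` describes the cycles of `D`, starting at the places `x`. -/
structure Marking (D : Diagram E ι) (L : List (ClosedPath E)) where
  /-- initial place of a closed path -/
  start : Fin L.length → ι
  /-- the closed path through a place -/
  idx : ι → Fin L.length
  /-- the position of a place on its closed path -/
  pos : ι → ℕ
  closedPathAt_start : ∀ i, D.closedPathAt (start i) = L.get i
  iterate_pos : ∀ y, D.next^[pos y] (start (idx y)) = y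
  idx_iterate : ∀ i n, idx (D.next^[n] (start i)) = i
  pos_iterate : ∀ i n, n < Function.minimalPeriod D.next (start i) →
    pos (D.next^[n] (start i)) = n

/-- Equality of multisets matches the cycles with the listed paths, and `exists_iterate_of_mk_eq`
supplies on each cycle a starting place from which the listed representative is read. Positions are
taken modulo the period. -/
theorem exists_marking [Finite ι] (D : Diagram E ι) {L : List (ClosedPath E)}
    (h : D.collection = (L.map Necklace.mk : List (Necklace E))) : Nonempty (D.Marking L) := by
  let : Fintype (Quotient (Equiv.Perm.SameCycle.setoid D.next)) := Fintype.ofFinite _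
  have h' : D.collection = (Finset.univ : Finset (Fin L.length)).val.map
      fun i => Necklace.mk (L.get i) := by
    rw [h, Fin.univ_val_map]
    conv_lhs => rw [← List.ofFn_get L]
    rw [List.map_ofFn]
    rfl
  obtain ⟨e, he⟩ := exists_equiv_of_map_univ_eq h'.symm
  have hs : ∀ i, ∃ x, D.closedPathAt x = L.get i ∧ D.cycleOf x = e i := by
    intro i
    obtain ⟨m, hm⟩ := D.exists_iterate_of_mk_eq (e i).out (he i).symm
    exact ⟨_, hm, (cycleOf_eq_iff.2 (sameCycle_iterate _ _ m).symm).trans (Quotient.out_eq _)⟩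
  choose start hs1 hs2 using hs
  have hp : ∀ y, ∃ n < Function.minimalPeriod D.next (start (e.symm (D.cycleOf y))),
      D.next^[n] (start (e.symm (D.cycleOf y))) = y := by
    intro y
    have := (hs2 (e.symm (D.cycleOf y))).trans (e.apply_symm_apply _)
    obtain ⟨n, hn⟩ := exists_iterate_eq (cycleOf_eq_iff.1 this)
    refine ⟨n % _, Nat.mod_lt n (D.minimalPeriod_pos _), ?_⟩
    rw [Function.iterate_mod_minimalPeriod_eq, hn]
  choose pos hpos1 hpos2 using hp
  have hi : ∀ i n, e.symm (D.cycleOf (D.next^[n] (start i))) = i := by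
    intro i n
    rw [Equiv.symm_apply_eq, ← hs2, cycleOf_eq_iff]
    exact (sameCycle_iterate _ _ _).symm
  refine ⟨⟨start, fun y => e.symm (D.cycleOf y), pos, hs1, hpos2, hi, fun i n hn => ?_⟩⟩
  have h1 := hpos1 (D.next^[n] (start i))
  have h2 := hpos2 (D.next^[n] (start i))
  rw [hi] at h1 h2
  exact Function.iterate_injOn_Iio_minimalPeriod (by exact h1) (by exact hn) h2

namespace Marking

variable {D : Diagram E ι} {L : List (ClosedPath E)} (M : D.Marking L)

include M

theorem word_eq (i : Fin L.length) : (L.get i).word =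
    D.wordFrom (M.start i) (Function.minimalPeriod D.next (M.start i)) := by
  rw [← M.closedPathAt_start]
  rfl

theorem pos_lt [Finite ι] (y : ι) :
    M.pos y < Function.minimalPeriod D.next (M.start (M.idx y)) := by
  have h := Nat.mod_lt (M.pos y) (D.minimalPeriod_pos (M.start (M.idx y)))
  have h1 := M.pos_iterate (M.idx y) _ h
  rw [Function.iterate_mod_minimalPeriod_eq, M.iterate_pos] at h1
  rwa [← h1] at h

theorem length_le (i : Fin L.length) {n : ℕ}
    (hn : n ≤ Function.minimalPeriod D.next (M.start i)) :
    (D.wordFrom (M.start i) n).length < (L.get i).word.length + 1 := by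
  rw [M.word_eq]
  exact Nat.lt_succ_of_le (D.length_wordFrom_mono _ hn)

theorem exists_place (i : Fin L.length) (j : Fin (L.get i).word.length) :
    ∃ q < Function.minimalPeriod D.next (M.start i), (D.wordFrom (M.start i) q).length = j ∧
      D.label (D.next^[q] (M.start i)) = .inl ((L.get i).word.get j) := by
  have hj : (j : ℕ) < (D.wordFrom (M.start i)
      (Function.minimalPeriod D.next (M.start i))).length := by
    rw [← M.word_eq]; exact j.2
  obtain ⟨q, hq, h1, h2⟩ := D.exists_place_of_lt_length _ hj
  refine ⟨q, hq, h1, h2.trans (congrArg _ ?_)⟩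
  exact (List.getElem_of_eq (M.word_eq i) j.2).symm

/-- The position of the `j`-th edge of a closed path. -/
noncomputable def place (i : Fin L.length) (j : Fin (L.get i).word.length) : ℕ :=
  (M.exists_place i j).choose

theorem place_lt (i : Fin L.length) (j : Fin (L.get i).word.length) :
    M.place i j < Function.minimalPeriod D.next (M.start i) :=
  (M.exists_place i j).choose_spec.1

theorem length_place (i : Fin L.length) (j : Fin (L.get i).word.length) :
    (D.wordFrom (M.start i) (M.place i j)).length = j :=
  (M.exists_place i j).choose_spec.2.1

theorem label_place (i : Fin L.length) (j : Fin (L.get i).word.length) :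
    D.label (D.next^[M.place i j] (M.start i)) = .inl ((L.get i).word.get j) :=
  (M.exists_place i j).choose_spec.2.2

theorem place_eq [Finite ι] {y : ι} (hy : D.IsEdge y) :
    ∃ j, D.next^[M.place (M.idx y) j] (M.start (M.idx y)) = y := by
  have hy' : D.IsEdge (D.next^[M.pos y] (M.start (M.idx y))) := by rwa [M.iterate_pos]
  have h := D.length_wordFrom_succ_of_isEdge hy'
  have h' := M.length_le (M.idx y) (M.pos_lt y)
  rw [h] at h'
  let j : Fin (L.get (M.idx y)).word.length := ⟨_, Nat.lt_of_succ_lt_succ h'⟩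
  refine ⟨j, ?_⟩
  rw [D.eq_of_length_wordFrom_eq (M.length_place _ j) ⟨_, M.label_place _ j⟩ hy', M.iterate_pos]

/-- The position that follows the first `n` places of a closed path. -/
def slot (i : Fin L.length) (n : ℕ) (hn : n ≤ Function.minimalPeriod D.next (M.start i)) :
    Fin ((L.get i).word.length + 1) :=
  ⟨(D.wordFrom (M.start i) n).length, M.length_le i hn⟩

theorem finRotate_slot_last (i : Fin L.length) :
    finRotate _ (M.slot i _ le_rfl) = 0 := by
  have : M.slot i _ le_rfl = Fin.last _ := Fin.ext (congrArg List.length (M.word_eq i).symm)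
  rw [this, finRotate_last]

/-- The place of the diagram of `L` at or after a place of the padded diagram. -/
def ret [Finite ι] (y : ι × Bool) : Σ i : Fin L.length, Fin ((L.get i).word.length + 1) :=
  -- The idempotent inserted before the starting place stands for the base vertex, place 0.
  -- Elsewhere `slot` counts the edges already passed, and `finRotate` turns this count `m` into
  -- place `m + 1`, the next edge, or back into the base vertex when all edges have been passed.
  ⟨M.idx y.1, if y.2 = false ∧ M.pos y.1 = 0 then 0 else
    finRotate _ (M.slot _ (M.pos y.1) (M.pos_lt y.1).le)⟩

/-- The value `n` equal to the period is allowed so that closing up the cycle needs no separate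
treatment; for `n = 0` the formula would be off, since the base vertex itself is not yet passed. -/
theorem ret_false [Finite ι] (i : Fin L.length) {n : ℕ}
    (hn : n ≤ Function.minimalPeriod D.next (M.start i)) (h0 : n ≠ 0) :
    M.ret (D.next^[n] (M.start i), false) = ⟨i, finRotate _ (M.slot i n hn)⟩ := by
  rcases hn.lt_or_eq with h | rfl
  · have h1 := M.idx_iterate i n
    have h2 := M.pos_iterate i n h
    unfold ret
    rw [if_neg (by rw [h2]; exact fun h => h0 h.2)]
    generalize D.next^[n] (M.start i) = y at *
    subst h1
    subst h2
    rfl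
  · rw [M.finRotate_slot_last, Function.iterate_minimalPeriod]
    have h1 := M.idx_iterate i 0
    have h2 := M.pos_iterate i 0 (D.minimalPeriod_pos _)
    unfold ret
    rw [if_pos ⟨rfl, h2⟩]
    have h1 : M.idx (M.start i) = i := h1
    change (⟨M.idx (M.start i), 0⟩ : Σ i : Fin L.length, Fin ((L.get i).word.length + 1)) = _
    rw [h1]

theorem ret_true [Finite ι] (i : Fin L.length) {n : ℕ}
    (hn : n < Function.minimalPeriod D.next (M.start i)) :
    M.ret (D.next^[n] (M.start i), true) = ⟨i, finRotate _ (M.slot i n hn.le)⟩ := by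
  have h1 := M.idx_iterate i n
  have h2 := M.pos_iterate i n hn
  unfold ret
  rw [if_neg (fun h => Bool.noConfusion h.1)]
  generalize D.next^[n] (M.start i) = y at *
  subst h1
  subst h2
  rfl

theorem ret_start [Finite ι] (i : Fin L.length) : M.ret (M.start i, false) = ⟨i, 0⟩ := by
  have h := M.ret_false i le_rfl (D.minimalPeriod_pos _).ne'
  rwa [M.finRotate_slot_last, Function.iterate_minimalPeriod] at h

theorem finRotate_slot_place (i : Fin L.length) (j : Fin (L.get i).word.length) :
    finRotate _ (M.slot i _ (M.place_lt i j).le) = j.succ := by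
  have : M.slot i _ (M.place_lt i j).le = j.castSucc := Fin.ext (M.length_place i j)
  rw [this]
  exact finRotate_of_lt j.2

theorem slot_succ_place (i : Fin L.length) (j : Fin (L.get i).word.length) :
    M.slot i _ (M.place_lt i j) = j.succ := by
  refine Fin.ext ?_
  refine (D.length_wordFrom_succ_of_isEdge ⟨_, M.label_place i j⟩).trans ?_
  rw [M.length_place]
  rfl

/-- The padded diagram contracts to the diagram of any list of closed paths that describes the
cycles of the original one. -/
noncomputable def contraction [Finite ι] : Contraction (ofPaths L) D.pad where
  -- The base vertex goes to the idempotent inserted before the starting place, an edge to its own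
  -- place. This is why padding is needed: `D` itself may have no idempotent there.
  emb x := Fin.cases (motive := fun _ => ι × Bool) (M.start x.1, false)
    (fun j => (D.next^[M.place x.1 j] (M.start x.1), true)) x.2
  ret := M.ret
  ret_emb := by
    rintro ⟨i, j⟩
    refine Fin.cases ?_ (fun j => ?_) j
    · exact M.ret_start i
    · exact (M.ret_true i (M.place_lt i j)).trans (by rw [M.finRotate_slot_place])
  label_emb := by
    rintro ⟨i, j⟩
    refine Fin.cases ?_ (fun j => ?_) j
    · exact congrArg Sum.inr (congrArg ClosedPath.base (M.closedPathAt_start i))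
    · exact M.label_place i j
  ret_next_emb := by
    rintro ⟨i, j⟩
    refine Fin.cases ?_ (fun j => ?_) j
    · exact M.ret_true i (D.minimalPeriod_pos _)
    · change M.ret (D.next (D.next^[M.place i j] (M.start i)), false) = _
      rw [← Function.iterate_succ_apply' (f := D.next), M.ret_false i (M.place_lt i j)
        (Nat.succ_ne_zero _), M.slot_succ_place]
      rfl
  ret_next := by
    rintro ⟨y, b⟩ h
    have hl := M.pos_lt y
    have hy := M.iterate_pos y
    cases b with
    | false =>
      have h0 : M.pos y ≠ 0 := by
        intro h0
        rw [h0] at hy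
        exact h ⟨M.idx y, 0⟩ (congrArg (fun y => (y, false)) hy)
      rw [pad_next_false, ← hy, M.ret_true _ hl, M.ret_false _ hl.le h0]
    | true =>
      have he : ¬ D.IsEdge (D.next^[M.pos y] (M.start (M.idx y))) := by
        rw [hy]
        intro he
        obtain ⟨j, hj⟩ := M.place_eq he
        exact h ⟨M.idx y, j.succ⟩ (congrArg (fun y => (y, true)) hj)
      rw [pad_next_true, ← hy, ← Function.iterate_succ_apply' (f := D.next), M.ret_true _ hl,
        M.ret_false _ hl (Nat.succ_ne_zero _)]
      congr 2
      exact Fin.ext (congrArg List.length (D.wordFrom_succ_of_not_isEdge he))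
  not_isEdge := by
    rintro ⟨y, _ | _⟩ h ⟨a, ha⟩
    · cases ha
    · obtain ⟨j, hj⟩ := M.place_eq ⟨a, ha⟩
      exact h ⟨M.idx y, j.succ⟩ (congrArg (fun y => (y, true)) hj)
  reach := by
    have key : ∀ y, ∃ n, D.pad.next^[n] (y, false) = (M.start (M.idx y), false) := by
      intro y
      obtain ⟨r, hr⟩ := Nat.exists_eq_add_of_le (M.pos_lt y).le
      refine ⟨2 * r, (D.pad_iterate y r).trans ?_⟩
      conv_lhs => rw [← M.iterate_pos y]
      rw [← Function.iterate_add_apply, add_comm, ← hr, Function.iterate_minimalPeriod]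
    rintro ⟨y, _ | _⟩
    · obtain ⟨n, hn⟩ := key y
      exact ⟨n, ⟨M.idx y, 0⟩, hn⟩
    · obtain ⟨n, hn⟩ := key (D.next y)
      exact ⟨n + 1, ⟨M.idx (D.next y), 0⟩, hn⟩

end Marking

/-- Every diagram is related by contractions to the standard diagram of its collection. -/
theorem nonempty_contraction_diagram [Finite ι] (D : Diagram E ι) :
    Nonempty (Contraction (diagram D.collection) D.pad) := by
  obtain ⟨M⟩ := D.exists_marking (L := repr D.collection)
    (by rw [mk_repr, Multiset.coe_toList])
  exact ⟨M.contraction⟩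

/-- A quantity that is invariant under contractions depends only on the collection. -/
theorem eq_of_contraction_invariant {α : Type*} (F : ∀ (ι : Type) [Fintype ι], Diagram E ι → α)
    (hF : ∀ (ι κ : Type) [Fintype ι] [Fintype κ] (D₀ : Diagram E κ) (D : Diagram E ι),
      Contraction D₀ D → F ι D = F κ D₀)
    [Fintype ι] (D : Diagram E ι) : F _ (diagram D.collection) = F ι D := by
  obtain ⟨C⟩ := D.nonempty_contraction_diagram
  rw [← hF _ _ _ _ C, hF _ _ _ _ D.contractionPad]

end Diagram

end Normalization

/-! ### Composition of cuttings and the addition of weights -/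

section Cuttings

variable {V : Type u} [Quiver.{v} V]

namespace Diagram

variable {ι κ : Type}

/-- The cuttings of a diagram. -/
abbrev Cutting (D : Diagram (DEdge V) ι) : Type := {φ : Equiv.Perm ι // D.IsCutting φ}

noncomputable instance [Finite ι] (D : Diagram (DEdge V) ι) : Fintype D.Cutting :=
  Fintype.ofFinite _

/-- Cutting and gluing along a cutting. -/
noncomputable abbrev cutAt (D : Diagram (DEdge V) ι) (φ : D.Cutting) : Diagram (DEdge V) ι :=
  D.cut φ.1 φ.2

theorem ext_of_eq {E : Type w} {V : Type u} [EdgeSet E V] {D D' : Diagram E ι}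
    (h : ∀ x, D.label x = D'.label x) (h' : ∀ x, D.next x = D'.next x) : D = D' := by
  cases D; cases D'
  cases funext h
  cases Equiv.ext h'
  rfl

namespace IsCutting

variable {D : Diagram (DEdge V) ι} {φ : Equiv.Perm ι} (h : D.IsCutting φ)

include h

theorem isEdge {x : ι} (hx : φ x ≠ x) : D.IsEdge x := by
  obtain ⟨a, ha, -⟩ := h.rev x hx
  exact ⟨a, ha⟩

theorem apply_ne {x : ι} (hx : φ x ≠ x) : φ (φ x) ≠ φ x := by
  rw [h.invol]
  exact hx.symm

theorem isQ_apply_iff {x : ι} (hx : φ x ≠ x) : D.IsQ (φ x) ↔ ¬ D.IsQ x := by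
  obtain ⟨a, ha, hb⟩ := h.rev x hx
  unfold IsQ
  rw [ha, hb]
  simp only [Sum.inl.injEq, exists_eq_left']
  cases a <;> simp [DEdge.star, DEdge.InQ]

end IsCutting

theorem isCutting_one (D : Diagram (DEdge V) ι) : D.IsCutting 1 :=
  ⟨fun _ => rfl, fun _ h => absurd rfl h⟩

theorem cut_one (D : Diagram (DEdge V) ι) : D.cut 1 D.isCutting_one = D :=
  ext_of_eq (fun _ => if_pos rfl) fun _ => rfl

theorem cutLabel_of_eq (D : Diagram (DEdge V) ι) {φ : Equiv.Perm ι} {x : ι} (h : φ x = x) :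
    D.cutLabel φ x = D.label x := if_pos h

theorem cutLabel_of_ne (D : Diagram (DEdge V) ι) {φ : Equiv.Perm ι} {x : ι} (h : φ x ≠ x) :
    D.cutLabel φ x = .inr (labelSrc (D.label x)) := if_neg h

theorem isQ_cutAt_iff (D : Diagram (DEdge V) ι) (φ : D.Cutting) (x : ι) :
    (D.cutAt φ).IsQ x ↔ φ.1 x = x ∧ D.IsQ x := by
  by_cases h : φ.1 x = x
  · have : (D.cutAt φ).label x = D.label x := D.cutLabel_of_eq h
    unfold IsQ
    rw [this]
    exact (and_iff_right h).symm
  · have : (D.cutAt φ).label x = .inr _ := D.cutLabel_of_ne h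
    unfold IsQ
    rw [this]
    simp [h]

theorem isEdge_cutAt_iff (D : Diagram (DEdge V) ι) (φ : D.Cutting) (x : ι) :
    (D.cutAt φ).IsEdge x ↔ φ.1 x = x ∧ D.IsEdge x := by
  by_cases h : φ.1 x = x
  · have : (D.cutAt φ).label x = D.label x := D.cutLabel_of_eq h
    unfold IsEdge
    rw [this]
    exact (and_iff_right h).symm
  · have : (D.cutAt φ).label x = .inr _ := D.cutLabel_of_ne h
    unfold IsEdge
    rw [this]
    simp [h]

theorem fix_of_ne {D : Diagram (DEdge V) ι} {φ : D.Cutting} (ψ : (D.cutAt φ).Cutting)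
    {x : ι} (h : ψ.1 x ≠ x) : φ.1 x = x :=
  ((D.isEdge_cutAt_iff φ x).1 (ψ.2.isEdge h)).1

/-- Two successive cuttings. -/
def Cutting.comp {D : Diagram (DEdge V) ι} (φ : D.Cutting) (ψ : (D.cutAt φ).Cutting) :
    D.Cutting where
  val := φ.1 * ψ.1
  property := by
    have h1 : ∀ x, ψ.1 x ≠ x → (φ.1 * ψ.1) x = ψ.1 x :=
      fun x hx => fix_of_ne ψ (ψ.2.apply_ne hx)
    have h2 : ∀ x, ψ.1 x = x → (φ.1 * ψ.1) x = φ.1 x := fun x hx => congrArg φ.1 hx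
    constructor
    · intro x
      by_cases hx : ψ.1 x = x
      · rw [h2 x hx]
        by_cases hx' : φ.1 x = x
        · rw [hx', h2 x hx, hx']
        · have : ψ.1 (φ.1 x) = φ.1 x := by
            by_contra h
            exact φ.2.apply_ne hx' (fix_of_ne ψ h)
          rw [h2 _ this, φ.2.invol]
      · rw [h1 x hx, h1 _ (ψ.2.apply_ne hx), ψ.2.invol]
    · intro x hx'
      by_cases hx : ψ.1 x = x
      · rw [h2 x hx] at hx' ⊢
        exact φ.2.rev x hx'
      · rw [h1 x hx]
        obtain ⟨a, ha, hb⟩ := ψ.2.rev x hx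
        exact ⟨a, (D.cutLabel_of_eq (fix_of_ne ψ hx)).symm.trans ha,
          (D.cutLabel_of_eq (fix_of_ne ψ (ψ.2.apply_ne hx))).symm.trans hb⟩

variable {D : Diagram (DEdge V) ι}

theorem Cutting.comp_of_ne (φ : D.Cutting) (ψ : (D.cutAt φ).Cutting) {x : ι} (h : ψ.1 x ≠ x) :
    (φ.comp ψ).1 x = ψ.1 x := fix_of_ne ψ (ψ.2.apply_ne h)

theorem Cutting.comp_of_eq (φ : D.Cutting) (ψ : (D.cutAt φ).Cutting) {x : ι} (h : ψ.1 x = x) :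
    (φ.comp ψ).1 x = φ.1 x := congrArg φ.1 h

theorem Cutting.comp_of_ne_left (φ : D.Cutting) (ψ : (D.cutAt φ).Cutting) {x : ι}
    (h : φ.1 x ≠ x) : (φ.comp ψ).1 x = φ.1 x :=
  φ.comp_of_eq ψ (by by_contra h'; exact h (fix_of_ne ψ h'))

theorem Cutting.comp_of_eq_left (φ : D.Cutting) (ψ : (D.cutAt φ).Cutting) {x : ι}
    (h : φ.1 x = x) : (φ.comp ψ).1 x = ψ.1 x := by
  by_cases h' : ψ.1 x = x
  · rw [φ.comp_of_eq ψ h', h, h']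
  · exact φ.comp_of_ne ψ h'

theorem cutAt_comp (φ : D.Cutting) (ψ : (D.cutAt φ).Cutting) :
    D.cutAt (φ.comp ψ) = (D.cutAt φ).cutAt ψ := by
  refine ext_of_eq (fun x => ?_) fun x => rfl
  by_cases h : ψ.1 x = x
  · refine Eq.trans ?_ ((D.cutAt φ).cutLabel_of_eq h).symm
    have h' := φ.comp_of_eq ψ h
    change D.cutLabel _ x = D.cutLabel _ x
    unfold cutLabel
    rw [h']
  · refine Eq.trans ?_ ((D.cutAt φ).cutLabel_of_ne h).symm
    have h' := φ.comp_of_ne ψ h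
    rw [show labelSrc ((D.cutAt φ).label x) = _ from D.labelSrc_cutLabel φ.1 x]
    exact D.cutLabel_of_ne (by rwa [h'])

/-- `φ` consists of some of the pairs of `θ`. -/
def Cutting.Sub (φ θ : D.Cutting) : Prop := ∀ x, φ.1 x ≠ x → θ.1 x = φ.1 x

theorem Cutting.sub_comp (φ : D.Cutting) (ψ : (D.cutAt φ).Cutting) : φ.Sub (φ.comp ψ) :=
  fun _ h => φ.comp_of_ne_left ψ h

theorem Cutting.comp_injective (φ : D.Cutting) : Function.Injective φ.comp := by
  intro ψ ψ' h
  have : φ.1 * ψ.1 = φ.1 * ψ'.1 := congrArg Subtype.val h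
  exact Subtype.ext (mul_left_cancel this)

/-- The remaining cutting is `φ * θ`: where `φ` moves a place the two involutions cancel, elsewhere
`φ` does nothing to the value of `θ`. -/
theorem Cutting.Sub.exists_comp_eq {φ θ : D.Cutting} (h : φ.Sub θ) : ∃ ψ, φ.comp ψ = θ := by
  have h1 : ∀ x, φ.1 x ≠ x → (φ.1 * θ.1) x = x := fun x hx => by
    rw [Equiv.Perm.mul_apply, h x hx, φ.2.invol]
  have h2 : ∀ x, φ.1 x = x → φ.1 (θ.1 x) = θ.1 x := fun x hx => by
    by_contra h'
    have := h _ h'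
    rw [θ.2.invol] at this
    have h'' : θ.1 x = x := by rw [← φ.2.invol (θ.1 x), ← this, hx]
    exact h' (by rw [h'', hx])
  have h3 : ∀ x, φ.1 x = x → (φ.1 * θ.1) x = θ.1 x := h2
  refine ⟨⟨φ.1 * θ.1, ?_, ?_⟩, Subtype.ext ?_⟩
  · intro x
    by_cases hx : φ.1 x = x
    · rw [h3 x hx, h3 _ (h2 x hx), θ.2.invol]
    · rw [h1 x hx, h1 x hx]
  · intro x hx
    have hx' : φ.1 x = x := by
      by_contra h'
      exact hx (h1 x h')
    rw [h3 x hx'] at hx ⊢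
    obtain ⟨a, ha, hb⟩ := θ.2.rev x hx
    exact ⟨a, (D.cutLabel_of_eq hx').trans ha, (D.cutLabel_of_eq (h2 x hx')).trans hb⟩
  · ext x
    change φ.1 (φ.1 (θ.1 x)) = θ.1 x
    rw [φ.2.invol]

variable [Fintype ι]

open scoped Classical in
/-- The abstract edges of `Q` that are moved by `φ`; there is one in every cut pair. -/
noncomputable def cutQ (D : Diagram (DEdge V) ι) (φ : Equiv.Perm ι) : Finset ι :=
  Finset.univ.filter fun x => φ x ≠ x ∧ D.IsQ x

theorem mem_cutQ {φ : Equiv.Perm ι} {x : ι} : x ∈ D.cutQ φ ↔ φ x ≠ x ∧ D.IsQ x := by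
  simp [cutQ]

theorem cutQ_one : D.cutQ 1 = ∅ := by
  ext x; simp [mem_cutQ]

/-- In every cut pair, one of the two edges belongs to `Q`. -/
theorem IsCutting.mem_cutQ_or {φ : Equiv.Perm ι} (h : D.IsCutting φ) {x : ι} (hx : φ x ≠ x) :
    x ∈ D.cutQ φ ∨ φ x ∈ D.cutQ φ := by
  rw [mem_cutQ, mem_cutQ, h.isQ_apply_iff hx]
  by_cases hq : D.IsQ x
  · exact .inl ⟨hx, hq⟩
  · exact .inr ⟨h.apply_ne hx, hq⟩

variable {R : Type*} [CommRing R]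

/-- The product of the weights of the pairs of a cutting; the weight of a pair is a function of
its edge in `Q` and of the reverse edge. -/
noncomputable def weight (D : Diagram (DEdge V) ι) (A : ι → ι → R) (φ : Equiv.Perm ι) : R :=
  ∏ x ∈ D.cutQ φ, A x (φ x)

theorem weight_one (A : ι → ι → R) : D.weight A 1 = 1 := by
  rw [weight, cutQ_one, Finset.prod_empty]

theorem weight_eq_zero {A : ι → ι → R} {φ : Equiv.Perm ι} {x : ι} (hx : x ∈ D.cutQ φ)
    (h : A x (φ x) = 0) : D.weight A φ = 0 := Finset.prod_eq_zero hx h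

theorem weight_congr {A B : ι → ι → R} {φ : Equiv.Perm ι}
    (h : ∀ x ∈ D.cutQ φ, A x (φ x) = B x (φ x)) : D.weight A φ = D.weight B φ :=
  Finset.prod_congr rfl h

open scoped Classical in
theorem cutQ_cutAt_disjoint (φ : D.Cutting) (ψ : (D.cutAt φ).Cutting) :
    (D.cutAt φ).cutQ ψ.1 = D.cutQ (φ.comp ψ).1 \ D.cutQ φ.1 := by
  ext x
  rw [Finset.mem_sdiff, mem_cutQ, mem_cutQ, mem_cutQ, isQ_cutAt_iff]
  by_cases h : φ.1 x = x
  · rw [φ.comp_of_eq_left ψ h]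
    tauto
  · rw [φ.comp_of_ne_left ψ h]
    tauto

theorem Cutting.Sub.cutQ_subset {φ θ : D.Cutting} (h : φ.Sub θ) : D.cutQ φ.1 ⊆ D.cutQ θ.1 := by
  intro x hx
  rw [mem_cutQ] at hx ⊢
  rw [h x hx.1]
  exact hx

open scoped Classical in
theorem weight_cutAt (φ : D.Cutting) (ψ : (D.cutAt φ).Cutting) (B : ι → ι → R) :
    (D.cutAt φ).weight B ψ.1 = ∏ x ∈ D.cutQ (φ.comp ψ).1 \ D.cutQ φ.1, B x ((φ.comp ψ).1 x) := by
  rw [weight, cutQ_cutAt_disjoint]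
  refine Finset.prod_congr rfl fun x hx => ?_
  rw [φ.comp_of_ne ψ]
  rw [← cutQ_cutAt_disjoint, mem_cutQ] at hx
  exact hx.1

theorem Cutting.Sub.weight_eq {φ θ : D.Cutting} (h : φ.Sub θ) (A : ι → ι → R) :
    D.weight A φ.1 = ∏ x ∈ D.cutQ φ.1, A x (θ.1 x) :=
  Finset.prod_congr rfl fun x hx => by rw [h x (mem_cutQ.1 hx).1]

/-- A pair of `θ` is determined by its edge in `Q`. Together with `Cutting.exists_sub`, sub-cuttings
of `θ` are the same as subsets of `cutQ θ`. -/
theorem Cutting.eq_of_sub_of_cutQ_eq {φ φ' θ : D.Cutting} (h : φ.Sub θ) (h' : φ'.Sub θ)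
    (hq : D.cutQ φ.1 = D.cutQ φ'.1) : φ = φ' := by
  have key : ∀ φ φ' : D.Cutting, φ.Sub θ → φ'.Sub θ → D.cutQ φ.1 = D.cutQ φ'.1 →
      ∀ x, φ.1 x ≠ x → φ.1 x = φ'.1 x := by
    intro φ φ' h h' hq x hx
    suffices hx' : φ'.1 x ≠ x by rw [← h x hx, h' x hx']
    rcases φ.2.mem_cutQ_or hx with h1 | h1 <;> rw [hq] at h1
    · exact (mem_cutQ.1 h1).1
    · have h2 := (mem_cutQ.1 h1).1
      have h3 := h' _ h2
      rw [← h x hx, θ.2.invol] at h3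
      intro h4
      rw [← h x hx] at h2 hx
      rw [← h3] at h2
      exact h2 (by rw [← φ'.2.invol (θ.1 x), ← h3, h4] at hx; exact absurd rfl hx)
  refine Subtype.ext (Equiv.ext fun x => ?_)
  by_cases hx : φ.1 x = x
  · by_cases hx' : φ'.1 x = x
    · rw [hx, hx']
    · exact (key φ' φ h' h hq.symm x hx').symm
  · exact key φ φ' h h' hq x hx

theorem Cutting.exists_sub (θ : D.Cutting) {s : Finset ι} (hs : s ⊆ D.cutQ θ.1) :
    ∃ φ : D.Cutting, φ.Sub θ ∧ D.cutQ φ.1 = s := by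
  classical
  let f : ι → ι := fun x => if x ∈ s ∨ θ.1 x ∈ s then θ.1 x else x
  have hf : Function.Involutive f := by
    intro x
    by_cases h : x ∈ s ∨ θ.1 x ∈ s
    · have e : f x = θ.1 x := if_pos h
      rw [e]
      have : θ.1 x ∈ s ∨ θ.1 (θ.1 x) ∈ s := by rwa [θ.2.invol, or_comm]
      exact (if_pos this).trans (θ.2.invol x)
    · have e : f x = x := if_neg h
      rw [e, e]
  have hne : ∀ x, Function.Involutive.toPerm f hf x ≠ x →
      (x ∈ s ∨ θ.1 x ∈ s) ∧ Function.Involutive.toPerm f hf x = θ.1 x := by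
    intro x hx
    have h : x ∈ s ∨ θ.1 x ∈ s := by
      by_contra h
      exact hx (if_neg h)
    exact ⟨h, if_pos h⟩
  refine ⟨⟨Function.Involutive.toPerm f hf, hf, fun x hx => ?_⟩, fun x hx => (hne x hx).2.symm, ?_⟩
  · obtain ⟨-, h2⟩ := hne x hx
    rw [h2] at hx ⊢
    exact θ.2.rev x hx
  · ext x
    rw [mem_cutQ]
    constructor
    · rintro ⟨h1, h2⟩
      obtain ⟨h3, h4⟩ := hne x h1
      refine h3.resolve_right fun h5 => ?_
      have := (mem_cutQ.1 (hs h5)).2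
      rw [θ.2.isQ_apply_iff (h4 ▸ h1)] at this
      exact this h2
    · intro hx
      have := mem_cutQ.1 (hs hx)
      refine ⟨?_, this.2⟩
      rw [show Function.Involutive.toPerm f hf x = θ.1 x from if_pos (.inl hx)]
      exact this.1

open scoped Classical in
/-- Pairs of successive cuttings are the same as cuttings with a distinguished part. -/
theorem sum_comp {M : Type*} [AddCommMonoid M] (G : D.Cutting → D.Cutting → M) :
    ∑ φ, ∑ ψ, G φ (φ.comp ψ) = ∑ θ, ∑ φ ∈ Finset.univ.filter fun φ => φ.Sub θ, G φ θ := by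
  have h : ∀ φ : D.Cutting, ∑ ψ, G φ (φ.comp ψ) =
      ∑ θ ∈ Finset.univ.filter fun θ => φ.Sub θ, G φ θ := by
    intro φ
    refine Finset.sum_bij (fun ψ _ => φ.comp ψ) ?_ ?_ ?_ ?_
    · intro ψ _
      exact Finset.mem_filter.2 ⟨Finset.mem_univ _, φ.sub_comp ψ⟩
    · intro ψ _ ψ' _ h
      exact φ.comp_injective h
    · intro θ hθ
      obtain ⟨ψ, h⟩ := (Finset.mem_filter.1 hθ).2.exists_comp_eq
      exact ⟨ψ, Finset.mem_univ _, h⟩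
    · intro ψ _
      rfl
  rw [Finset.sum_congr rfl fun φ _ => h φ]
  exact Finset.sum_comm' (by simp)

-- The expansion of the product of the factors `A + B` over the pairs of `θ` is indexed by subsets
-- of pairs, that is, by sub-cuttings.
open scoped Classical in
theorem sum_sub_weight (θ : D.Cutting) (A B : ι → ι → R) :
    ∑ φ ∈ Finset.univ.filter fun φ : D.Cutting => φ.Sub θ,
      D.weight A φ.1 * ∏ x ∈ D.cutQ θ.1 \ D.cutQ φ.1, B x (θ.1 x) =
      D.weight (A + B) θ.1 := by
  have h : D.weight (A + B) θ.1 = ∏ x ∈ D.cutQ θ.1, (A x (θ.1 x) + B x (θ.1 x)) := rfl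
  rw [h, Finset.prod_add]
  refine Finset.sum_bij (fun φ _ => D.cutQ φ.1) ?_ ?_ ?_ ?_
  · intro φ hφ
    exact Finset.mem_powerset.2 (Finset.mem_filter.1 hφ).2.cutQ_subset
  · intro φ hφ φ' hφ' h
    exact Cutting.eq_of_sub_of_cutQ_eq (Finset.mem_filter.1 hφ).2 (Finset.mem_filter.1 hφ').2 h
  · intro s hs
    obtain ⟨φ, h1, h2⟩ := θ.exists_sub (Finset.mem_powerset.1 hs)
    exact ⟨φ, Finset.mem_filter.2 ⟨Finset.mem_univ _, h1⟩, h2⟩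
  · intro φ hφ
    rw [(Finset.mem_filter.1 hφ).2.weight_eq]

/-- Weighted sum over all cuttings of a diagram. -/
noncomputable def cutSum {M : Type*} [AddCommGroup M] [Module R M] (D : Diagram (DEdge V) ι)
    (A : ι → ι → R) (T : D.Cutting → M) : M :=
  ∑ φ, D.weight A φ.1 • T φ

open scoped Classical in
/-- Cutting twice with weights `A` and `B` is cutting once with weight `A + B`. -/
theorem cutSum_cutSum {M : Type*} [AddCommGroup M] [Module R M] (A B : ι → ι → R)
    (T : D.Cutting → M) :
    D.cutSum A (fun φ => (D.cutAt φ).cutSum B fun ψ => T (φ.comp ψ)) = D.cutSum (A + B) T := by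
  have h : D.cutSum A (fun φ => (D.cutAt φ).cutSum B fun ψ => T (φ.comp ψ)) =
      ∑ φ : D.Cutting, ∑ ψ : (D.cutAt φ).Cutting,
        (fun (φ θ : D.Cutting) => (D.weight A φ.1 * ∏ x ∈ D.cutQ θ.1 \ D.cutQ φ.1,
          B x (θ.1 x)) • T θ) φ (φ.comp ψ) := by
    unfold cutSum
    refine Finset.sum_congr rfl fun φ _ => ?_
    rw [Finset.smul_sum]
    refine Finset.sum_congr rfl fun ψ _ => ?_
    rw [smul_smul, weight_cutAt]
  refine h.trans ((sum_comp fun φ θ : D.Cutting => (D.weight A φ.1 *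
    ∏ x ∈ D.cutQ θ.1 \ D.cutQ φ.1, B x (θ.1 x)) • T θ).trans ?_)
  unfold cutSum
  refine Finset.sum_congr rfl fun θ _ => ?_
  rw [← Finset.sum_smul, sum_sub_weight]

end Diagram

end Cuttings

/-! ### Juxtapositions, parts, and cuttings under contraction -/

namespace Diagram

section Sums

variable {E : Type w} {V : Type u} [EdgeSet E V] {ι κ ι' κ' : Type}

/-- Contractions of two diagrams give a contraction of their juxtaposition. -/
def Contraction.sum {D₀ : Diagram E κ} {D : Diagram E ι} {D₀' : Diagram E κ'} {D' : Diagram E ι'}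
    (C : Contraction D₀ D) (C' : Contraction D₀' D') :
    Contraction (D₀.sum D₀') (D.sum D') where
  emb := Sum.map C.emb C'.emb
  ret := Sum.map C.ret C'.ret
  ret_emb := by
    rintro (x | x)
    · exact congrArg _ (C.ret_emb x)
    · exact congrArg _ (C'.ret_emb x)
  label_emb := by
    rintro (x | x)
    · exact C.label_emb x
    · exact C'.label_emb x
  ret_next_emb := by
    rintro (x | x)
    · exact congrArg _ (C.ret_next_emb x)
    · exact congrArg _ (C'.ret_next_emb x)
  ret_next := by
    rintro (y | y) h
    · exact congrArg Sum.inl (C.ret_next y fun x hx => h (.inl x) (congrArg _ hx))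
    · exact congrArg Sum.inr (C'.ret_next y fun x hx => h (.inr x) (congrArg _ hx))
  not_isEdge := by
    rintro (y | y) h
    · exact C.not_isEdge y fun x hx => h (.inl x) (congrArg _ hx)
    · exact C'.not_isEdge y fun x hx => h (.inr x) (congrArg _ hx)
  reach := by
    have h1 : ∀ (y : ι) n, (D.sum D').next^[n] (.inl y) = .inl (D.next^[n] y) := fun y n => by
      induction n with
      | zero => rfl
      | succ n ih => rw [Function.iterate_succ_apply', ih, Function.iterate_succ_apply']; rfl
    have h2 : ∀ (y : ι') n, (D.sum D').next^[n] (.inr y) = .inr (D'.next^[n] y) := fun y n => by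
      induction n with
      | zero => rfl
      | succ n ih => rw [Function.iterate_succ_apply', ih, Function.iterate_succ_apply']; rfl
    rintro (y | y)
    · obtain ⟨n, x, h⟩ := C.reach y
      exact ⟨n, .inl x, (h1 y n).trans (congrArg _ h)⟩
    · obtain ⟨n, x, h⟩ := C'.reach y
      exact ⟨n, .inr x, (h2 y n).trans (congrArg _ h)⟩

/-- Every diagram is a contraction of itself. -/
def Contraction.refl (D : Diagram E ι) : Contraction D D :=
  .ofEquiv (.refl ι) (fun _ => rfl) fun _ => rfl

end Sums

section

variable {V : Type u} [Quiver.{v} V] {ι κ : Type} {D₀ : Diagram (DEdge V) κ}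
  {D : Diagram (DEdge V) ι}

theorem iterate_component {c : ι → Fin 2} (hc : ∀ x, c (D.next x) = c x) (n : ℕ) (y : ι) :
    c (D.next^[n] y) = c y := by
  induction n with
  | zero => rfl
  | succ n ih => rw [Function.iterate_succ_apply', hc, ih]

namespace Contraction

section

variable (C : Contraction D₀ D)

include C

theorem component_emb_ret {c : ι → Fin 2} (hc : ∀ x, c (D.next x) = c x) (y : ι) :
    c (C.emb (C.ret y)) = c y := by
  obtain ⟨n, hn⟩ := C.exists_iterate_eq_emb_ret y
  rw [← hn, iterate_component hc]

theorem component_comp_emb {c : ι → Fin 2} (hc : ∀ x, c (D.next x) = c x) (x : κ) :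
    c (C.emb (D₀.next x)) = c (C.emb x) := by
  rw [← C.ret_next_emb, C.component_emb_ret hc, hc]

theorem component_comp_ret {c : κ → Fin 2} (hc : ∀ x, c (D₀.next x) = c x) (y : ι) :
    c (C.ret (D.next y)) = c (C.ret y) := by
  by_cases h : C.emb (C.ret y) = y
  · rw [C.ret_next_of_emb h, hc]
  · rw [C.ret_next_of_not h]

/-- Component assignments are the same for a diagram and for a contraction of it. -/
def components : Components D ≃ Components D₀ where
  toFun c := ⟨fun x => c.1 (C.emb x), C.component_comp_emb c.2⟩
  invFun c := ⟨fun y => c.1 (C.ret y), C.component_comp_ret c.2⟩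
  left_inv c := Subtype.ext (funext fun y => C.component_emb_ret c.2 y)
  right_inv c := Subtype.ext (funext fun x => congrArg c.1 (C.ret_emb x))

end

/-- A contraction restricts to the parts that are assigned to a tensor factor. -/
def part (C : Contraction D₀ D) (c : Components D) (i : Fin 2) :
    Contraction (D₀.part (C.components c) i) (D.part c i) where
  emb x := ⟨C.emb x.1, x.2⟩
  ret y := ⟨C.ret y.1, (C.component_emb_ret c.2 y.1).trans y.2⟩
  ret_emb x := Subtype.ext (C.ret_emb x.1)
  label_emb x := C.label_emb x.1
  ret_next_emb x := Subtype.ext (C.ret_next_emb x.1)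
  ret_next y h := by
    refine Subtype.ext (C.ret_next y.1 fun x hx => ?_)
    refine h ⟨x, ?_⟩ (Subtype.ext hx)
    change c.1 (C.emb x) = i
    rw [hx]
    exact y.2
  not_isEdge y h := by
    refine C.not_isEdge y.1 fun x hx => ?_
    refine h ⟨x, ?_⟩ (Subtype.ext hx)
    change c.1 (C.emb x) = i
    rw [hx]
    exact y.2
  reach y := by
    obtain ⟨n, hn⟩ := C.exists_iterate_eq_emb_ret y.1
    refine ⟨n, ⟨C.ret y.1, (C.component_emb_ret c.2 y.1).trans y.2⟩, Subtype.ext (Eq.trans ?_ hn)⟩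
    clear hn
    induction n with
    | zero => rfl
    | succ n ih => rw [Function.iterate_succ_apply', Function.iterate_succ_apply', ← ih]; rfl

section

variable (C : Contraction D₀ D)

include C

theorem emb_ret_apply (φ : D.Cutting) (x : κ) :
    C.emb (C.ret (φ.1 (C.emb x))) = φ.1 (C.emb x) := by
  by_cases h : φ.1 (C.emb x) = C.emb x
  · rw [h, C.ret_emb]
  · exact C.emb_ret_of_isEdge (φ.2.isEdge (φ.2.apply_ne h))

theorem apply_eq_of_not (φ : D.Cutting) {y : ι} (h : C.emb (C.ret y) ≠ y) : φ.1 y = y := by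
  by_contra h'
  exact h (C.emb_ret_of_isEdge (φ.2.isEdge h'))

open scoped Classical in
/-- The extension by the identity of a cutting of a contraction of `D`. -/
noncomputable def pushFun (φ : D₀.Cutting) (y : ι) : ι :=
  if C.emb (C.ret y) = y then C.emb (φ.1 (C.ret y)) else y

theorem pushFun_of_eq (φ : D₀.Cutting) {y : ι} (h : C.emb (C.ret y) = y) :
    C.pushFun φ y = C.emb (φ.1 (C.ret y)) := if_pos h

theorem pushFun_of_ne (φ : D₀.Cutting) {y : ι} (h : C.emb (C.ret y) ≠ y) :
    C.pushFun φ y = y := if_neg h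

theorem pushFun_involutive (φ : D₀.Cutting) : Function.Involutive (C.pushFun φ) := by
  intro y
  by_cases h : C.emb (C.ret y) = y
  · rw [C.pushFun_of_eq φ h, C.pushFun_of_eq φ (by rw [C.ret_emb]), C.ret_emb, φ.2.invol, h]
  · rw [C.pushFun_of_ne φ h, C.pushFun_of_ne φ h]

/-- A cutting of a contraction of `D`, as a cutting of `D`. -/
noncomputable def push (φ : D₀.Cutting) : D.Cutting where
  val := Function.Involutive.toPerm (C.pushFun φ) (C.pushFun_involutive φ)
  property := by
    constructor
    · exact C.pushFun_involutive φ
    · intro y hy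
      change C.pushFun φ y ≠ y at hy
      change ∃ a, _ ∧ D.label (C.pushFun φ y) = _
      by_cases h : C.emb (C.ret y) = y
      · rw [C.pushFun_of_eq φ h] at hy ⊢
        have : φ.1 (C.ret y) ≠ C.ret y := fun h' => hy (by rw [h', h])
        obtain ⟨a, ha, hb⟩ := φ.2.rev _ this
        exact ⟨a, by rw [← ha, ← C.label_emb, h], by rw [C.label_emb, hb]⟩
      · exact absurd (C.pushFun_of_ne φ h) hy

theorem push_emb (φ : D₀.Cutting) (x : κ) : (C.push φ).1 (C.emb x) = C.emb (φ.1 x) := by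
  refine (C.pushFun_of_eq φ (congrArg C.emb (C.ret_emb x))).trans ?_
  rw [C.ret_emb]

/-- A cutting of `D`, as a cutting of a contraction of `D`. -/
def pull (φ : D.Cutting) : D₀.Cutting where
  val := Function.Involutive.toPerm (fun x => C.ret (φ.1 (C.emb x))) fun x => by
    simp only [C.emb_ret_apply, φ.2.invol, C.ret_emb]
  property := by
    constructor
    · exact Function.Involutive.toPerm_involutive _
    · intro x hx
      change C.ret _ ≠ _ at hx
      change ∃ a, _ ∧ D₀.label (C.ret _) = _
      have : φ.1 (C.emb x) ≠ C.emb x := fun h' => hx (by rw [h', C.ret_emb])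
      obtain ⟨a, ha, hb⟩ := φ.2.rev _ this
      exact ⟨a, by rw [← ha, C.label_emb], by rw [← C.label_emb, C.emb_ret_apply, hb]⟩

/-- Cuttings are the same for a diagram and for a contraction of it. -/
noncomputable def cutting : D₀.Cutting ≃ D.Cutting where
  toFun := C.push
  invFun := C.pull
  left_inv φ := Subtype.ext (Equiv.ext fun x => by
    change C.ret ((C.push φ).1 (C.emb x)) = _
    rw [C.push_emb, C.ret_emb])
  right_inv φ := Subtype.ext (Equiv.ext fun y => by
    by_cases h : C.emb (C.ret y) = y
    · rw [← h, C.push_emb]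
      exact C.emb_ret_apply φ _
    · rw [C.apply_eq_of_not φ h, C.apply_eq_of_not _ h])

theorem cutting_emb (φ : D₀.Cutting) (x : κ) : (C.cutting φ).1 (C.emb x) = C.emb (φ.1 x) :=
  C.push_emb φ x

theorem cutting_emb_eq_iff (φ : D₀.Cutting) (x : κ) :
    (C.cutting φ).1 (C.emb x) = C.emb x ↔ φ.1 x = x := by
  rw [C.cutting_emb, C.emb_injective.eq_iff]

end

/-- Cutting is compatible with contractions. -/
noncomputable def cutAt (C : Contraction D₀ D) (φ : D₀.Cutting) :
    Contraction (D₀.cutAt φ) (D.cutAt (C.cutting φ)) where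
  emb := C.emb
  ret := C.ret
  ret_emb := C.ret_emb
  label_emb x := by
    change D.cutLabel _ _ = D₀.cutLabel _ _
    by_cases h : φ.1 x = x
    · rw [D₀.cutLabel_of_eq h, D.cutLabel_of_eq ((C.cutting_emb_eq_iff φ x).2 h), C.label_emb]
    · rw [D₀.cutLabel_of_ne h, D.cutLabel_of_ne (mt (C.cutting_emb_eq_iff φ x).1 h), C.label_emb]
  ret_next_emb x := by
    change C.ret (D.next ((C.cutting φ).1 (C.emb x))) = D₀.next (φ.1 x)
    rw [C.cutting_emb, C.ret_next_emb]
  ret_next y h := by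
    change C.ret (D.next ((C.cutting φ).1 y)) = _
    rw [C.apply_eq_of_not _ (h _), C.ret_next y h]
  not_isEdge y h h' := C.not_isEdge y h (isEdge_of_cut h')
  reach y := by
    obtain ⟨n, x, h⟩ := C.reach y
    induction n generalizing y with
    | zero => exact ⟨0, x, h⟩
    | succ n ih =>
      by_cases hy : C.emb (C.ret y) = y
      · exact ⟨0, C.ret y, hy.symm⟩
      · obtain ⟨m, z, hz⟩ := ih _ h
        refine ⟨m + 1, z, ?_⟩
        rw [Function.iterate_succ_apply]
        have : (D.cutAt (C.cutting φ)).next y = D.next y :=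
          congrArg D.next (C.apply_eq_of_not _ hy)
        rw [this, hz]

theorem isQ_emb_iff (C : Contraction D₀ D) (x : κ) : D.IsQ (C.emb x) ↔ D₀.IsQ x := by
  unfold IsQ
  rw [C.label_emb]

variable [Fintype ι] [Fintype κ] {R : Type*} [CommRing R]

theorem weight_cutting (C : Contraction D₀ D) (A : ι → ι → R) (φ : D₀.Cutting) :
    D.weight A (C.cutting φ).1 = D₀.weight (fun x y => A (C.emb x) (C.emb y)) φ.1 := by
  refine (Finset.prod_bij (fun x _ => C.emb x) ?_ ?_ ?_ ?_).symm
  · intro x hx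
    rw [mem_cutQ] at hx ⊢
    rwa [Ne, C.cutting_emb_eq_iff, C.isQ_emb_iff]
  · intro x _ y _ h
    exact C.emb_injective h
  · intro y hy
    rw [mem_cutQ] at hy
    have h := C.emb_ret_of_isEdge ((C.cutting φ).2.isEdge hy.1)
    refine ⟨C.ret y, ?_, h⟩
    rw [← h, Ne, C.cutting_emb_eq_iff, C.isQ_emb_iff] at hy
    exact mem_cutQ.2 hy
  · intro x _
    rw [C.cutting_emb]

theorem cutSum_eq {M : Type*} [AddCommGroup M] [Module R M] (C : Contraction D₀ D)
    (A : ι → ι → R) (T : D.Cutting → M) :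
    D.cutSum A T =
      D₀.cutSum (fun x y => A (C.emb x) (C.emb y)) fun φ => T (C.cutting φ) :=
  (Fintype.sum_equiv C.cutting _ _ fun φ => by rw [C.weight_cutting]).symm

end Contraction

/-- The juxtaposition of two cuttings. -/
def Cutting.sum (φ : D.Cutting) (ψ : D₀.Cutting) : (D.sum D₀).Cutting where
  val := Equiv.sumCongr φ.1 ψ.1
  property := by
    constructor
    · rintro (x | x)
      · exact congrArg _ (φ.2.invol x)
      · exact congrArg _ (ψ.2.invol x)
    · rintro (x | x) h
      · exact φ.2.rev x fun h' => h (congrArg _ h')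
      · exact ψ.2.rev x fun h' => h (congrArg _ h')

theorem cutAt_sum (φ : D.Cutting) (ψ : D₀.Cutting) :
    (D.sum D₀).cutAt (φ.sum ψ) = (D.cutAt φ).sum (D₀.cutAt ψ) := by
  refine ext_of_eq ?_ ?_
  · have h1 : ∀ x, (φ.sum ψ).1 (.inl x) = .inl x ↔ φ.1 x = x := fun x => Sum.inl.inj_iff
    have h2 : ∀ x, (φ.sum ψ).1 (.inr x) = .inr x ↔ ψ.1 x = x := fun x => Sum.inr.inj_iff
    rintro (x | x)
    · by_cases h : φ.1 x = x
      · exact (cutLabel_of_eq _ ((h1 x).2 h)).trans (D.cutLabel_of_eq h).symm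
      · exact (cutLabel_of_ne _ (mt (h1 x).1 h)).trans (D.cutLabel_of_ne h).symm
    · by_cases h : ψ.1 x = x
      · exact (cutLabel_of_eq _ ((h2 x).2 h)).trans (D₀.cutLabel_of_eq h).symm
      · exact (cutLabel_of_ne _ (mt (h2 x).1 h)).trans (D₀.cutLabel_of_ne h).symm
  · rintro (x | x) <;> rfl

/-- An involution sending no place of the first diagram into the second sends none backwards either,
so it restricts to both sides. -/
theorem Cutting.exists_sum_eq [Finite ι] (φ : (D.sum D₀).Cutting)
    (h : ∀ x y, φ.1 (.inl x) ≠ .inr y) : ∃ φ₁ φ₂, Cutting.sum φ₁ φ₂ = φ := by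
  have hr : ∀ y x, φ.1 (.inr y) ≠ .inl x := by
    intro y x h'
    refine h x y ?_
    rw [← h', φ.2.invol]
  have h1 : Set.MapsTo φ.1 (Set.range Sum.inl) (Set.range Sum.inl) := by
    rintro _ ⟨x, rfl⟩
    cases hx : φ.1 (.inl x) with
    | inl y => exact ⟨y, rfl⟩
    | inr y => exact absurd hx (h x y)
  have h1 : ∀ x, ∃ z, φ.1 (.inl x) = .inl z := by
    intro x
    obtain ⟨z, hz⟩ := h1 ⟨x, rfl⟩
    exact ⟨z, hz.symm⟩
  have h2 : ∀ y, ∃ z, φ.1 (.inr y) = .inr z := by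
    intro y
    cases hy : φ.1 (.inr y) with
    | inl z => exact absurd hy (hr y z)
    | inr z => exact ⟨z, rfl⟩
  choose f hf using h1
  choose g hg using h2
  have hf' : Function.Involutive f := fun x => Sum.inl_injective (by
    rw [← hf, ← hf, φ.2.invol])
  have hg' : Function.Involutive g := fun x => Sum.inr_injective (by
    rw [← hg, ← hg, φ.2.invol])
  refine ⟨⟨Function.Involutive.toPerm f hf', hf', fun x hx => ?_⟩,
    ⟨Function.Involutive.toPerm g hg', hg', fun x hx => ?_⟩, Subtype.ext (Equiv.ext ?_)⟩
  · obtain ⟨a, ha, hb⟩ := φ.2.rev (.inl x) (by rw [hf]; exact fun h => hx (Sum.inl_injective h))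
    rw [hf] at hb
    exact ⟨a, ha, hb⟩
  · obtain ⟨a, ha, hb⟩ := φ.2.rev (.inr x) (by rw [hg]; exact fun h => hx (Sum.inr_injective h))
    rw [hg] at hb
    exact ⟨a, ha, hb⟩
  · rintro (x | x)
    · exact (hf x).symm
    · exact (hg x).symm

variable [Fintype ι] [Fintype κ] {R : Type*} [CommRing R]

theorem weight_sum (A : ι ⊕ κ → ι ⊕ κ → R) (φ : D.Cutting) (ψ : D₀.Cutting) :
    (D.sum D₀).weight A (φ.sum ψ).1 =
      D.weight (fun x y => A (.inl x) (.inl y)) φ.1 *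
        D₀.weight (fun x y => A (.inr x) (.inr y)) ψ.1 := by
  have h : (D.sum D₀).cutQ (φ.sum ψ).1 = (D.cutQ φ.1).disjSum (D₀.cutQ ψ.1) := by
    ext (x | x)
    · rw [Finset.inl_mem_disjSum, mem_cutQ, mem_cutQ]
      exact and_congr_left fun _ => not_congr Sum.inl.inj_iff
    · rw [Finset.inr_mem_disjSum, mem_cutQ, mem_cutQ]
      exact and_congr_left fun _ => not_congr Sum.inr.inj_iff
  rw [weight, h, Finset.prod_disjSum]
  rfl

/-- A sum over all cuttings of a juxtaposition whose weights vanish on the pairs between the two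
diagrams. -/
theorem cutSum_sum {M : Type*} [AddCommGroup M] [Module R M] (A : ι ⊕ κ → ι ⊕ κ → R)
    (h : ∀ x y, A (.inl x) (.inr y) = 0) (h' : ∀ x y, A (.inr x) (.inl y) = 0)
    (T : (D.sum D₀).Cutting → M) : (D.sum D₀).cutSum A T = D.cutSum (fun x y => A (.inl x) (.inl y)) fun φ =>
      D₀.cutSum (fun x y => A (.inr x) (.inr y)) fun ψ => T (φ.sum ψ) := by
  have e : D.cutSum (fun x y => A (.inl x) (.inl y)) (fun φ =>
      D₀.cutSum (fun x y => A (.inr x) (.inr y)) fun ψ => T (φ.sum ψ)) =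
      ∑ p : D.Cutting × D₀.Cutting, (D.sum D₀).weight A (p.1.sum p.2).1 • T (p.1.sum p.2) := by
    rw [Fintype.sum_prod_type]
    refine Finset.sum_congr rfl fun φ _ => ?_
    unfold cutSum
    rw [Finset.smul_sum]
    refine Finset.sum_congr rfl fun ψ _ => ?_
    rw [smul_smul, weight_sum]
  rw [e]
  symm
  refine Fintype.sum_of_injective (fun p : D.Cutting × D₀.Cutting => p.1.sum p.2) ?_
    (fun p => (D.sum D₀).weight A (p.1.sum p.2).1 • T (p.1.sum p.2))
    (fun φ => (D.sum D₀).weight A φ.1 • T φ) ?_ fun _ => rfl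
  · rintro ⟨φ, ψ⟩ ⟨φ', ψ'⟩ hp
    have hp : (φ.sum ψ).1 = (φ'.sum ψ').1 := congrArg Subtype.val hp
    refine Prod.ext (Subtype.ext (Equiv.ext fun x => ?_)) (Subtype.ext (Equiv.ext fun x => ?_))
    · exact Sum.inl_injective (Equiv.congr_fun hp (.inl x))
    · exact Sum.inr_injective (Equiv.congr_fun hp (.inr x))
  · intro φ hφ
    have : ∃ x y, φ.1 (.inl x) = .inr y := by
      by_contra! hc
      obtain ⟨φ₁, φ₂, h⟩ := φ.exists_sum_eq hc
      exact hφ ⟨(φ₁, φ₂), h⟩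
    obtain ⟨x, y, hxy⟩ := this
    have hx : φ.1 (.inl x) ≠ .inl x := by rw [hxy]; exact Sum.inr_ne_inl
    rw [show (D.sum D₀).weight A φ.1 = 0 from ?_, zero_smul]
    -- The edge in `Q` of the offending pair may lie on either side, so the vanishing of `A` is used
    -- in both directions.
    rcases φ.2.mem_cutQ_or hx with hq | hq
    · exact weight_eq_zero hq (by rw [hxy, h])
    · exact weight_eq_zero hq (by rw [φ.2.invol, hxy, h'])

/-- The places of the two parts of a diagram. -/
def placesParts {D : Diagram (DEdge V) ι} (c : Components D) :
    {x // c.1 x = 0} ⊕ {x // c.1 x = 1} ≃ ι where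
  toFun := Sum.elim Subtype.val Subtype.val
  invFun x := if h : c.1 x = 0 then .inl ⟨x, h⟩ else .inr ⟨x, by omega⟩
  left_inv := by
    rintro (⟨x, h⟩ | ⟨x, h⟩)
    · exact dif_pos h
    · exact dif_neg (show ¬ c.1 x = 0 by omega)
  right_inv x := by
    by_cases h : c.1 x = 0
    · simp only [h, dif_pos, Sum.elim_inl]
    · simp only [h, dif_neg, not_false_eq_true, Sum.elim_inr]

/-- A diagram is the juxtaposition of its two parts. -/
def contractionParts (D : Diagram (DEdge V) ι) (c : Components D) :
    Contraction ((D.part c 0).sum (D.part c 1)) D :=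
  .ofEquiv (placesParts c) (by rintro (x | x) <;> rfl) (by rintro (x | x) <;> rfl)

/-- The parts of a juxtaposition. -/
def contractionSumPart (c : Components (D.sum D₀)) (c₁ : Components D) (c₂ : Components D₀)
    (h₁ : ∀ x, c.1 (.inl x) = c₁.1 x) (h₂ : ∀ x, c.1 (.inr x) = c₂.1 x) (i : Fin 2) :
    Contraction ((D.part c₁ i).sum (D₀.part c₂ i)) ((D.sum D₀).part c i) :=
  .ofEquiv
    { toFun := Sum.elim (fun x => ⟨.inl x.1, (h₁ x.1).trans x.2⟩)
        fun x => ⟨.inr x.1, (h₂ x.1).trans x.2⟩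
      invFun := fun
        | ⟨.inl x, h⟩ => .inl ⟨x, (h₁ x).symm.trans h⟩
        | ⟨.inr x, h⟩ => .inr ⟨x, (h₂ x).symm.trans h⟩
      left_inv := by rintro (x | x) <;> rfl
      right_inv := by rintro ⟨x | x, h⟩ <;> rfl }
    (by rintro (x | x) <;> rfl) (by rintro (x | x) <;> rfl)

end

end Diagram

/-! ### The Moyal product and coproduct as weighted sums over cuttings -/

section MoyalFormulas

variable {k : Type w} [Field k] {V : Type u} [Quiver.{v} V] {ι κ : Type}

theorem basisMonomials_eq_coll (d : Necklace (DEdge V) →₀ ℕ) :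
    MvPolynomial.basisMonomials (Necklace (DEdge V)) k[X] d = coll k (Finsupp.toMultiset d) := by
  rw [MvPolynomial.coe_basisMonomials]
  change MvPolynomial.monomial d 1 = _
  rw [MvPolynomial.monomial_eq, coll, Finsupp.toMultiset_map,
    Finsupp.prod_toMultiset, map_one, one_mul]
  exact (Finsupp.prod_mapDomain_index (by simp) (by intros; rw [pow_add])).symm

theorem linExt_coll {M : Type*} [AddCommGroup M] [Module k[X] M]
    (F : Multiset (Necklace (DEdge V)) → M) (s : Multiset (Necklace (DEdge V))) :
    linExt k F (coll k s) = F s := by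
  classical
  have h := basisMonomials_eq_coll (k := k) (Multiset.toFinsupp s)
  rw [Multiset.toFinsupp_toMultiset] at h
  rw [← h, linExt, Module.Basis.constr_basis, Multiset.toFinsupp_toMultiset]

/-- Linear maps on `(Sym L)[h]` are determined by their values on collections of necklaces. -/
theorem linearMap_ext_coll {M : Type*} [AddCommGroup M] [Module k[X] M]
    {f g : SymL k V →ₗ[k[X]] M} (h : ∀ s, f (coll k s) = g (coll k s)) : f = g :=
  (MvPolynomial.basisMonomials (Necklace (DEdge V)) k[X]).ext fun d => by
    rw [basisMonomials_eq_coll, h]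

theorem coll_zero : coll k (0 : Multiset (Necklace (DEdge V))) = 1 := by
  rw [coll, Multiset.map_zero, Multiset.prod_zero]

namespace Diagram

/-- The sum over all cuttings of a diagram, with the weights `A`, of the resulting collections. -/
noncomputable def cutColl [Fintype ι] (D : Diagram (DEdge V) ι) (A : ι → ι → k[X]) : SymL k V :=
  D.cutSum A fun φ => coll k (D.cutAt φ).collection

theorem Contraction.cutColl_eq [Fintype ι] [Fintype κ] {D₀ : Diagram (DEdge V) κ}
    {D : Diagram (DEdge V) ι} (C : Contraction D₀ D) (A : ι → ι → k[X]) :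
    D.cutColl A = D₀.cutColl fun x y => A (C.emb x) (C.emb y) := by
  unfold cutColl
  rw [C.cutSum_eq]
  congr 1
  ext φ
  rw [(C.cutAt φ).collection_eq]

end Diagram

/-- The weights of the Moyal product. -/
noncomputable def crossWeight : ι ⊕ κ → ι ⊕ κ → k[X]
  | .inl _, .inr _ => halfH k
  | .inr _, .inl _ => -halfH k
  | _, _ => 0

-- Reading each pair from its edge in `Q`, a pair contributes h/2 if that edge is in the first
-- collection and -h/2 if it is in the second; the minus signs make up `crossSign`.
open scoped Classical in
theorem weight_crossWeight [Fintype ι] [Fintype κ] (D : Diagram (DEdge V) ι)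
    (D' : Diagram (DEdge V) κ) {φ : Equiv.Perm (ι ⊕ κ)} (h : Crossing φ) :
    (D.sum D').weight crossWeight φ =
      halfH k ^ (D.sum D').numPairs φ * ((crossSign D' φ : ℤ) : k[X]) := by
  have h1 : ∀ z ∈ (D.sum D').cutQ φ, (crossWeight z (φ z) : k[X]) =
      halfH k * Sum.elim (fun _ => 1) (fun _ => -1) z := by
    intro z hz
    have hz := (Diagram.mem_cutQ.1 hz).1
    rcases z with x | y
    · obtain ⟨y, hy⟩ := h.1 x hz
      rw [hy]
      simp [crossWeight]
    · obtain ⟨x, hx⟩ := h.2 y hz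
      rw [hx]
      simp [crossWeight]
  have h2 : (D.sum D').cutQ φ =
      (Finset.univ.filter fun x => φ (.inl x) ≠ .inl x ∧ D.IsQ x).disjSum
        (Finset.univ.filter fun y => φ (.inr y) ≠ .inr y ∧ D'.IsQ y) := by
    ext (x | x)
    · rw [Finset.inl_mem_disjSum, Diagram.mem_cutQ, Finset.mem_filter]
      exact (and_iff_right (Finset.mem_univ _)).symm
    · rw [Finset.inr_mem_disjSum, Diagram.mem_cutQ, Finset.mem_filter]
      exact (and_iff_right (Finset.mem_univ _)).symm
  rw [Diagram.weight, Finset.prod_congr rfl h1, Finset.prod_mul_distrib, Finset.prod_const]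
  congr 1
  rw [h2, Finset.prod_disjSum]
  simp only [Sum.elim_inl, Sum.elim_inr, Finset.prod_const_one, one_mul, Finset.prod_const]
  rw [crossSign, Int.cast_pow, Int.cast_neg, Int.cast_one]

theorem weight_crossWeight_eq_zero [Fintype ι] [Fintype κ] (D : Diagram (DEdge V) ι)
    (D' : Diagram (DEdge V) κ) (φ : (D.sum D').Cutting) (h : ¬ Crossing φ.1) :
    (D.sum D').weight (crossWeight (k := k)) φ.1 = 0 := by
  have key : ∀ z, φ.1 z ≠ z → (crossWeight z (φ.1 z) : k[X]) = 0 →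
      (crossWeight (φ.1 z) z : k[X]) = 0 → (D.sum D').weight (crossWeight (k := k)) φ.1 = 0 := by
    intro z hz h1 h2
    rcases φ.2.mem_cutQ_or hz with hq | hq
    · exact Diagram.weight_eq_zero hq h1
    · exact Diagram.weight_eq_zero hq (by rw [φ.2.invol]; exact h2)
  rw [Crossing, not_and_or] at h
  push Not at h
  rcases h with ⟨x, hx, hx'⟩ | ⟨x, hx, hx'⟩
  · refine key _ hx ?_ ?_ <;>
    · cases hz : φ.1 (.inl x) with
      | inl y => rfl
      | inr y => exact absurd hz (hx' y)
  · refine key _ hx ?_ ?_ <;>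
    · cases hz : φ.1 (.inr x) with
      | inr y => rfl
      | inl y => exact absurd hz (hx' y)

/-- Cuttings that pair two places of the same collection have weight zero, so the restriction to
crossing involutions can be dropped. -/
theorem moyalMulColl_eq (s t : Multiset (Necklace (DEdge V))) :
    moyalMulColl k s t = ((diagram s).sum (diagram t)).cutColl crossWeight := by
  classical
  unfold moyalMulColl Diagram.cutColl Diagram.cutSum
  refine Fintype.sum_of_injective
    (fun φ : {φ : Equiv.Perm (Places s ⊕ Places t) //
      ((diagram s).sum (diagram t)).IsCutting φ ∧ Crossing φ} =>
      (⟨φ.1, φ.2.1⟩ : ((diagram s).sum (diagram t)).Cutting)) ?_ _ _ ?_ ?_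
  · intro φ ψ h
    exact Subtype.ext (congrArg (fun φ : ((diagram s).sum (diagram t)).Cutting => φ.1) h)
  · intro φ hφ
    rw [weight_crossWeight_eq_zero, zero_smul]
    exact fun hc => hφ ⟨⟨φ.1, φ.2, hc⟩, rfl⟩
  · intro φ
    rw [weight_crossWeight _ _ φ.2.2]

theorem crossWeight_map {ι' κ' : Type} (f : ι → ι') (g : κ → κ') (x y : ι ⊕ κ) :
    (crossWeight (Sum.map f g x) (Sum.map f g y) : k[X]) = crossWeight x y := by
  rcases x with x | x <;> rcases y with y | y <;> rfl

theorem Diagram.Contraction.cutColl_sum [Fintype ι] [Fintype κ] {ι' κ' : Type} [Fintype ι']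
    [Fintype κ'] {D₀ : Diagram (DEdge V) κ} {D : Diagram (DEdge V) ι} (C : Contraction D₀ D)
    {D₀' : Diagram (DEdge V) κ'} {D' : Diagram (DEdge V) ι'} (C' : Contraction D₀' D') :
    (D.sum D').cutColl (crossWeight (k := k)) = (D₀.sum D₀').cutColl crossWeight := by
  rw [(C.sum C').cutColl_eq]
  congr 1
  funext x y
  exact crossWeight_map _ _ x y

/-- The Moyal product of the collections of any two diagrams. -/
theorem moyalMul_coll [Fintype ι] [Fintype κ] (D : Diagram (DEdge V) ι) (D' : Diagram (DEdge V) κ) :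
    moyalMul k (coll k D.collection) (coll k D'.collection) = (D.sum D').cutColl crossWeight := by
  rw [moyalMul, linExt_coll, linExt_coll, moyalMulColl_eq]
  exact (Diagram.eq_of_contraction_invariant
    (fun _ _ D => (D.sum (diagram D'.collection)).cutColl crossWeight)
    (fun _ _ _ _ _ _ C => C.cutColl_sum (.refl _)) D).trans
    (Diagram.eq_of_contraction_invariant (fun _ _ D' => (D.sum D').cutColl crossWeight)
      (fun _ _ _ _ _ _ C => (Diagram.Contraction.refl _).cutColl_sum C) D')

/-- The part of a tensor-valued sum that belongs to a component assignment. -/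
noncomputable def tensorTerm (E : Diagram (DEdge V) ι) [Finite ι] (c : ι → Fin 2) :
    SymL k V ⊗[k[X]] SymL k V :=
  open scoped Classical in
  if h : ∀ x, c (E.next x) = c x then
    coll k (E.part ⟨c, h⟩ 0).collection ⊗ₜ[k[X]] coll k (E.part ⟨c, h⟩ 1).collection
  else 0

theorem tensorTerm_component [Finite ι] {E : Diagram (DEdge V) ι} (c : Components E) :
    tensorTerm (k := k) E c.1 =
      coll k (E.part c 0).collection ⊗ₜ[k[X]] coll k (E.part c 1).collection :=
  dif_pos c.2

theorem tensorTerm_of_not [Finite ι] {E : Diagram (DEdge V) ι} {c : ι → Fin 2}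
    (h : ¬ ∀ x, c (E.next x) = c x) : tensorTerm (k := k) E c = 0 :=
  dif_neg h

open scoped Classical in
theorem sum_components [Fintype ι] {M : Type*} [AddCommMonoid M] (E : Diagram (DEdge V) ι)
    (f : (ι → Fin 2) → M) (hf : ∀ c, (¬ ∀ x, c (E.next x) = c x) → f c = 0) :
    ∑ c : Components E, f c.1 = ∑ c : ι → Fin 2, f c := by
  exact Fintype.sum_of_injective (fun c : Components E => c.1) Subtype.val_injective
    (fun c => f c.1) f (fun c hc => hf c fun h => hc ⟨⟨c, h⟩, rfl⟩) fun _ => rfl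

/-- The weights of the Moyal coproduct. -/
noncomputable def compWeight (c : ι → Fin 2) (x y : ι) : k[X] :=
  halfH k * (((c y : ℕ) : k[X]) - ((c x : ℕ) : k[X]))

/-- After gluing, `x + 1` is the successor of `φ x`, hence c(x + 1) = c(φ x). This makes the sign
c(x + 1) - c(x) a function of the cut pair. -/
theorem weight_compWeight [Fintype ι] (D : Diagram (DEdge V) ι) (φ : D.Cutting)
    (c : Components (D.cutAt φ)) :
    D.weight (compWeight (k := k) c.1) φ.1 =
      halfH k ^ D.numPairs φ.1 * ((compSign D φ.1 c.1 : ℤ) : k[X]) := by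
  unfold Diagram.weight compWeight
  rw [Finset.prod_mul_distrib, Finset.prod_const, compSign, Int.cast_prod]
  congr 1
  refine Finset.prod_congr rfl fun x _ => ?_
  have h := c.2 (φ.1 x)
  have h : c.1 (D.next (φ.1 (φ.1 x))) = c.1 (φ.1 x) := h
  rw [φ.2.invol] at h
  rw [h]
  push_cast
  rfl

/-- The Moyal coproduct of the collection of a diagram. -/
noncomputable def comulSum [Fintype ι] (D : Diagram (DEdge V) ι) : SymL k V ⊗[k[X]] SymL k V :=
  ∑ φ : D.Cutting, ∑ c : Components (D.cutAt φ),
    D.weight (compWeight (k := k) c.1) φ.1 • tensorTerm (D.cutAt φ) c.1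

theorem moyalComulColl_eq (s : Multiset (Necklace (DEdge V))) :
    moyalComulColl k s = comulSum (k := k) (diagram s) := by
  classical
  unfold moyalComulColl comulSum
  refine Finset.sum_congr (Finset.ext fun φ => by simp) fun φ _ => ?_
  refine Finset.sum_congr rfl fun c _ => ?_
  rw [tensorTerm_component]
  congr 1
  exact (weight_compWeight (diagram s) φ c).symm

namespace Diagram.Contraction

variable [Fintype ι] [Fintype κ] {D₀ : Diagram (DEdge V) κ} {D : Diagram (DEdge V) ι}

theorem tensorTerm_eq (C : Contraction D₀ D) (c : Components D) :
    tensorTerm (k := k) D c.1 = tensorTerm D₀ (C.components c).1 := by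
  rw [tensorTerm_component, tensorTerm_component, (C.part c 0).collection_eq,
    (C.part c 1).collection_eq]

theorem comulSum_eq (C : Contraction D₀ D) : comulSum (k := k) D = comulSum D₀ := by
  unfold comulSum
  refine (Fintype.sum_equiv C.cutting _ _ fun φ => ?_).symm
  refine (Fintype.sum_equiv (C.cutAt φ).components _ _ fun c => ?_).symm
  rw [C.weight_cutting, (C.cutAt φ).tensorTerm_eq]
  rfl

end Diagram.Contraction

/-- The Moyal coproduct of the collection of any diagram. -/
theorem moyalComul_coll [Fintype ι] (D : Diagram (DEdge V) ι) :
    moyalComul k (coll k D.collection) = comulSum (k := k) D := by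
  rw [moyalComul, linExt_coll, moyalComulColl_eq]
  exact Diagram.eq_of_contraction_invariant (fun _ _ D => comulSum (k := k) D)
    (fun _ _ _ _ _ _ C => C.comulSum_eq) D

-- Extending `tensorTerm` by zero to all functions `c` removes the dependence of the colourings on
-- the cutting. The sums can be interchanged, and for fixed `c` the addition of weights applies.
open scoped Classical in
theorem comulSum_eq_sum [Fintype ι] (D : Diagram (DEdge V) ι) :
    comulSum (k := k) D =
      ∑ c : ι → Fin 2, D.cutSum (compWeight (k := k) c) fun φ => tensorTerm (D.cutAt φ) c := by
  unfold comulSum Diagram.cutSum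
  rw [Finset.sum_comm]
  refine Finset.sum_congr rfl fun φ _ => ?_
  exact sum_components (D.cutAt φ)
    (fun c => D.weight (compWeight (k := k) c) φ.1 • tensorTerm (D.cutAt φ) c)
    fun c hc => by rw [tensorTerm_of_not hc, smul_zero]

end MoyalFormulas

/-! ### Diagrams with heights and their classes -/

section Heights

variable {V : Type u} [Quiver.{v} V] {ι κ : Type}

namespace HDiagram

/-- A contraction of diagrams with heights. -/
structure Contraction (D₀ : HDiagram V κ) (D : HDiagram V ι) extends
    Diagram.Contraction D₀.toDiagram D.toDiagram where
  height_emb : ∀ x, D₀.IsEdge x → D.height (emb x) = D₀.height x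

theorem heighted_label_edge (D : HDiagram V ι) {x : ι} {a : DEdge V} (h : D.label x = .inl a) :
    D.heighted.label x = .inl (a, D.height x) := by
  change Sum.map _ _ (D.label x) = _
  rw [h]
  rfl

theorem heighted_label_vertex (D : HDiagram V ι) {x : ι} {a : V} (h : D.label x = .inr a) :
    D.heighted.label x = .inr a := by
  change Sum.map _ _ (D.label x) = _
  rw [h]
  rfl

theorem isEdge_heighted_iff (D : HDiagram V ι) (x : ι) : D.heighted.IsEdge x ↔ D.IsEdge x := by
  constructor
  · rintro ⟨a, ha⟩
    cases hl : D.label x with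
    | inl b => exact ⟨b, hl⟩
    | inr b => rw [D.heighted_label_vertex hl] at ha; cases ha
  · rintro ⟨a, ha⟩
    exact ⟨_, D.heighted_label_edge ha⟩

/-- The underlying contraction of diagrams with labels in the edges with heights. -/
def Contraction.heighted {D₀ : HDiagram V κ} {D : HDiagram V ι} (C : Contraction D₀ D) :
    Diagram.Contraction D₀.heighted D.heighted where
  emb := C.emb
  ret := C.ret
  ret_emb := C.ret_emb
  label_emb x := by
    cases h : D₀.label x with
    | inl a =>
      rw [D₀.heighted_label_edge h, D.heighted_label_edge ((C.label_emb x).trans h),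
        C.height_emb x ⟨a, h⟩]
    | inr a =>
      rw [D₀.heighted_label_vertex h, D.heighted_label_vertex ((C.label_emb x).trans h)]
  ret_next_emb := C.ret_next_emb
  ret_next := C.ret_next
  not_isEdge y h := by rw [isEdge_heighted_iff]; exact C.not_isEdge y h
  reach := C.reach

theorem Contraction.hcoll_eq [Fintype ι] [Fintype κ] {D₀ : HDiagram V κ} {D : HDiagram V ι}
    (C : Contraction D₀ D) : D.hcoll = D₀.hcoll :=
  Subtype.ext C.heighted.collection_eq

end HDiagram

/-- The edges of a diagram have pairwise distinct heights. -/
def Diagram.DistinctHeights (E : Diagram (DEdge V × ℕ) ι) : Prop :=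
  ∀ x y a b n, E.label x = .inl (a, n) → E.label y = .inl (b, n) → x = y

/-- A diagram with labels in the edges with heights, as a diagram with heights. -/
def HDiagram.ofHeighted (E : Diagram (DEdge V × ℕ) ι) (h : E.DistinctHeights) : HDiagram V ι where
  label x := Sum.map Prod.fst id (E.label x)
  next := E.next
  compat x := by
    have hc := E.compat x
    have h1 : ∀ l : (DEdge V × ℕ) ⊕ V, labelSrc (Sum.map Prod.fst id l : DEdge V ⊕ V) =
        labelSrc l := by rintro (l | l) <;> rfl
    have h2 : ∀ l : (DEdge V × ℕ) ⊕ V, labelTgt (Sum.map Prod.fst id l : DEdge V ⊕ V) =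
        labelTgt l := by rintro (l | l) <;> rfl
    rw [h1, h2, hc]
  height x := Sum.elim Prod.snd (fun _ => 0) (E.label x)
  height_inj := by
    rintro x y ⟨a, ha⟩ ⟨b, hb⟩ hxy
    cases hx : E.label x with
    | inr v =>
      have ha : Sum.map Prod.fst id (E.label x) = _ := ha
      rw [hx] at ha
      cases ha
    | inl e =>
      cases hy : E.label y with
      | inr v =>
        have hb : Sum.map Prod.fst id (E.label y) = _ := hb
        rw [hy] at hb
        cases hb
      | inl f =>
        rw [hx, hy] at hxy
        have hxy : e.2 = f.2 := hxy
        refine h x y e.1 f.1 e.2 hx ?_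
        rw [hxy]
        exact hy

theorem HDiagram.distinctHeights (D : HDiagram V ι) : D.heighted.DistinctHeights := by
  intro x y a b n hx hy
  have key : ∀ x a n, D.heighted.label x = .inl (a, n) → D.label x = .inl a ∧ D.height x = n := by
    intro x a n hx
    cases h : D.label x with
    | inl c =>
      rw [D.heighted_label_edge h] at hx
      cases hx
      exact ⟨rfl, rfl⟩
    | inr c => rw [D.heighted_label_vertex h] at hx; cases hx
  obtain ⟨h1, h2⟩ := key x a n hx
  obtain ⟨h3, h4⟩ := key y b n hy
  exact D.height_inj x y ⟨a, h1⟩ ⟨b, h3⟩ (h2.trans h4.symm)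

/-- Forgetting the heights at the idempotents. -/
def HDiagram.contractionOfHeighted (D : HDiagram V ι) :
    Contraction (ofHeighted D.heighted D.distinctHeights) D where
  toContraction := .ofEquiv (.refl ι) (by
    intro x
    change D.label x = Sum.map _ _ (Sum.map _ _ _)
    cases D.label x <;> rfl) fun _ => rfl
  height_emb := by
    rintro x ⟨a, ha⟩
    cases h : D.label x with
    | inl b =>
      change _ = Sum.elim _ _ (D.heighted.label x)
      rw [D.heighted_label_edge h]
      rfl
    | inr b =>
      change Sum.map _ _ (D.heighted.label x) = _ at ha
      rw [D.heighted_label_vertex h] at ha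
      cases ha

theorem Diagram.Contraction.distinctHeights_iff {E₀ : Diagram (DEdge V × ℕ) κ}
    {E : Diagram (DEdge V × ℕ) ι} (C : Contraction E₀ E) :
    E.DistinctHeights ↔ E₀.DistinctHeights := by
  constructor
  · intro h x y a b n hx hy
    refine C.emb_injective (h _ _ a b n ?_ ?_)
    · rw [C.label_emb, hx]
    · rw [C.label_emb, hy]
  · intro h x y a b n hx hy
    obtain ⟨x, rfl⟩ := C.exists_of_isEdge ⟨_, hx⟩
    obtain ⟨y, rfl⟩ := C.exists_of_isEdge ⟨_, hy⟩
    rw [C.label_emb] at hx hy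
    rw [h x y a b n hx hy]

/-- Contractions of diagrams with labels in the edges with heights. -/
def Diagram.Contraction.ofHeighted {E₀ : Diagram (DEdge V × ℕ) κ}
    {E : Diagram (DEdge V × ℕ) ι} (C : Contraction E₀ E) (h₀ : E₀.DistinctHeights)
    (h : E.DistinctHeights) :
    HDiagram.Contraction (HDiagram.ofHeighted E₀ h₀) (HDiagram.ofHeighted E h) where
  emb := C.emb
  ret := C.ret
  ret_emb := C.ret_emb
  label_emb x := congrArg (Sum.map Prod.fst id) (C.label_emb x)
  ret_next_emb := C.ret_next_emb
  ret_next := C.ret_next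
  not_isEdge := by
    rintro y hy ⟨a, ha⟩
    change Sum.map _ _ (E.label y) = _ at ha
    cases hl : E.label y with
    | inl b => exact C.not_isEdge y hy ⟨b, hl⟩
    | inr b => rw [hl] at ha; cases ha
  reach := C.reach
  height_emb x _ := congrArg (Sum.elim Prod.snd fun _ => 0) (C.label_emb x)

open scoped Classical in
/-- A quantity that is invariant under contractions depends only on the collection with heights. -/
theorem HDiagram.eq_of_hcoll_eq {α : Type*} (F : ∀ (ι : Type) [Fintype ι], HDiagram V ι → α)
    (hF : ∀ (ι κ : Type) [Fintype ι] [Fintype κ] (D₀ : HDiagram V κ) (D : HDiagram V ι),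
      Contraction D₀ D → F ι D = F κ D₀)
    [Fintype ι] [Fintype κ] (D : HDiagram V ι) (D' : HDiagram V κ) (h : D.hcoll = D'.hcoll) :
    F ι D = F κ D' := by
  -- Contraction invariance is a criterion about all diagrams with labels in `DEdge V × ℕ`,
  -- including those with repeated heights; these get the value `none`.
  let G : ∀ (ι : Type) [Fintype ι], Diagram (DEdge V × ℕ) ι → Option α := fun ι _ E =>
    if h : E.DistinctHeights then some (F ι (ofHeighted E h)) else none
  have hG : ∀ (ι : Type) [Fintype ι] (D : HDiagram V ι), G ι D.heighted = some (F ι D) := by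
    intro ι _ D
    refine (dif_pos D.distinctHeights).trans ?_
    rw [hF _ _ _ _ D.contractionOfHeighted]
  have key : ∀ (ι : Type) [Fintype ι] (E : Diagram (DEdge V × ℕ) ι),
      G _ (diagram E.collection) = G ι E := by
    intro ι _ E
    refine Diagram.eq_of_contraction_invariant G (fun ι κ _ _ E₀ E C => ?_) E
    by_cases h : E.DistinctHeights
    · have h₀ := C.distinctHeights_iff.1 h
      refine (dif_pos h).trans (Eq.trans ?_ (dif_pos h₀).symm)
      rw [hF _ _ _ _ (C.ofHeighted h₀ h)]
    · have h₁ : G ι E = none := dif_neg h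
      have h₂ : G κ E₀ = none := dif_neg (mt C.distinctHeights_iff.2 h)
      rw [h₁, h₂]
  apply Option.some_injective
  rw [← hG, ← hG, ← key, ← key κ D'.heighted, show D.heighted.collection = D'.heighted.collection
    from congrArg Subtype.val h]

variable {k : Type w} [Field k]

theorem HDiagram.cls_eq_of_lt_iff [Fintype ι] {D D' : HDiagram V ι}
    (h : D'.toDiagram = D.toDiagram)
    (hlt : ∀ x y, D.IsEdge x → D.IsEdge y →
      (D.height x < D.height y ↔ D'.height x < D'.height y)) : D.cls k = D'.cls k :=
  (Submodule.Quotient.eq _).2 (Submodule.subset_span (AhRel.reorder D D' h hlt))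

/-- The class of a diagram with heights depends only on the order of the heights, and is invariant
under contractions. -/
theorem HDiagram.cls_eq_of_contraction [Fintype ι] [Fintype κ] {D₀ : HDiagram V κ}
    {D : HDiagram V ι} (C : Diagram.Contraction D₀.toDiagram D.toDiagram)
    (hlt : ∀ x y, D₀.IsEdge x → D₀.IsEdge y →
      (D₀.height x < D₀.height y ↔ D.height (C.emb x) < D.height (C.emb y))) :
    D.cls k = D₀.cls k := by
  -- The intermediate `D₁` has the places of `D₀` and the heights of `D`: it differs from `D₀` by a
  -- reordering relation and presents the same collection with heights as `D`.
  let D₁ : HDiagram V κ :=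
    { toDiagram := D₀.toDiagram
      height := fun x => D.height (C.emb x)
      height_inj := fun x y hx hy h => C.emb_injective
        (D.height_inj _ _ ((C.isEdge_emb x).2 hx) ((C.isEdge_emb y).2 hy) h) }
  have C₁ : Contraction D₁ D := ⟨C, fun _ _ => rfl⟩
  rw [D₀.cls_eq_of_lt_iff (D' := D₁) rfl hlt]
  exact congrArg (fun M => Submodule.Quotient.mk (Finsupp.single M 1)) C₁.hcoll_eq

/-- The classes of diagrams with heights span. -/
theorem span_cls : Submodule.span k[X] {a : Ah k V |
    ∃ (ι : Type) (_ : Fintype ι) (D : HDiagram V ι), a = D.cls k} = ⊤ := by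
  rw [eq_top_iff]
  rintro a -
  obtain ⟨f, rfl⟩ := Submodule.Quotient.mk_surjective _ a
  induction f using Finsupp.induction_linear with
  | zero => exact Submodule.zero_mem _
  | add f g hf hg => exact Submodule.add_mem _ hf hg
  | single M p =>
    obtain ⟨M, ι, hι, D, rfl⟩ := M
    have : (Submodule.Quotient.mk (Finsupp.single ⟨D.heighted.collection, ι, hι, D, rfl⟩ p) :
        Ah k V) = p • D.cls k := by
      rw [HDiagram.cls, ← Submodule.Quotient.mk_smul, Finsupp.smul_single, smul_eq_mul, mul_one]
      rfl
    rw [this]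
    exact Submodule.smul_mem _ _ (Submodule.subset_span ⟨ι, hι, D, rfl⟩)

end Heights

/-! ### The Wick map from `A_h(Q)` to `(Sym L)[h]` -/

section Wick

variable {k : Type w} [Field k] {V : Type u} [Quiver.{v} V] {ι κ : Type}

theorem Diagram.weight_comp [Fintype ι] {D : Diagram (DEdge V) ι} {R : Type*} [CommRing R]
    (A : ι → ι → R) (φ : D.Cutting) (ψ : (D.cutAt φ).Cutting) :
    D.weight A (φ.comp ψ).1 = D.weight A φ.1 * (D.cutAt φ).weight A ψ.1 := by
  classical
  rw [weight_cutAt, (φ.sub_comp ψ).weight_eq, mul_comm]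
  exact (Finset.prod_sdiff (φ.sub_comp ψ).cutQ_subset).symm

variable (k) in
/-- The weights that express a collection with heights by symmetrized ones: the contraction of
two mutually reverse edges is `h / 2`, up to a sign. -/
noncomputable def heightWeight (H : ι → ℕ) (x y : ι) : k[X] :=
  if H x < H y then halfH k else -halfH k

variable (k) in
/-- The element of `(Sym L)[h]` whose symmetrization is the class of a collection with heights. -/
noncomputable def HDiagram.wick [Fintype ι] (D : HDiagram V ι) : SymL k V :=
  D.toDiagram.cutColl (heightWeight k D.height)

theorem weight_heightWeight_congr [Fintype ι] {D : Diagram (DEdge V) ι} {φ : Equiv.Perm ι}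
    {H H' : ι → ℕ}
    (h : ∀ x, φ x ≠ x → (H x < H (φ x) ↔ H' x < H' (φ x))) :
    D.weight (heightWeight k H) φ = D.weight (heightWeight k H') φ :=
  Diagram.weight_congr fun x hx => by
    unfold heightWeight
    rw [if_congr (h x (Diagram.mem_cutQ.1 hx).1) rfl rfl]

theorem cutColl_heightWeight_congr [Fintype ι] {D : Diagram (DEdge V) ι} {H H' : ι → ℕ}
    (h : ∀ x y a, D.label x = .inl a → D.label y = .inl a.star → (H x < H y ↔ H' x < H' y)) :
    D.cutColl (heightWeight k H) = D.cutColl (heightWeight k H') :=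
  Finset.sum_congr rfl fun φ _ => by
    rw [weight_heightWeight_congr]
    intro x hx
    obtain ⟨a, ha, hb⟩ := φ.2.rev x hx
    exact h _ _ a ha hb

theorem HDiagram.Contraction.wick_eq [Fintype ι] [Fintype κ] {D₀ : HDiagram V κ}
    {D : HDiagram V ι} (C : Contraction D₀ D) : D.wick k = D₀.wick k := by
  refine (C.cutColl_eq _).trans (cutColl_heightWeight_congr fun x y a hx hy => ?_)
  rw [C.height_emb x ⟨_, hx⟩, C.height_emb y ⟨_, hy⟩]

variable (k) in
/-- `HDiagram.wick` as a function of the collection with heights. -/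
noncomputable def HCollection.wick (M : HCollection V) : SymL k V :=
  let := M.2.choose_spec.choose
  M.2.choose_spec.choose_spec.choose.wick k

theorem HDiagram.wick_hcoll [Fintype ι] (D : HDiagram V ι) : D.hcoll.wick k = D.wick k := by
  let := D.hcoll.2.choose_spec.choose
  refine HDiagram.eq_of_hcoll_eq (fun _ _ D => D.wick k) (fun _ _ _ _ _ _ C => C.wick_eq) _ D ?_
  exact Subtype.ext D.hcoll.2.choose_spec.choose_spec.choose_spec.symm

/-- If `H'` arises from `H` by exchanging two consecutive heights, only the order of these two
changes. -/
theorem lt_iff_of_exchange {H H' : ι → ℕ} {p : ι → Prop}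
    (hinj : ∀ x y, p x → p y → H x = H y → x = y) {x y : ι} (hx : p x) (hy : p y)
    (hlt : H x < H y) (hcons : ∀ z, p z → ¬ (H x < H z ∧ H z < H y)) (hDx : H' x = H y)
    (hDy : H' y = H x) (hDz : ∀ z, z ≠ x → z ≠ y → H' z = H z) {a b : ι} (ha : p a) (hb : p b)
    (h1 : ¬ (a = x ∧ b = y)) (h2 : ¬ (a = y ∧ b = x)) : H a < H b ↔ H' a < H' b := by
  have hca := hcons a ha
  have hcb := hcons b hb
  by_cases hax : a = x
  · subst hax
    by_cases hba : b = a
    · subst hba; simp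
    · have hby : b ≠ y := fun h => h1 ⟨rfl, h⟩
      have := mt (hinj b y hb hy) hby
      rw [hDx, hDz b hba hby]
      omega
  · by_cases hay : a = y
    · subst hay
      by_cases hba : b = a
      · subst hba; simp
      · have hbx : b ≠ x := fun h => h2 ⟨rfl, h⟩
        have := mt (hinj b a hb hy) hba
        rw [hDy, hDz b hbx hba]
        omega
    · have e1 := mt (hinj a x ha hx) hax
      have e2 := mt (hinj a y ha hy) hay
      rw [hDz a hax hay]
      by_cases hbx : b = x
      · subst hbx
        rw [hDx]
        omega
      · by_cases hby : b = y
        · subst hby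
          rw [hDy]
          omega
        · rw [hDz b hbx hby]

variable [CharZero k]

variable (k) in
theorem halfH_add_halfH : halfH k + halfH k = Polynomial.X := by
  unfold halfH
  rw [← add_mul, ← Polynomial.C_add, ← two_mul, mul_inv_cancel₀ two_ne_zero, Polynomial.C_1,
    one_mul]

/-- The exchange reverses the order of the heights of `x` and `y` only. Cuttings that do not contain
this pair cancel; those that do factor as the pair followed by a cutting of the cut diagram, and
their weights differ by the factor h/2 - (-h/2), up to the sign of `a`. -/
theorem wick_exchange [Fintype ι] {D : Diagram (DEdge V) ι} {H H' : ι → ℕ}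
    (hinj : ∀ x y, D.IsEdge x → D.IsEdge y → H x = H y → x = y)
    (x y : ι) (a : DEdge V) (hx : D.label x = .inl a) (hy : D.label y = .inl a.star)
    (hlt : H x < H y) (hcons : ∀ z, D.IsEdge z → ¬ (H x < H z ∧ H z < H y))
    (hDx : H' x = H y) (hDy : H' y = H x) (hDz : ∀ z, z ≠ x → z ≠ y → H' z = H z)
    (φ : Equiv.Perm ι) (hφ : D.IsCutting φ) (hφx : φ x = y) (hφy : φ y = x)
    (hφz : ∀ z, z ≠ x → z ≠ y → φ z = z) :
    D.cutColl (heightWeight k H) - D.cutColl (heightWeight k H') =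
      ((a.sign : k[X]) * Polynomial.X) • (D.cut φ hφ).cutColl (heightWeight k H) := by
  have hxy : x ≠ y := fun h => hlt.ne (congrArg H h)
  have hxy' : ∀ z, φ z = z → z ≠ x ∧ z ≠ y := by
    intro z hz
    refine ⟨?_, ?_⟩
    · rintro rfl; exact hxy (hz.symm.trans hφx)
    · rintro rfl; exact hxy (hφy.symm.trans hz)
  let Φ : D.Cutting := ⟨φ, hφ⟩
  -- The weight of the single pair is read from its edge in `Q`: the lower edge `x` if `a` is in
  -- `Q`, the upper edge `y` otherwise. This produces the sign `[a, a*]`.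
  have hΦ : D.weight (heightWeight k H) φ - D.weight (heightWeight k H') φ =
      (a.sign : k[X]) * Polynomial.X := by
    have key : ∀ z z', φ z = z' → φ z ≠ z → D.IsQ z →
        (∀ w, φ w ≠ w → w = z ∨ w = z') → D.cutQ φ = {z} := by
      intro z z' hz hne hq h
      ext w
      rw [Diagram.mem_cutQ, Finset.mem_singleton]
      constructor
      · rintro ⟨h1, h2⟩
        refine (h w h1).resolve_right ?_
        rintro rfl
        rw [← hz, hφ.isQ_apply_iff hne] at h2
        exact h2 hq
      · rintro rfl
        exact ⟨hne, hq⟩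
    have hmem : ∀ w, φ w ≠ w → w = x ∨ w = y := by
      intro w hw
      by_contra! h
      exact hw (hφz w h.1 h.2)
    cases a with
    | inl e =>
      have hq := key x y hφx (by rw [hφx]; exact hxy.symm) ⟨_, hx, trivial⟩ hmem
      unfold Diagram.weight
      rw [hq, Finset.prod_singleton, Finset.prod_singleton, hφx]
      unfold heightWeight
      rw [if_pos hlt, hDx, hDy, if_neg hlt.not_gt, sub_neg_eq_add, halfH_add_halfH]
      simp [DEdge.sign]
    | inr e =>
      have hq := key y x hφy (by rw [hφy]; exact hxy) ⟨_, hy, trivial⟩ fun w hw => (hmem w hw).symm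
      unfold Diagram.weight
      rw [hq, Finset.prod_singleton, Finset.prod_singleton, hφy]
      unfold heightWeight
      rw [if_neg hlt.not_gt, hDx, hDy, if_pos hlt, ← neg_add', halfH_add_halfH]
      simp [DEdge.sign]
  unfold Diagram.cutColl Diagram.cutSum
  rw [← Finset.sum_sub_distrib, Finset.smul_sum]
  symm
  refine Fintype.sum_of_injective Φ.comp Φ.comp_injective _ _ ?_ ?_
  -- A cutting outside the range of `Φ.comp` does not contain the pair, so none of its comparisons
  -- of heights changes.
  · intro θ hθ
    rw [← sub_smul, weight_heightWeight_congr, sub_self, zero_smul]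
    intro z hz
    have hne : ∀ z, θ.1 z ≠ z → ¬ (z = x ∧ θ.1 z = y) ∧ ¬ (z = y ∧ θ.1 z = x) := by
      intro z hz
      suffices h : θ.1 x ≠ y by
        refine ⟨fun h' => h (h'.1 ▸ h'.2), fun h' => h ?_⟩
        rw [← h'.2, θ.2.invol, h'.1]
      intro hθx
      refine hθ (Diagram.Cutting.Sub.exists_comp_eq (φ := Φ) fun w hw => ?_)
      by_cases h1 : w = x
      · subst h1; exact hθx.trans hφx.symm
      · by_cases h2 : w = y
        · subst h2
          refine Eq.trans ?_ hφy.symm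
          rw [← hθx, θ.2.invol]
        · exact absurd (hφz w h1 h2) hw
    exact lt_iff_of_exchange hinj ⟨a, hx⟩ ⟨a.star, hy⟩ hlt hcons hDx hDy hDz (θ.2.isEdge hz)
      (θ.2.isEdge (θ.2.apply_ne hz)) (hne z hz).1 (hne z hz).2
  -- The remaining pairs avoid `x` and `y`, so their weight is common to `H` and `H'` and factors
  -- out.
  · intro ψ
    beta_reduce
    have hψ : (D.cutAt Φ).weight (heightWeight k H) ψ.1 =
        (D.cutAt Φ).weight (heightWeight k H') ψ.1 := by
      refine weight_heightWeight_congr fun z hz => ?_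
      have h1 := hxy' z (Diagram.fix_of_ne ψ hz)
      have h2 := hxy' (ψ.1 z) (Diagram.fix_of_ne ψ (ψ.2.apply_ne hz))
      rw [hDz z h1.1 h1.2, hDz _ h2.1 h2.2]
    rw [Diagram.weight_comp, Diagram.weight_comp, Diagram.cutAt_comp, smul_smul,
      ← sub_smul, ← hψ, ← sub_mul]
    exact congrArg (fun r : k[X] => (r * _) • _) hΦ.symm

/-- The defining relations of `A_h(Q)` hold for `HDiagram.wick`. -/
theorem linearCombination_wick_of_ahRel {r : HCollection V →₀ k[X]} (h : AhRel k r) :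
    Finsupp.linearCombination k[X] (HCollection.wick k) r = 0 := by
  cases h with
  | reorder D D' h hlt =>
    rw [map_sub, Finsupp.linearCombination_single, Finsupp.linearCombination_single, one_smul,
      one_smul, HDiagram.wick_hcoll, HDiagram.wick_hcoll, sub_eq_zero, HDiagram.wick,
      HDiagram.wick, h]
    exact cutColl_heightWeight_congr fun x y a hx hy => hlt x y ⟨_, hx⟩ ⟨_, hy⟩
  | commute D D' h x y a b hx hy hlt hcons hDx hDy hDz hab =>
    rw [map_sub, Finsupp.linearCombination_single, Finsupp.linearCombination_single, one_smul,
      one_smul, HDiagram.wick_hcoll, HDiagram.wick_hcoll, sub_eq_zero, HDiagram.wick,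
      HDiagram.wick, h]
    refine cutColl_heightWeight_congr fun z w c hz hw => ?_
    refine lt_iff_of_exchange D.height_inj ⟨a, hx⟩ ⟨b, hy⟩ hlt hcons hDx hDy hDz ⟨_, hz⟩ ⟨_, hw⟩
      ?_ ?_
    · rintro ⟨rfl, rfl⟩
      rw [hx] at hz
      rw [hy] at hw
      cases hz
      exact hab (Sum.inl_injective hw)
    · rintro ⟨rfl, rfl⟩
      rw [hy] at hz
      rw [hx] at hw
      cases hz
      refine hab ?_
      rw [Sum.inl_injective hw]
      cases b <;> rfl
  | exchange D D' h x y a hx hy hlt hcons hDx hDy hDz φ hφ hφx hφy hφz =>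
    have := wick_exchange (k := k) D.height_inj x y a hx hy hlt hcons hDx hDy hDz φ hφ hφx hφy hφz
    rw [map_sub, map_sub, Finsupp.linearCombination_single, Finsupp.linearCombination_single,
      Finsupp.linearCombination_single, one_smul, one_smul, HDiagram.wick_hcoll,
      HDiagram.wick_hcoll, HDiagram.wick_hcoll, HDiagram.wick, HDiagram.wick, h, this,
      HDiagram.wick]
    exact sub_self _

variable (k V) in
/-- The inverse of the symmetrization map. -/
noncomputable def wickMap : Ah k V →ₗ[k[X]] SymL k V :=
  Submodule.liftQ _ (Finsupp.linearCombination k[X] (HCollection.wick k)) <| by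
    rw [Submodule.span_le]
    intro r hr
    exact linearCombination_wick_of_ahRel hr

theorem wickMap_cls [Fintype ι] (D : HDiagram V ι) : wickMap k V (D.cls k) = D.wick k := by
  refine (Finsupp.linearCombination_single k[X] 1 D.hcoll).trans ?_
  rw [one_smul, HDiagram.wick_hcoll]

end Wick

/-! ### The symmetrization map is an isomorphism -/

section Symmetrization

variable {k : Type w} [Field k] {V : Type u} [Quiver.{v} V] {ι κ : Type}

theorem Diagram.height_withHeights (D : Diagram (DEdge V) ι) (H : HeightAssignment D) {x : ι}
    (hx : D.IsEdge x) : (D.withHeights H).height x = (H ⟨x, hx⟩ : ℕ) + 1 :=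
  dif_pos hx

noncomputable instance [Finite ι] (D : Diagram (DEdge V) ι) : Fintype (HeightAssignment D) :=
  Fintype.ofFinite _

variable (k) in
/-- The average of a diagram over all height assignments. -/
noncomputable def Diagram.average [Fintype ι] (D : Diagram (DEdge V) ι) : Ah k V :=
  Polynomial.C (((Nat.card {x // D.IsEdge x}).factorial : k)⁻¹) •
    ∑ H : HeightAssignment D, (D.withHeights H).cls k

theorem Diagram.height_withHeights_of_not (D : Diagram (DEdge V) ι) (H : HeightAssignment D) {x : ι}
    (hx : ¬ D.IsEdge x) : (D.withHeights H).height x = 0 :=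
  dif_neg hx

theorem phiWColl_eq (s : Multiset (Necklace (DEdge V))) :
    phiWColl k s = (diagram s).average k := by
  unfold phiWColl Diagram.average
  congr!

namespace Diagram.Contraction

variable {D₀ : Diagram (DEdge V) κ} {D : Diagram (DEdge V) ι}

/-- The edges of a diagram and of a contraction of it. -/
def edges (C : Contraction D₀ D) : {x // D₀.IsEdge x} ≃ {y // D.IsEdge y} where
  toFun x := ⟨C.emb x.1, (C.isEdge_emb x.1).2 x.2⟩
  invFun y := ⟨C.ret y.1, by rw [← C.isEdge_emb, C.emb_ret_of_isEdge y.2]; exact y.2⟩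
  left_inv x := Subtype.ext (C.ret_emb x.1)
  right_inv y := Subtype.ext (C.emb_ret_of_isEdge y.2)

theorem average_eq [Fintype ι] [Fintype κ] (C : Contraction D₀ D) :
    D.average k = D₀.average k := by
  have hN : Nat.card {x // D₀.IsEdge x} = Nat.card {y // D.IsEdge y} := Nat.card_congr C.edges
  unfold average
  refine congrArg₂ (fun (n : ℕ) a => Polynomial.C ((n.factorial : k)⁻¹) • a) hN.symm ?_
  refine (Fintype.sum_equiv (Equiv.equivCongr C.edges (finCongr hN)) _ _ fun H => ?_).symm
  refine (HDiagram.cls_eq_of_contraction (D₀ := D₀.withHeights H)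
    (D := D.withHeights (C.edges.equivCongr (finCongr hN) H)) C fun x y hx hy => ?_).symm
  have key : ∀ x (hx : D₀.IsEdge x), (D.withHeights (C.edges.equivCongr (finCongr hN) H)).height
      (C.emb x) = (D₀.withHeights H).height x := by
    intro x hx
    have e : C.edges.symm ⟨C.emb x, (C.isEdge_emb x).2 hx⟩ = ⟨x, hx⟩ :=
      C.edges.symm_apply_apply ⟨x, hx⟩
    rw [height_withHeights _ _ ((C.isEdge_emb x).2 hx), height_withHeights _ _ hx]
    simp [Equiv.equivCongr, e]
  rw [key x hx, key y hy]

end Diagram.Contraction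

theorem phiW_coll [Fintype ι] (D : Diagram (DEdge V) ι) :
    phiW k (coll k D.collection) = D.average k := by
  rw [phiW, linExt_coll, phiWColl_eq]
  exact Diagram.eq_of_contraction_invariant (fun _ _ D => D.average k)
    (fun _ _ _ _ _ _ C => C.average_eq) D

section Surjective

variable (P : Submodule k[X] (Ah k V))

theorem perm_fin_mem_closure {m : ℕ} (σ : Equiv.Perm (Fin m)) :
    σ ∈ Submonoid.closure {τ | ∃ i j : Fin m, (j : ℕ) = i + 1 ∧ τ = Equiv.swap i j} := by
  cases m with
  | zero =>
    rw [Subsingleton.elim σ 1]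
    exact Submonoid.one_mem _
  | succ n =>
    have h : σ ∈ (⊤ : Submonoid (Equiv.Perm (Fin (n + 1)))) := Submonoid.mem_top σ
    rw [← Equiv.Perm.mclosure_swap_castSucc_succ] at h
    refine Submonoid.closure_mono ?_ h
    rintro _ ⟨i, rfl⟩
    exact ⟨i.castSucc, i.succ, rfl, rfl⟩

/-- Exchanging neighbouring heights is one of the defining relations: the class is unchanged or
changes by a multiple of the class of a diagram with fewer edges, which lies in `P` by hypothesis.
-/
theorem cls_sub_cls_swap_mem [Fintype ι] {D : Diagram (DEdge V) ι}
    (hP : ∀ D' : HDiagram V ι, Nat.card {x // D'.IsEdge x} < Nat.card {x // D.IsEdge x} →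
      D'.cls k ∈ P) (H : HeightAssignment D) {i j : Fin (Nat.card {x // D.IsEdge x})}
    (hij : (j : ℕ) = i + 1) :
    (D.withHeights H).cls k - (D.withHeights (H.trans (Equiv.swap i j))).cls k ∈ P := by
  classical
  obtain ⟨⟨x, a, ha⟩, hx⟩ := H.surjective i
  obtain ⟨⟨y, b, hb⟩, hy⟩ := H.surjective j
  have hxy : x ≠ y := by
    rintro rfl
    rw [hx] at hy
    rw [hy] at hij
    omega
  have hHx : (D.withHeights H).height x = i + 1 := by
    rw [D.height_withHeights H ⟨a, ha⟩, hx]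
  have hHy : (D.withHeights H).height y = j + 1 := by
    rw [D.height_withHeights H ⟨b, hb⟩, hy]
  have hlt : (D.withHeights H).height x < (D.withHeights H).height y := by omega
  have hcons : ∀ z, (D.withHeights H).IsEdge z → ¬ ((D.withHeights H).height x <
      (D.withHeights H).height z ∧ (D.withHeights H).height z < (D.withHeights H).height y) := by
    intro z _ h
    omega
  have hDx : (D.withHeights (H.trans (Equiv.swap i j))).height x =
      (D.withHeights H).height y := by
    rw [hHy, D.height_withHeights _ ⟨a, ha⟩, Equiv.trans_apply, hx, Equiv.swap_apply_left]
  have hDy : (D.withHeights (H.trans (Equiv.swap i j))).height y =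
      (D.withHeights H).height x := by
    rw [hHx, D.height_withHeights _ ⟨b, hb⟩, Equiv.trans_apply, hy, Equiv.swap_apply_right]
  have hDz : ∀ z, z ≠ x → z ≠ y → (D.withHeights (H.trans (Equiv.swap i j))).height z =
      (D.withHeights H).height z := by
    intro z hzx hzy
    by_cases hz : D.IsEdge z
    · rw [D.height_withHeights _ hz, D.height_withHeights _ hz, Equiv.trans_apply,
        Equiv.swap_apply_of_ne_of_ne]
      · exact fun h => hzx (congrArg Subtype.val (H.injective (h.trans hx.symm)))
      · exact fun h => hzy (congrArg Subtype.val (H.injective (h.trans hy.symm)))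
    · rw [D.height_withHeights_of_not _ hz, D.height_withHeights_of_not _ hz]
  by_cases hab : b = a.star
  · subst hab
    have hsx : Equiv.swap x y x = y := Equiv.swap_apply_left x y
    have hsy : Equiv.swap x y y = x := Equiv.swap_apply_right x y
    have hsz : ∀ z, z ≠ x → z ≠ y → Equiv.swap x y z = z :=
      fun z h1 h2 => Equiv.swap_apply_of_ne_of_ne h1 h2
    have hφ : D.IsCutting (Equiv.swap x y) := by
      refine ⟨fun z => Equiv.congr_fun (Equiv.swap_swap x y) z, fun z hz => ?_⟩
      by_cases h1 : z = x
      · subst h1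
        exact ⟨a, ha, by rw [hsx, hb]⟩
      · by_cases h2 : z = y
        · subst h2
          refine ⟨a.star, hb, ?_⟩
          rw [hsy, ha]
          cases a <;> rfl
        · exact absurd (hsz z h1 h2) hz
    have h := AhRel.exchange (k := k) (D.withHeights H)
      (D.withHeights (H.trans (Equiv.swap i j))) rfl x y a ha hb hlt hcons hDx hDy hDz
      (Equiv.swap x y) hφ hsx hsy hsz
    have h' := (Submodule.Quotient.mk_eq_zero
      (Submodule.span k[X] {r : HCollection V →₀ k[X] | AhRel k r})).2 (Submodule.subset_span h)
    have e : ∀ r : k[X], Finsupp.single ((D.withHeights H).cut (Equiv.swap x y) hφ).hcoll r =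
        r • Finsupp.single ((D.withHeights H).cut (Equiv.swap x y) hφ).hcoll 1 := by
      intro r
      rw [Finsupp.smul_single, smul_eq_mul, mul_one]
    rw [Submodule.Quotient.mk_sub, Submodule.Quotient.mk_sub, e, Submodule.Quotient.mk_smul,
      sub_eq_zero] at h'
    refine (congrArg (· ∈ P) h').mpr (P.smul_mem _ (hP _ ?_))
    have := Fintype.ofFinite {z // D.IsEdge z}
    have := Fintype.ofFinite {z // ((D.withHeights H).cut (Equiv.swap x y) hφ).IsEdge z}
    rw [Nat.card_eq_fintype_card, Nat.card_eq_fintype_card]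
    let f (z : {z // ((D.withHeights H).cut (Equiv.swap x y) hφ).IsEdge z}) : {z // D.IsEdge z} :=
      ⟨z.1, Diagram.isEdge_of_cut (hφ := hφ) z.2⟩
    have hf : Function.Injective f := fun z z' h =>
      Subtype.ext (congrArg (Subtype.val (p := D.IsEdge)) h)
    refine Fintype.card_lt_of_injective_of_notMem f hf (b := ⟨x, a, ha⟩) ?_
    rintro ⟨⟨z, hz⟩, h⟩
    have h : z = x := congrArg Subtype.val h
    subst h
    have := ((D.isEdge_cutAt_iff ⟨_, hφ⟩ z).1 hz).1
    exact hxy (this.symm.trans hsx)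
  · have h := AhRel.commute (k := k) (D.withHeights H)
      (D.withHeights (H.trans (Equiv.swap i j))) rfl x y a b ha hb hlt hcons hDx hDy hDz hab
    have h' := (Submodule.Quotient.mk_eq_zero
      (Submodule.span k[X] {r : HCollection V →₀ k[X] | AhRel k r})).2 (Submodule.subset_span h)
    rw [Submodule.Quotient.mk_sub] at h'
    exact (congrArg (· ∈ P) h').mpr P.zero_mem

/-- Two height assignments differ by a permutation, and adjacent transpositions generate; the
differences telescope. -/
theorem cls_sub_cls_mem [Fintype ι] {D : Diagram (DEdge V) ι}
    (hP : ∀ D' : HDiagram V ι, Nat.card {x // D'.IsEdge x} < Nat.card {x // D.IsEdge x} →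
      D'.cls k ∈ P) (H H' : HeightAssignment D) :
    (D.withHeights H).cls k - (D.withHeights H').cls k ∈ P := by
  have key : ∀ σ : Equiv.Perm (Fin (Nat.card {x // D.IsEdge x})), ∀ H : HeightAssignment D,
      (D.withHeights H).cls k - (D.withHeights (H.trans σ)).cls k ∈ P := by
    intro σ
    induction perm_fin_mem_closure σ using Submonoid.closure_induction with
    | mem σ h =>
      obtain ⟨i, j, hij, rfl⟩ := h
      exact fun H => cls_sub_cls_swap_mem P hP H hij
    | one =>
      intro H
      have : H.trans (1 : Equiv.Perm (Fin _)) = H := Equiv.ext fun _ => rfl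
      rw [this, sub_self]
      exact P.zero_mem
    | mul σ τ _ _ hσ hτ =>
      intro H
      have := P.add_mem (hτ H) (hσ (H.trans τ))
      rwa [sub_add_sub_cancel] at this
  have := key (H.symm.trans H') H
  rwa [← Equiv.trans_assoc, Equiv.self_trans_symm, Equiv.refl_trans] at this

/-- Replace each height by its rank among the heights of the edges. -/
theorem HDiagram.exists_heightAssignment [Fintype ι] (D : HDiagram V ι) :
    ∃ H : HeightAssignment D.toDiagram, D.cls k = (D.toDiagram.withHeights H).cls k := by
  classical
  let : LinearOrder {x // D.IsEdge x} := LinearOrder.lift' (fun x => D.height x.1)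
    fun x y h => Subtype.ext (D.height_inj _ _ x.2 y.2 h)
  let e := Fintype.orderIsoFinOfCardEq {x // D.IsEdge x} Nat.card_eq_fintype_card.symm
  refine ⟨e.symm.toEquiv, D.cls_eq_of_lt_iff (D' := D.toDiagram.withHeights e.symm.toEquiv) rfl
    fun x y hx hy => ?_⟩
  rw [Diagram.height_withHeights _ _ hx, Diagram.height_withHeights _ _ hy, add_lt_add_iff_right]
  exact (e.symm.lt_iff_lt (x := ⟨x, hx⟩) (y := ⟨y, hy⟩)).symm

variable [CharZero k]

theorem card_heightAssignment [Finite ι] (D : Diagram (DEdge V) ι) :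
    Fintype.card (HeightAssignment D) = (Nat.card {x // D.IsEdge x}).factorial := by
  classical
  have := Fintype.ofFinite {x // D.IsEdge x}
  rw [← Nat.card_eq_fintype_card, Nat.card_eq_fintype_card (α := {x // D.IsEdge x})]
  have e : {x // D.IsEdge x} ≃ Fin (Nat.card {x // D.IsEdge x}) := Finite.equivFin _
  rw [Nat.card_congr (Equiv.equivCongr (Equiv.refl _) e.symm), Nat.card_eq_fintype_card,
    Fintype.card_perm]

theorem C_inv_factorial_smul {M : Type*} [AddCommGroup M] [Module k[X] M] (n : ℕ) (a : M) :
    Polynomial.C ((n.factorial : k)⁻¹) • (n.factorial • a) = a := by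
  rw [← Nat.cast_smul_eq_nsmul k[X], smul_smul, ← Polynomial.C_eq_natCast, ← Polynomial.C_mul,
    inv_mul_cancel₀ (Nat.cast_ne_zero.2 n.factorial_ne_zero), Polynomial.C_1, one_smul]

/-- The symmetrization map is surjective. -/
theorem phiW_surjective : Function.Surjective (phiW k (V := V)) := by
  have key : ∀ N : ℕ, ∀ (ι : Type) [Fintype ι] (D : HDiagram V ι),
      Nat.card {x // D.IsEdge x} = N → D.cls k ∈ LinearMap.range (phiW k (V := V)) := by
    intro N
    induction N using Nat.strong_induction_on with
    | _ N ih =>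
      intro ι _ D hN
      obtain ⟨H₀, h₀⟩ := D.exists_heightAssignment (k := k)
      have h1 : D.toDiagram.average k ∈ LinearMap.range (phiW k (V := V)) :=
        ⟨_, phiW_coll D.toDiagram⟩
      -- Divided by N!, this sum is the class of `D` minus its average. The average is in the range
      -- by construction, and each difference is in the range by induction on the number of edges.
      have h2 : ∑ H : HeightAssignment D.toDiagram, ((D.toDiagram.withHeights H₀).cls k -
          (D.toDiagram.withHeights H).cls k) ∈ LinearMap.range (phiW k (V := V)) := by
        refine Submodule.sum_mem _ fun H _ => cls_sub_cls_mem _ (fun D' hD' => ?_) H₀ H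
        exact ih _ (hN ▸ hD') ι D' rfl
      rw [Finset.sum_sub_distrib, Finset.sum_const, Finset.card_univ,
        card_heightAssignment, ← h₀] at h2
      have h3 := Submodule.add_mem _ (Submodule.smul_mem _
        (Polynomial.C (((Nat.card {x // D.IsEdge x}).factorial : k)⁻¹)) h2) h1
      rw [smul_sub, C_inv_factorial_smul] at h3
      unfold Diagram.average at h3
      rwa [sub_add_cancel] at h3
  rw [← LinearMap.range_eq_top, eq_top_iff, ← span_cls, Submodule.span_le]
  rintro _ ⟨ι, _, D, rfl⟩
  exact key _ ι D rfl

end Surjective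

section Injective

variable [CharZero k]

/-- Choose a cut pair and exchange the heights of its two edges. The factor of this pair changes
sign and no other factor changes, so the sum over all height assignments equals its own negative. -/
theorem sum_weight_heightWeight_eq_zero [Fintype ι] {D : Diagram (DEdge V) ι} (φ : D.Cutting)
    (hφ : φ.1 ≠ 1) :
    ∑ H : HeightAssignment D, D.weight (heightWeight k (D.withHeights H).height) φ.1 = 0 := by
  classical
  obtain ⟨x, hx⟩ : ∃ x, x ∈ D.cutQ φ.1 := by
    by_contra! h
    refine hφ (Equiv.ext fun x => ?_)
    by_contra hx
    exact (φ.2.mem_cutQ_or hx).elim (h x) (h _)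
  have hx' := Diagram.mem_cutQ.1 hx
  have hex : D.IsEdge x := φ.2.isEdge hx'.1
  have hey : D.IsEdge (φ.1 x) := φ.2.isEdge (φ.2.apply_ne hx'.1)
  let σ : Equiv.Perm {x // D.IsEdge x} := Equiv.swap ⟨x, hex⟩ ⟨φ.1 x, hey⟩
  have hσ : ∀ H : HeightAssignment D,
      D.weight (heightWeight k (D.withHeights (σ.trans H)).height) φ.1 =
        -D.weight (heightWeight k (D.withHeights H).height) φ.1 := by
    intro H
    have h1 : (D.withHeights (σ.trans H)).height x = (D.withHeights H).height (φ.1 x) := by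
      rw [D.height_withHeights _ hex, D.height_withHeights _ hey, Equiv.trans_apply,
        Equiv.swap_apply_left]
    have h2 : (D.withHeights (σ.trans H)).height (φ.1 x) = (D.withHeights H).height x := by
      rw [D.height_withHeights _ hex, D.height_withHeights _ hey, Equiv.trans_apply,
        Equiv.swap_apply_right]
    have h3 : ∀ z, z ≠ x → z ≠ φ.1 x →
        (D.withHeights (σ.trans H)).height z = (D.withHeights H).height z := by
      intro z hzx hzy
      by_cases hz : D.IsEdge z
      · rw [D.height_withHeights _ hz, D.height_withHeights _ hz, Equiv.trans_apply,
          Equiv.swap_apply_of_ne_of_ne]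
        · exact fun h => hzx (congrArg Subtype.val h)
        · exact fun h => hzy (congrArg Subtype.val h)
      · rw [D.height_withHeights_of_not _ hz, D.height_withHeights_of_not _ hz]
    unfold Diagram.weight
    rw [← Finset.mul_prod_erase _ _ hx, ← Finset.mul_prod_erase _ _ hx, neg_mul_eq_neg_mul]
    congr 1
    · have hne : (D.withHeights H).height x ≠ (D.withHeights H).height (φ.1 x) :=
        fun h => hx'.1 ((D.withHeights H).height_inj _ _ hex hey h).symm
      unfold heightWeight
      rw [h1, h2]
      rcases lt_or_gt_of_ne hne with h | h
      · rw [if_neg h.not_gt, if_pos h]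
      · rw [if_pos h, if_neg h.not_gt, neg_neg]
    · refine Finset.prod_congr rfl fun z hz => ?_
      rw [Finset.mem_erase, Diagram.mem_cutQ] at hz
      -- The partner of `x` is not in `Q`, so no other factor of the product involves the chosen
      -- pair.
      have hzy : z ≠ φ.1 x := by
        rintro rfl
        exact (φ.2.isQ_apply_iff hx'.1).1 hz.2.2 hx'.2
      unfold heightWeight
      rw [h3 z hz.1 hzy, h3 (φ.1 z) ?_ fun h => hz.1 (φ.1.injective h)]
      intro h
      exact hzy (by rw [← h, φ.2.invol])
  have hs := Fintype.sum_equiv (Equiv.equivCongr σ.symm (Equiv.refl _))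
    (fun H : HeightAssignment D =>
      D.weight (heightWeight k (D.withHeights (σ.trans H)).height) φ.1)
    (fun H : HeightAssignment D => D.weight (heightWeight k (D.withHeights H).height) φ.1)
    fun H => rfl
  simp only [hσ, Finset.sum_neg_distrib] at hs
  exact neg_eq_self.1 hs

/-- After averaging, only the empty cutting survives, and its term is the collection itself. -/
theorem wickMap_average [Fintype ι] (D : Diagram (DEdge V) ι) :
    wickMap k V (D.average k) = coll k D.collection := by
  classical
  unfold Diagram.average
  rw [map_smul, map_sum]
  simp only [wickMap_cls]
  have h : ∑ H : HeightAssignment D, (D.withHeights H).wick k =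
      (Nat.card {x // D.IsEdge x}).factorial • coll k D.collection := by
    have h1 : ∀ H : HeightAssignment D, (D.withHeights H).wick k = ∑ φ : D.Cutting,
        D.weight (heightWeight k (D.withHeights H).height) φ.1 •
          coll k (D.cutAt φ).collection := fun H => rfl
    simp only [h1]
    rw [Finset.sum_comm]
    simp only [← Finset.sum_smul]
    rw [Finset.sum_eq_single (⟨1, D.isCutting_one⟩ : D.Cutting)]
    · simp only [Diagram.weight_one, Finset.sum_const, Finset.card_univ, card_heightAssignment,
        D.cut_one, nsmul_eq_mul, mul_one, Nat.cast_smul_eq_nsmul]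
    · intro φ _ hφ
      rw [sum_weight_heightWeight_eq_zero φ fun h => hφ (Subtype.ext h), zero_smul]
    · exact fun h => absurd (Finset.mem_univ _) h
  refine Eq.trans ?_ (C_inv_factorial_smul (k := k) (Nat.card {x // D.IsEdge x}) _)
  rw [h]

theorem wickMap_phiW (a : SymL k V) : wickMap k V (phiW k a) = a := by
  have : wickMap k V ∘ₗ phiW k = LinearMap.id := linearMap_ext_coll fun s => by
    rw [LinearMap.comp_apply, ← collection_diagram s, phiW_coll, wickMap_average]
    rfl
  exact LinearMap.congr_fun this a

variable (k V) in
/-- The symmetrization map as an isomorphism. -/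
noncomputable def phiEquiv : SymL k V ≃ₗ[k[X]] Ah k V :=
  LinearEquiv.ofLinearMap (phiW k) (wickMap k V)
    (LinearMap.ext fun a => by
      obtain ⟨b, rfl⟩ := phiW_surjective a
      rw [LinearMap.comp_apply, wickMap_phiW]
      rfl)
    (LinearMap.ext wickMap_phiW)

theorem phiEquiv_apply (a : SymL k V) : phiEquiv k V a = phiW k a := rfl

theorem phiEquiv_symm_cls [Fintype ι] (D : HDiagram V ι) :
    (phiEquiv k V).symm (D.cls k) = D.wick k := wickMap_cls D

end Injective

end Symmetrization

/-! ### Product, coproduct and counit of `A_h(Q)` under the Wick map -/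

section Formulas

variable {k : Type w} [Field k] {V : Type u} [Quiver.{v} V] {ι κ : Type} [Fintype ι] [Fintype κ]

/-- The weights on a juxtaposition that only pair places of the same diagram. -/
def blockWeight {R : Type*} [Zero R] (A : ι → ι → R) (B : κ → κ → R) : ι ⊕ κ → ι ⊕ κ → R
  | .inl x, .inl y => A x y
  | .inr x, .inr y => B x y
  | _, _ => 0

/-- Cutting within the two factors and then between them is a two-stage cutting of the
juxtaposition, so the weights add. -/
theorem moyalMul_cutColl (D : Diagram (DEdge V) ι) (D' : Diagram (DEdge V) κ)
    (A : ι → ι → k[X]) (B : κ → κ → k[X]) :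
    moyalMul k (D.cutColl A) (D'.cutColl B) =
      (D.sum D').cutColl (blockWeight A B + crossWeight) := by
  classical
  have h := Diagram.cutSum_cutSum (D := D.sum D') (blockWeight A B) (crossWeight (k := k))
    fun θ => coll k ((D.sum D').cutAt θ).collection
  refine Eq.trans ?_ h
  rw [Diagram.cutSum_sum _ (fun _ _ => rfl) fun _ _ => rfl]
  unfold Diagram.cutColl
  conv_lhs => unfold Diagram.cutSum
  rw [map_sum (moyalMul k), LinearMap.sum_apply]
  refine Finset.sum_congr rfl fun φ _ => ?_
  rw [map_smul, LinearMap.smul_apply, map_sum]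
  congr 1
  refine Finset.sum_congr rfl fun ψ _ => ?_
  rw [map_smul, moyalMul_coll]
  congr 1
  rw [← Diagram.cutAt_sum]
  unfold Diagram.cutColl Diagram.cutSum
  refine Finset.sum_congr rfl fun θ _ => ?_
  beta_reduce
  rw [Diagram.cutAt_comp]

open scoped Classical in
theorem moyalComul_cutColl (D : Diagram (DEdge V) ι) (A : ι → ι → k[X]) :
    moyalComul k (D.cutColl A) =
      ∑ c : ι → Fin 2, D.cutSum (A + compWeight c) fun θ => tensorTerm (k := k) (D.cutAt θ) c := by
  have h : ∀ c : ι → Fin 2,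
      D.cutSum (A + compWeight c) (fun θ => tensorTerm (k := k) (D.cutAt θ) c) =
      D.cutSum A fun φ => (D.cutAt φ).cutSum (compWeight (k := k) c) fun ψ =>
        tensorTerm (k := k) ((D.cutAt φ).cutAt ψ) c := by
    intro c
    rw [← Diagram.cutSum_cutSum]
    simp only [Diagram.cutAt_comp]
  simp only [h]
  unfold Diagram.cutColl Diagram.cutSum
  rw [map_sum, Finset.sum_comm]
  refine Finset.sum_congr rfl fun φ _ => ?_
  rw [map_smul, moyalComul_coll, comulSum_eq_sum, ← Finset.smul_sum]
  rfl

/-- The weights `A`, on the pairs of places that are assigned to the same factor. -/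
def sameWeight {R : Type*} [Zero R] (c : ι → Fin 2) (A : ι → ι → R) (x y : ι) : R :=
  if c x = c y then A x y else 0

theorem comp_eq_of_weight_sameWeight_ne_zero {R : Type*} [CommRing R] {D : Diagram (DEdge V) ι}
    {c : ι → Fin 2} {A : ι → ι → R} {φ : D.Cutting} (h : D.weight (sameWeight c A) φ.1 ≠ 0)
    (x : ι) : c (φ.1 x) = c x := by
  by_cases hx : φ.1 x = x
  · rw [hx]
  · by_contra hc
    rcases φ.2.mem_cutQ_or hx with hq | hq
    · exact h (Diagram.weight_eq_zero hq (if_neg (Ne.symm hc)))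
    · refine h (Diagram.weight_eq_zero hq (if_neg ?_))
      rw [φ.2.invol]
      exact hc

/-- A nonzero weight forces paired places to have the same colour. Then a colouring constant on the
necklaces after cutting was already constant on those before. -/
theorem cutSum_sameWeight_eq_zero {D : Diagram (DEdge V) ι} {c : ι → Fin 2}
    (hc : ¬ ∀ x, c (D.next x) = c x) (A : ι → ι → k[X]) :
    D.cutSum (sameWeight c A) (fun φ => tensorTerm (k := k) (D.cutAt φ) c) = 0 := by
  refine Finset.sum_eq_zero fun φ _ => ?_
  by_cases h : D.weight (sameWeight c A) φ.1 = 0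
  · rw [h, zero_smul]
  · beta_reduce
    rw [tensorTerm_of_not, smul_zero]
    refine fun h' => hc fun x => ?_
    have h1 := h' (φ.1 x)
    have h1 : c (D.next (φ.1 (φ.1 x))) = c (φ.1 x) := h1
    rw [φ.2.invol, comp_eq_of_weight_sameWeight_ne_zero h] at h1
    exact h1

theorem tensorTerm_cutting_sum {D : Diagram (DEdge V) ι} (c : Components D)
    (φ : (D.part c 0).Cutting) (ψ : (D.part c 1).Cutting) :
    tensorTerm (k := k) (D.cutAt ((D.contractionParts c).cutting (φ.sum ψ))) c.1 =
      coll k ((D.part c 0).cutAt φ).collection ⊗ₜ[k[X]]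
        coll k ((D.part c 1).cutAt ψ).collection := by
  set θ := (D.contractionParts c).cutting (φ.sum ψ) with hθ
  have h0 : ∀ x, θ.1 x.1 = (φ.1 x).1 := fun x =>
    (D.contractionParts c).cutting_emb (φ.sum ψ) (.inl x)
  have h1 : ∀ x, θ.1 x.1 = (ψ.1 x).1 := fun x =>
    (D.contractionParts c).cutting_emb (φ.sum ψ) (.inr x)
  have hc : ∀ x, c.1 ((D.cutAt θ).next x) = c.1 x := by
    intro x
    refine (c.2 (θ.1 x)).trans ?_
    by_cases hx : c.1 x = 0
    · rw [h0 ⟨x, hx⟩, hx]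
      exact (φ.1 ⟨x, hx⟩).2
    · have hx : c.1 x = 1 := by omega
      rw [h1 ⟨x, hx⟩, hx]
      exact (ψ.1 ⟨x, hx⟩).2
  have key : ∀ (i : Fin 2) (η : (D.part c i).Cutting), (∀ x, θ.1 x.1 = (η.1 x).1) →
      (D.cutAt θ).part ⟨c.1, hc⟩ i = (D.part c i).cutAt η := by
    intro i η h
    refine Diagram.ext_of_eq (fun x => ?_) fun x => ?_
    · have e : η.1 x = x ↔ θ.1 x.1 = x.1 := by rw [h, Subtype.ext_iff]
      change D.cutLabel θ.1 x.1 = (D.part c i).cutLabel η.1 x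
      by_cases hx : η.1 x = x
      · rw [Diagram.cutLabel_of_eq _ hx, Diagram.cutLabel_of_eq _ (e.1 hx)]
        rfl
      · rw [Diagram.cutLabel_of_ne _ hx, Diagram.cutLabel_of_ne _ (mt e.2 hx)]
        rfl
    · exact Subtype.ext (congrArg D.next (h x))
  rw [tensorTerm_component ⟨c.1, hc⟩, key 0 φ h0, key 1 ψ h1]

/-- Cutting the two parts independently is cutting `D` without pairs between them, which is what
`sameWeight` enforces. -/
theorem cutColl_tmul_cutColl {D : Diagram (DEdge V) ι} (c : Components D) (A : ι → ι → k[X]) :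
    (D.part c 0).cutColl (fun x y => A x.1 y.1) ⊗ₜ[k[X]]
      (D.part c 1).cutColl (fun x y => A x.1 y.1) =
    D.cutSum (sameWeight c.1 A) fun φ => tensorTerm (D.cutAt φ) c.1 := by
  have h0 : ∀ x y : {x // c.1 x = 0}, sameWeight c.1 A x.1 y.1 = A x.1 y.1 :=
    fun x y => if_pos (x.2.trans y.2.symm)
  have h1 : ∀ x y : {x // c.1 x = 1}, sameWeight c.1 A x.1 y.1 = A x.1 y.1 :=
    fun x y => if_pos (x.2.trans y.2.symm)
  rw [(D.contractionParts c).cutSum_eq, Diagram.cutSum_sum]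
  · unfold Diagram.cutColl
    conv_lhs => unfold Diagram.cutSum
    rw [TensorProduct.sum_tmul]
    unfold Diagram.cutSum
    refine Finset.sum_congr rfl fun φ _ => ?_
    rw [← TensorProduct.smul_tmul', TensorProduct.tmul_sum]
    congr 1
    · exact Diagram.weight_congr fun x _ => (h0 _ _).symm
    · refine Finset.sum_congr rfl fun ψ _ => ?_
      beta_reduce
      rw [TensorProduct.tmul_smul, tensorTerm_cutting_sum]
      congr 1
      exact Diagram.weight_congr fun x _ => (h1 _ _).symm
  · intro x y
    exact if_neg (show ¬ c.1 x.1 = c.1 y.1 by rw [x.2, y.2]; decide)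
  · intro x y
    exact if_neg (show ¬ c.1 x.1 = c.1 y.1 by rw [x.2, y.2]; decide)

/-- Stacking corresponds to the Moyal product. -/
theorem wick_stack (D : HDiagram V ι) (D' : HDiagram V κ) :
    (D.stack D').wick k = moyalMul k (D.wick k) (D'.wick k) := by
  refine Eq.trans ?_ (moyalMul_cutColl _ _ _ _).symm
  refine congrArg (Diagram.cutColl _) ?_
  -- All edges of `D` lie below those of `D'`, so the height weight between the two diagrams is
  -- exactly the weight of the Moyal product; within each diagram the order of heights is unchanged.
  funext x y
  rcases x with x | x <;> rcases y with y | y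
  · exact (add_zero _).symm
  · have := Finset.le_sup (f := D.height) (Finset.mem_univ x)
    exact (if_pos (show D.height x < D'.height y + (Finset.univ.sup D.height + 1) by omega)).trans
      (zero_add _).symm
  · have := Finset.le_sup (f := D.height) (Finset.mem_univ y)
    exact (if_neg (show ¬ D'.height x + (Finset.univ.sup D.height + 1) < D.height y by
      omega)).trans (zero_add _).symm
  · refine Eq.trans ?_ (add_zero _).symm
    exact if_congr (add_lt_add_iff_right _) rfl rfl

variable (k) in
/-- The weights of the coproduct of `A_h(Q)`. -/
noncomputable def heightCompWeight (H : ι → ℕ) (c : ι → Fin 2) (x y : ι) : k[X] :=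
  if H x < H y then (if c x = 0 ∧ c y = 1 then Polynomial.X else 0)
  else if c y = 0 ∧ c x = 1 then -Polynomial.X else 0

-- For equal colours both sides are the height weight. For colours 0, 1 the right side is h/2 + h/2
-- = h when `x` is lower and -h/2 + h/2 = 0 otherwise; for 1, 0 it is 0 or -h. These are the weights
-- of the coproduct of `A_h(Q)`.
omit [Fintype ι] in
theorem heightCompWeight_add [CharZero k] (H : ι → ℕ) (c : ι → Fin 2) :
    heightCompWeight k H c + sameWeight c (heightWeight k H) =
      heightWeight k H + compWeight c := by
  funext x y
  have h := halfH_add_halfH k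
  simp only [Pi.add_apply, heightCompWeight, sameWeight, heightWeight, compWeight, ← h]
  have h2 : ∀ i : Fin 2, i = 0 ∨ i = 1 := by decide
  rcases h2 (c x) with hx | hx <;> rcases h2 (c y) with hy | hy <;> by_cases hlt : H x < H y <;>
    simp [hx, hy, hlt]

omit [Fintype ι] in
theorem signAt_of_isQ {D : Diagram (DEdge V) ι} {x : ι} (h : D.IsQ x) : D.signAt x = 1 := by
  obtain ⟨a | a, ha, hq⟩ := h
  · rw [Diagram.signAt, ha]
    rfl
  · exact hq.elim

omit [Fintype ι] in
theorem signAt_of_not_isQ {D : Diagram (DEdge V) ι} {x : ι} (h : ¬ D.IsQ x) (hx : D.IsEdge x) :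
    D.signAt x = -1 := by
  obtain ⟨a | a, ha⟩ := hx
  · exact absurd ⟨_, ha, trivial⟩ h
  · rw [Diagram.signAt, ha]
    rfl

omit [Fintype ι] in
theorem HDiagram.height_apply_ne (D : HDiagram V ι) (φ : D.Cutting) {x : ι} (hx : φ.1 x ≠ x) :
    D.height x ≠ D.height (φ.1 x) := fun h =>
  hx (D.height_inj _ _ (φ.2.isEdge hx) (φ.2.isEdge (φ.2.apply_ne hx)) h).symm

/-- Each pair has one lower edge and one edge in `Q`, and its sign is positive exactly when they
coincide. The product is reindexed from the former to the latter. -/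
theorem HDiagram.cutSign_eq (D : HDiagram V ι) (φ : D.Cutting) :
    D.cutSign φ.1 =
      ∏ x ∈ D.cutQ φ.1, if D.height x < D.height (φ.1 x) then (1 : ℤ) else -1 := by
  classical
  symm
  refine Finset.prod_bij (fun x _ => if D.height x < D.height (φ.1 x) then x else φ.1 x)
    ?_ ?_ ?_ ?_
  · intro x hx
    have hx := (Diagram.mem_cutQ.1 hx).1
    refine Finset.mem_filter.2 ⟨Finset.mem_univ _, ?_⟩
    by_cases h : D.height x < D.height (φ.1 x)
    · rw [if_pos h]
      exact ⟨hx, h⟩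
    · rw [if_neg h, φ.2.invol]
      exact ⟨Ne.symm hx, lt_of_le_of_ne (not_lt.1 h) (D.height_apply_ne φ hx).symm⟩
  · intro x hx y hy h
    have hx := Diagram.mem_cutQ.1 hx
    have hy := Diagram.mem_cutQ.1 hy
    split_ifs at h with h1 h2 h2
    · exact h
    · rw [h, φ.2.isQ_apply_iff hy.1] at hx
      exact absurd hy.2 hx.2
    · rw [← h, φ.2.isQ_apply_iff hx.1] at hy
      exact absurd hx.2 hy.2
    · exact φ.1.injective h
  · intro z hz
    obtain ⟨hz, hlt⟩ := (Finset.mem_filter.1 hz).2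
    by_cases hq : D.IsQ z
    · exact ⟨z, Diagram.mem_cutQ.2 ⟨hz, hq⟩, if_pos hlt⟩
    · refine ⟨φ.1 z, Diagram.mem_cutQ.2 ⟨φ.2.apply_ne hz, (φ.2.isQ_apply_iff hz).2 hq⟩, ?_⟩
      rw [φ.2.invol]
      exact if_neg hlt.not_gt
  · intro x hx
    obtain ⟨hx, hq⟩ := Diagram.mem_cutQ.1 hx
    by_cases h : D.height x < D.height (φ.1 x)
    · rw [if_pos h, if_pos h, signAt_of_isQ hq]
    · rw [if_neg h, if_neg h, signAt_of_not_isQ (fun h' => (φ.2.isQ_apply_iff hx).1 h' hq)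
        (φ.2.isEdge (φ.2.apply_ne hx))]

/-- As for the Moyal coproduct, c(x + 1) = c(φ x), so compatibility with the heights is a condition
on each pair separately and can be absorbed into the weight. -/
theorem HDiagram.weight_heightCompWeight (D : HDiagram V ι) (φ : D.Cutting)
    (c : Components (D.cutAt φ)) [Decidable (D.Compatible φ.1 c.1)] :
    D.weight (heightCompWeight k D.height c.1) φ.1 =
      if D.Compatible φ.1 c.1 then (D.cutSign φ.1 : k[X]) * Polynomial.X ^ D.numPairs φ.1
      else 0 := by
  have hn : ∀ x, c.1 (D.next x) = c.1 (φ.1 x) := by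
    intro x
    have h : c.1 (D.next (φ.1 (φ.1 x))) = c.1 (φ.1 x) := c.2 (φ.1 x)
    rwa [φ.2.invol] at h
  split_ifs with hc
  · rw [D.cutSign_eq φ, Int.cast_prod]
    have hX : (Polynomial.X : k[X]) ^ D.numPairs φ.1 = ∏ _x ∈ D.cutQ φ.1, Polynomial.X :=
      (Finset.prod_const _).symm
    rw [hX, ← Finset.prod_mul_distrib]
    refine Finset.prod_congr rfl fun x hx => ?_
    obtain ⟨hx, hq⟩ := Diagram.mem_cutQ.1 hx
    unfold heightCompWeight
    by_cases h : D.height x < D.height (φ.1 x)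
    · have := hc x hx h
      rw [hn] at this
      rw [if_pos h, if_pos h, if_pos this, Int.cast_one, one_mul]
    · have := hc (φ.1 x) (φ.2.apply_ne hx) (by
        rw [φ.2.invol]
        exact lt_of_le_of_ne (not_lt.1 h) (D.height_apply_ne φ hx).symm)
      rw [hn, φ.2.invol] at this
      rw [if_neg h, if_neg h, if_pos this, Int.cast_neg, Int.cast_one, neg_one_mul]
  · unfold HDiagram.Compatible at hc
    push Not at hc
    obtain ⟨x, hx, hlt, h⟩ := hc
    have h : ¬ (c.1 x = 0 ∧ c.1 (φ.1 x) = 1) := fun h' => h h'.1 ((hn x).trans h'.2)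
    rcases φ.2.mem_cutQ_or hx with hq | hq
    · refine Diagram.weight_eq_zero hq ?_
      rw [heightCompWeight, if_pos hlt, if_neg h]
    · refine Diagram.weight_eq_zero hq ?_
      rw [heightCompWeight, φ.2.invol, if_neg hlt.not_gt, if_neg h]

variable [CharZero k]

-- On the left, cut along compatible pairs and then apply the Wick sum in each part; on the right,
-- apply the Wick sum and then the Moyal coproduct. For each colouring both are one cutting with the
-- two sides of `heightCompWeight_add` as weights.
open scoped Classical in
theorem map_wickMap_comulCls (D : HDiagram V ι) :
    TensorProduct.map (wickMap k V) (wickMap k V) (D.comulCls k) = moyalComul k (D.wick k) := by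
  have h : ∀ c : ι → Fin 2,
      D.cutSum (heightWeight k D.height + compWeight c)
        (fun θ => tensorTerm (k := k) (D.cutAt θ) c) =
      D.cutSum (heightCompWeight k D.height c) fun φ =>
        (D.cutAt φ).cutSum (sameWeight c (heightWeight k D.height)) fun ψ =>
          tensorTerm ((D.cutAt φ).cutAt ψ) c := by
    intro c
    rw [← heightCompWeight_add, ← Diagram.cutSum_cutSum]
    simp only [Diagram.cutAt_comp]
  unfold HDiagram.wick
  rw [moyalComul_cutColl]
  simp only [h]
  unfold HDiagram.comulCls
  rw [map_sum]
  conv_rhs => unfold Diagram.cutSum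
  rw [Finset.sum_comm]
  refine Finset.sum_congr (Finset.ext fun φ => by simp) fun φ _ => ?_
  rw [map_sum]
  refine Eq.trans ?_ (sum_components (D.cutAt φ) (fun c =>
    D.weight (heightCompWeight k D.height c) φ.1 •
      (D.cutAt φ).cutSum (sameWeight c (heightWeight k D.height)) fun ψ =>
        tensorTerm ((D.cutAt φ).cutAt ψ) c) fun c hc => ?_)
  · refine Finset.sum_congr rfl fun c _ => ?_
    rw [D.weight_heightCompWeight φ c]
    split_ifs with hc
    · rw [map_smul, TensorProduct.map_tmul, wickMap_cls, wickMap_cls]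
      congr 1
      exact cutColl_tmul_cutColl c (heightWeight k D.height)
    · rw [map_zero, zero_smul]
  · rw [cutSum_sameWeight_eq_zero hc, smul_zero]

omit [Fintype ι] [CharZero k] in
theorem moyalCounit_coll (s : Multiset (Necklace (DEdge V))) [Decidable (s = 0)] :
    moyalCounit k (coll k s) = if s = 0 then 1 else 0 := by
  rw [moyalCounit, linExt_coll]
  split_ifs <;> rfl

-- Cutting turns edges into idempotents but keeps all places, so it yields the empty collection only
-- from the empty diagram.
omit [CharZero k] in
theorem moyalCounit_cutColl (D : Diagram (DEdge V) ι) (A : ι → ι → k[X]) [Decidable (IsEmpty ι)] :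
    moyalCounit k (D.cutColl A) = if IsEmpty ι then 1 else 0 := by
  classical
  unfold Diagram.cutColl Diagram.cutSum
  rw [map_sum]
  simp only [map_smul, moyalCounit_coll, Diagram.collection_eq_zero_iff]
  split_ifs with h
  · have : Subsingleton D.Cutting := ⟨fun φ ψ => Subtype.ext (Subsingleton.elim _ _)⟩
    rw [Fintype.sum_subsingleton _ (⟨1, D.isCutting_one⟩ : D.Cutting), Diagram.weight_one, one_smul]
  · simp

variable (k V) in
/-- The product of `A_h(Q)`. -/
noncomputable def Ah.mul : Ah k V →ₗ[k[X]] Ah k V →ₗ[k[X]] Ah k V :=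
  ((moyalMul k).compl₁₂ (wickMap k V) (wickMap k V)).compr₂ (phiW k)

variable (k V) in
/-- The coproduct of `A_h(Q)`. -/
noncomputable def Ah.comul : Ah k V →ₗ[k[X]] Ah k V ⊗[k[X]] Ah k V :=
  TensorProduct.map (phiW k) (phiW k) ∘ₗ moyalComul k ∘ₗ wickMap k V

variable (k V) in
/-- The counit of `A_h(Q)`. -/
noncomputable def Ah.counit : Ah k V →ₗ[k[X]] k[X] := moyalCounit k ∘ₗ wickMap k V

theorem phiW_wickMap (a : Ah k V) : phiW k (wickMap k V a) = a :=
  (phiEquiv k V).apply_symm_apply a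

-- Since the operations are transported from `(Sym L)[h]` along an isomorphism, they respect the
-- relations automatically; only their values on classes have to be identified.
variable (k V) in
theorem isAhStructure : IsAhStructure k (Ah.mul k V) (Ah.comul k V) (Ah.counit k V) where
  mul_cls D D' := by
    refine Eq.trans ?_ (phiW_wickMap _)
    rw [wickMap_cls, wick_stack, ← wickMap_cls, ← wickMap_cls]
    rfl
  comul_cls D := by
    have h : ∀ t : Ah k V ⊗[k[X]] Ah k V, TensorProduct.map (phiW k) (phiW k)
        (TensorProduct.map (wickMap k V) (wickMap k V) t) = t := by
      intro t
      rw [← LinearMap.comp_apply, ← TensorProduct.map_comp]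
      have : phiW k ∘ₗ wickMap k V = LinearMap.id := LinearMap.ext phiW_wickMap
      rw [this, TensorProduct.map_id]
      rfl
    rw [← h (D.comulCls k), map_wickMap_comulCls, ← wickMap_cls]
    rfl
  counit_cls D := by
    classical
    change moyalCounit k (wickMap k V (D.cls k)) = _
    rw [wickMap_cls]
    exact moyalCounit_cutColl _ _

end Formulas

/-! ### Associativity, unit, and multiplicativity of the coproduct -/

section BialgebraAxioms

variable {k : Type w} [Field k] {V : Type u} [Quiver.{v} V] {ι κ : Type} [Fintype ι] [Fintype κ]

theorem Diagram.weight_of_ne_one_eq_zero {R : Type*} [CommRing R] {D : Diagram (DEdge V) ι}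
    {φ : D.Cutting} (h : φ.1 ≠ 1) : D.weight (0 : ι → ι → R) φ.1 = 0 := by
  obtain ⟨x, hx⟩ : ∃ x, φ.1 x ≠ x := by
    by_contra! h'
    exact h (Equiv.ext h')
  rcases φ.2.mem_cutQ_or hx with hq | hq <;> exact Diagram.weight_eq_zero hq rfl

theorem Diagram.cutSum_zero {R : Type*} [CommRing R] {M : Type*} [AddCommGroup M] [Module R M]
    (D : Diagram (DEdge V) ι) (T : D.Cutting → M) :
    D.cutSum (0 : ι → ι → R) T = T ⟨1, D.isCutting_one⟩ := by
  classical
  unfold cutSum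
  rw [Finset.sum_eq_single (⟨1, D.isCutting_one⟩ : D.Cutting)]
  · rw [weight_one, one_smul]
  · intro φ _ hφ
    rw [weight_of_ne_one_eq_zero fun h => hφ (Subtype.ext h), zero_smul]
  · exact fun h => absurd (Finset.mem_univ _) h

theorem Diagram.cutColl_zero (D : Diagram (DEdge V) ι) : D.cutColl (0 : ι → ι → k[X]) = coll k D.collection := by
  rw [cutColl, cutSum_zero]
  exact congrArg (coll k) (congrArg Diagram.collection D.cut_one)

/-- Weight zero allows only the empty cutting. Written in this form, collections can be fed into
`moyalMul_cutColl` repeatedly. -/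
theorem coll_eq_cutColl (s : Multiset (Necklace (DEdge V))) :
    coll k s = (diagram s).cutColl 0 := by
  rw [Diagram.cutColl_zero, collection_diagram]

theorem one_eq_cutColl : (1 : SymL k V) = (HDiagram.empty (V := V)).cutColl 0 := by
  rw [Diagram.cutColl_zero, (Diagram.collection_eq_zero_iff _).2 inferInstance, coll_zero]

/-- Bilinear maps on `(Sym L)[h]` are determined by their values on collections of necklaces. -/
theorem bilinearMap_ext_coll {M : Type*} [AddCommGroup M] [Module k[X] M]
    {f g : SymL k V →ₗ[k[X]] SymL k V →ₗ[k[X]] M}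
    (h : ∀ s t, f (coll k s) (coll k t) = g (coll k s) (coll k t)) : f = g :=
  linearMap_ext_coll fun s => linearMap_ext_coll (h s)

/-- Both bracketings are the sum over the cuttings of the juxtaposition of three diagrams with
weight h/2 from an earlier factor to a later one and -h/2 backwards. -/
theorem moyalMul_assoc (a b c : SymL k V) :
    moyalMul k (moyalMul k a b) c = moyalMul k a (moyalMul k b c) := by
  have h : ∀ s t r : Multiset (Necklace (DEdge V)),
      moyalMul k (moyalMul k (coll k s) (coll k t)) (coll k r) =
        moyalMul k (coll k s) (moyalMul k (coll k t) (coll k r)) := by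
    intro s t r
    rw [coll_eq_cutColl s, coll_eq_cutColl t, coll_eq_cutColl r]
    simp only [moyalMul_cutColl]
    refine ((Diagram.Contraction.ofEquiv
      (D₀ := (diagram s).sum ((diagram t).sum (diagram r)))
      (D := ((diagram s).sum (diagram t)).sum (diagram r)) (Equiv.sumAssoc _ _ _).symm
      (by rintro (x | x | x) <;> rfl) (by rintro (x | x | x) <;> rfl)).cutColl_eq _).trans
        (congrArg (Diagram.cutColl _) ?_)
    funext x y
    rcases x with x | x | x <;> rcases y with y | y | y <;>
      simp [Diagram.Contraction.ofEquiv, blockWeight, crossWeight]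
  have h1 : ∀ (r : Multiset (Necklace (DEdge V))) (a b : SymL k V),
      moyalMul k (moyalMul k a b) (coll k r) = moyalMul k a (moyalMul k b (coll k r)) :=
    fun r a b => LinearMap.congr_fun₂ (bilinearMap_ext_coll (k := k)
      (f := (moyalMul k).compr₂ ((moyalMul k).flip (coll k r)))
      (g := (moyalMul k).compl₂ ((moyalMul k).flip (coll k r))) fun s t => h s t r) a b
  exact LinearMap.congr_fun (linearMap_ext_coll (k := k) (f := moyalMul k (moyalMul k a b))
    (g := moyalMul k a ∘ₗ moyalMul k b) fun r => h1 r a b) c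

theorem one_moyalMul (a : SymL k V) : moyalMul k 1 a = a := by
  have : moyalMul k (1 : SymL k V) = LinearMap.id := linearMap_ext_coll fun s => by
    rw [one_eq_cutColl, coll_eq_cutColl, moyalMul_cutColl]
    refine ((Diagram.Contraction.ofEquiv (D₀ := diagram s) (Equiv.emptySum Empty _).symm
      (fun _ => rfl) fun _ => rfl).cutColl_eq _).trans (congrArg (Diagram.cutColl _) ?_)
    funext x y
    exact add_zero _
  exact LinearMap.congr_fun this a

theorem moyalMul_one (a : SymL k V) : moyalMul k a 1 = a := by
  have : (moyalMul k).flip (1 : SymL k V) = LinearMap.id := linearMap_ext_coll fun s => by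
    rw [LinearMap.flip_apply, one_eq_cutColl, coll_eq_cutColl, moyalMul_cutColl]
    refine ((Diagram.Contraction.ofEquiv (D₀ := diagram s) (Equiv.sumEmpty _ Empty).symm
      (fun _ => rfl) fun _ => rfl).cutColl_eq _).trans (congrArg (Diagram.cutColl _) ?_)
    funext x y
    exact add_zero _
  exact LinearMap.congr_fun this a

theorem moyalCounit_one : moyalCounit k (1 : SymL k V) = 1 := by
  classical
  rw [← coll_zero, moyalCounit_coll, if_pos rfl]

theorem moyalCounit_mul (a b : SymL k V) :
    moyalCounit k (moyalMul k a b) = moyalCounit k a * moyalCounit k b := by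
  classical
  have h : ∀ s t : Multiset (Necklace (DEdge V)), moyalCounit k (moyalMul k (coll k s) (coll k t)) =
      moyalCounit k (coll k s) * moyalCounit k (coll k t) := by
    intro s t
    rw [coll_eq_cutColl s, coll_eq_cutColl t, moyalMul_cutColl, moyalCounit_cutColl,
      moyalCounit_cutColl, moyalCounit_cutColl, isEmpty_sum]
    split_ifs <;> simp_all
  exact LinearMap.congr_fun₂ (bilinearMap_ext_coll (k := k)
    (f := (moyalMul k).compr₂ (moyalCounit k))
    (g := (LinearMap.mul k[X] k[X]).compl₁₂ (moyalCounit k) (moyalCounit k)) h) a b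

theorem moyalComul_one : moyalComul k (1 : SymL k V) = 1 ⊗ₜ 1 := by
  classical
  rw [one_eq_cutColl, moyalComul_cutColl, Fintype.sum_unique, zero_add]
  have : Subsingleton (HDiagram.empty (V := V)).Cutting :=
    ⟨fun φ ψ => Subtype.ext (Subsingleton.elim _ _)⟩
  unfold Diagram.cutSum
  rw [Fintype.sum_subsingleton _ (⟨1, Diagram.isCutting_one _⟩ : (HDiagram.empty (V := V)).Cutting),
    Diagram.weight_one, one_smul]
  refine (tensorTerm_component (⟨_, fun x => x.elim⟩ :
    Components ((HDiagram.empty (V := V)).cutAt ⟨1, Diagram.isCutting_one _⟩))).trans ?_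
  rw [(Diagram.collection_eq_zero_iff _).2 (Subtype.isEmpty_of_false fun x => x.elim),
    (Diagram.collection_eq_zero_iff _).2 (Subtype.isEmpty_of_false fun x => x.elim), coll_zero,
    Diagram.cutColl_zero, (Diagram.collection_eq_zero_iff _).2 inferInstance, coll_zero]

omit [Fintype κ] in
/-- In a cut juxtaposition, the two factors cannot be separated by pairs in one direction only. -/
theorem apply_eq_of_cutAt_sum {D : Diagram (DEdge V) ι} {D' : Diagram (DEdge V) κ}
    (θ : (D.sum D').Cutting) {c : ι ⊕ κ → Fin 2} (hc : ∀ x, c (((D.sum D').cutAt θ).next x) = c x)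
    (h : ∀ x y, θ.1 (.inl x) = .inr y → c (.inl x) ≤ c (.inr y)) (x : ι) (y : κ)
    (hxy : θ.1 (.inl x) = .inr y) : c (.inl x) = c (.inr y) := by
  have hn : ∀ x, c ((D.sum D').next x) = c (θ.1 x) := by
    intro x
    have h : c ((D.sum D').next (θ.1 (θ.1 x))) = c (θ.1 x) := hc (θ.1 x)
    rwa [θ.2.invol] at h
  -- The involution `ρ` keeps the pairs of `θ` inside the first diagram and forgets those that
  -- cross.
  let ρ : ι → ι := fun x => Sum.elim id (fun _ => x) (θ.1 (.inl x))
  have hρ₁ : ∀ x x', θ.1 (.inl x) = .inl x' → ρ x = x' := fun x x' h => by simp [ρ, h]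
  have hρ₂ : ∀ x y, θ.1 (.inl x) = .inr y → ρ x = x := fun x x' h => by simp [ρ, h]
  have hρ : Function.Involutive ρ := by
    intro x
    cases hx : θ.1 (.inl x) with
    | inl x' => exact (congrArg ρ (hρ₁ _ _ hx)).trans (hρ₁ x' x (by rw [← hx, θ.2.invol]))
    | inr y => rw [hρ₂ _ _ hx, hρ₂ _ _ hx]
  have hle : ∀ x, (c (.inl (ρ x)) : ℕ) ≤ (c (θ.1 (.inl x)) : ℕ) := by
    intro x
    cases hx : θ.1 (.inl x) with
    | inl x' => rw [hρ₁ _ _ hx]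
    | inr y => rw [hρ₂ _ _ hx]; exact h x y hx
  -- Conservation: both sums equal the sum of all colours in the first diagram, the left because `ρ`
  -- permutes its places, the right because the colour of `θ x` is that of the place after `x`.
  -- Termwise inequality then forces termwise equality.
  have hs : ∑ x, (c (.inl (ρ x)) : ℕ) = ∑ x, (c (θ.1 (.inl x)) : ℕ) := by
    refine (Equiv.sum_comp hρ.toPerm fun x => (c (.inl x) : ℕ)).trans ?_
    rw [← Equiv.sum_comp D.next fun x => (c (.inl x) : ℕ)]
    exact Finset.sum_congr rfl fun x _ => congrArg Fin.val (hn (.inl x))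
  have := (Finset.sum_eq_sum_iff_of_le fun x _ => hle x).1 hs x (Finset.mem_univ x)
  rw [hρ₂ x y hxy, hxy] at this
  exact Fin.ext this

/-- The two weights agree except on crossing pairs coloured 0 in the first diagram and 1 in the
second, where the left weight is h and the right one 0. Pairs coloured 1 and 0 have weight zero on
both sides; if there are none, conservation of colours excludes the exceptional pairs as well. -/
theorem weight_crossWeight_add_compWeight {D : Diagram (DEdge V) ι} {D' : Diagram (DEdge V) κ}
    (θ : (D.sum D').Cutting) {c : ι ⊕ κ → Fin 2} (hc : ∀ x, c (((D.sum D').cutAt θ).next x) = c x) :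
    (D.sum D').weight (crossWeight + compWeight c : _ → _ → k[X]) θ.1 =
      (D.sum D').weight (blockWeight (compWeight (c ∘ .inl)) (compWeight (c ∘ .inr)) +
        sameWeight c crossWeight) θ.1 := by
  by_cases hs : ∀ x y, θ.1 (.inl x) = .inr y → c (.inl x) = c (.inr y)
  · refine Diagram.weight_congr fun x _ => ?_
    rcases x with x | x
    · cases hx : θ.1 (.inl x) with
      | inl y => simp [crossWeight, blockWeight, sameWeight, compWeight]
      | inr y => simp [crossWeight, blockWeight, sameWeight, compWeight, hs x y hx]
    · cases hx : θ.1 (.inr x) with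
      | inl y =>
        have := hs y x (by rw [← hx, θ.2.invol])
        simp [crossWeight, blockWeight, sameWeight, compWeight, this]
      | inr y => simp [crossWeight, blockWeight, sameWeight, compWeight]
  · have hl : (D.sum D').weight (crossWeight + compWeight c : _ → _ → k[X]) θ.1 = 0 := by
      by_contra hne
      refine hs fun x y hxy => apply_eq_of_cutAt_sum θ hc (fun x y hxy => ?_) x y hxy
      by_contra hlt
      have h1 : c (.inl x) = 1 := by omega
      have h0 : c (.inr y) = 0 := by omega
      have hx : θ.1 (.inl x) ≠ .inl x := by rw [hxy]; exact Sum.inr_ne_inl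
      refine hne ?_
      rcases θ.2.mem_cutQ_or hx with hq | hq <;> refine Diagram.weight_eq_zero hq ?_
      · rw [hxy]
        simp [crossWeight, compWeight, h1, h0]
      · rw [θ.2.invol, hxy]
        simp [crossWeight, compWeight, h1, h0]
    rw [hl]
    push Not at hs
    obtain ⟨x, y, hxy, hne⟩ := hs
    have hx : θ.1 (.inl x) ≠ .inl x := by rw [hxy]; exact Sum.inr_ne_inl
    symm
    rcases θ.2.mem_cutQ_or hx with hq | hq <;> refine Diagram.weight_eq_zero hq ?_
    · rw [hxy]
      simp [blockWeight, sameWeight, hne]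
    · rw [θ.2.invol, hxy]
      simp [blockWeight, sameWeight, hne.symm]

/-- The product in the tensor square multiplies parts of the same colour, so exactly the crossing
pairs of equal colours may be cut. -/
theorem map₂_tensorTerm {E : Diagram (DEdge V) ι} {E' : Diagram (DEdge V) κ} (c : ι ⊕ κ → Fin 2) :
    TensorProduct.map₂ (moyalMul k) (moyalMul k) (tensorTerm (k := k) E (c ∘ .inl))
      (tensorTerm (k := k) E' (c ∘ .inr)) =
    (E.sum E').cutSum (sameWeight c (crossWeight (k := k))) fun θ =>
      tensorTerm (k := k) ((E.sum E').cutAt θ) c := by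
  by_cases h : ∀ x, c ((E.sum E').next x) = c x
  · let c₁ : Components E := ⟨c ∘ .inl, fun x => h (.inl x)⟩
    let c₂ : Components E' := ⟨c ∘ .inr, fun x => h (.inr x)⟩
    let c₀ : Components (E.sum E') := ⟨c, h⟩
    have h₁ := tensorTerm_component (k := k) c₁
    have h₂ := tensorTerm_component (k := k) c₂
    have h₀ := cutColl_tmul_cutColl (k := k) c₀ crossWeight
    refine Eq.trans ?_ h₀
    have key : ∀ i, ((E.sum E').part c₀ i).cutColl (fun x y => crossWeight (k := k) x.1 y.1) =
        ((E.part c₁ i).sum (E'.part c₂ i)).cutColl crossWeight := by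
      intro i
      rw [(Diagram.contractionSumPart c₀ c₁ c₂ (fun _ => rfl) (fun _ => rfl) i).cutColl_eq]
      refine congrArg (Diagram.cutColl _) ?_
      funext x y
      rcases x with x | x <;> rcases y with y | y <;> rfl
    rw [h₁, h₂, TensorProduct.map₂_apply_tmul, TensorProduct.map_tmul, moyalMul_coll, moyalMul_coll,
      key, key]
  · rw [cutSum_sameWeight_eq_zero h]
    by_cases h1 : ∀ x, (c ∘ .inl) (E.next x) = (c ∘ .inl) x
    · have h2 : ¬ ∀ x, (c ∘ .inr) (E'.next x) = (c ∘ .inr) x := by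
        intro h2
        refine h ?_
        rintro (x | x)
        · exact h1 x
        · exact h2 x
      rw [tensorTerm_of_not h2, map_zero]
    · rw [tensorTerm_of_not h1, map_zero, LinearMap.zero_apply]

theorem moyalComul_mul_coll (D : Diagram (DEdge V) ι) (D' : Diagram (DEdge V) κ) :
    moyalComul k (moyalMul k (coll k D.collection) (coll k D'.collection)) =
      TensorProduct.map₂ (moyalMul k) (moyalMul k) (moyalComul k (coll k D.collection))
        (moyalComul k (coll k D'.collection)) := by
  classical
  rw [moyalMul_coll, moyalComul_cutColl, moyalComul_coll, moyalComul_coll,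
    comulSum_eq_sum, comulSum_eq_sum, map_sum]
  simp only [LinearMap.sum_apply, map_sum]
  rw [Finset.sum_comm, ← Fintype.sum_prod_type']
  rw [← Equiv.sum_comp (Equiv.sumArrowEquivProdArrow ι κ (Fin 2))]
  refine Finset.sum_congr (Finset.ext fun c => by simp) fun c _ => ?_
  have h1 : (D.sum D').cutSum (crossWeight + compWeight (k := k) c)
      (fun θ => tensorTerm (k := k) ((D.sum D').cutAt θ) c) =
      (D.sum D').cutSum (blockWeight (compWeight (k := k) (c ∘ .inl)) (compWeight (c ∘ .inr)) +
        sameWeight c crossWeight) fun θ => tensorTerm (k := k) ((D.sum D').cutAt θ) c := by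
    refine Finset.sum_congr rfl fun θ _ => ?_
    by_cases hc : ∀ x, c (((D.sum D').cutAt θ).next x) = c x
    · rw [weight_crossWeight_add_compWeight θ hc]
    · beta_reduce
      rw [tensorTerm_of_not hc, smul_zero, smul_zero]
  rw [h1, ← Diagram.cutSum_cutSum, Diagram.cutSum_sum _ (fun _ _ => rfl) fun _ _ => rfl]
  unfold Diagram.cutSum
  rw [LinearMap.map_sum₂]
  refine Finset.sum_congr rfl fun φ _ => ?_
  rw [LinearMap.map_smul₂, map_sum]
  refine congrArg₂ _ rfl (Finset.sum_congr rfl fun ψ _ => ?_)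
  rw [map_smul]
  refine congrArg₂ _ rfl ?_
  refine Eq.trans ?_ (map₂_tensorTerm c).symm
  rw [← Diagram.cutAt_sum]
  refine Finset.sum_congr rfl fun θ _ => ?_
  beta_reduce
  rw [Diagram.cutAt_comp]

theorem moyalComul_mul (a b : SymL k V) : moyalComul k (moyalMul k a b) =
    TensorProduct.map₂ (moyalMul k) (moyalMul k) (moyalComul k a) (moyalComul k b) := by
  let T : SymL k V ⊗[k[X]] SymL k V →ₗ[k[X]] SymL k V ⊗[k[X]] SymL k V →ₗ[k[X]]
    SymL k V ⊗[k[X]] SymL k V := TensorProduct.map₂ (moyalMul k) (moyalMul k)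
  have h : (moyalMul k).compr₂ (moyalComul k) = T.compl₁₂ (moyalComul k) (moyalComul k) := by
    refine bilinearMap_ext_coll (k := k) (M := SymL k V ⊗[k[X]] SymL k V) fun s t => ?_
    have h := moyalComul_mul_coll (k := k) (diagram s) (diagram t)
    rwa [collection_diagram, collection_diagram] at h
  exact LinearMap.congr_fun₂ h a b

end BialgebraAxioms

/-! ### The counit axioms -/

section Counit

variable {k : Type w} [Field k] {V : Type u} [Quiver.{v} V] {ι : Type} [Fintype ι]

theorem collection_part_const {E : Diagram (DEdge V) ι} (c : Components E) (i : Fin 2)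
    (h : ∀ x, c.1 x = i) : (E.part c i).collection = E.collection :=
  (Diagram.Contraction.ofEquiv (Equiv.subtypeUnivEquiv h).symm (fun _ => rfl)
    fun _ => rfl : Diagram.Contraction E (E.part c i)).collection_eq

theorem rTensor_counit_tensorTerm (E : Diagram (DEdge V) ι) (c : ι → Fin 2) [Decidable (c = 1)] :
    (moyalCounit k).rTensor (SymL k V) (tensorTerm E c) =
      if c = 1 then 1 ⊗ₜ coll k E.collection else 0 := by
  classical
  by_cases h : ∀ x, c (E.next x) = c x
  · rw [tensorTerm_component ⟨c, h⟩, LinearMap.rTensor_tmul, moyalCounit_coll]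
    simp only [Diagram.collection_eq_zero_iff]
    by_cases h1 : c = 1
    · have : IsEmpty {x // c x = 0} := ⟨fun x => absurd (x.2.symm.trans (congrFun h1 x.1)) fun h => by simp at h⟩
      rw [if_pos this, if_pos h1, collection_part_const ⟨c, h⟩ 1 (congrFun h1)]
    · rw [if_neg h1, if_neg, TensorProduct.zero_tmul]
      refine fun h' => h1 (funext fun x => ?_)
      have : ¬ c x = 0 := fun hx => h'.false ⟨x, hx⟩
      change c x = 1
      omega
  · rw [tensorTerm_of_not h, map_zero, if_neg]
    rintro rfl
    exact h fun _ => rfl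

theorem lTensor_counit_tensorTerm (E : Diagram (DEdge V) ι) (c : ι → Fin 2) [Decidable (c = 0)] :
    (moyalCounit k).lTensor (SymL k V) (tensorTerm E c) =
      if c = 0 then coll k E.collection ⊗ₜ 1 else 0 := by
  classical
  by_cases h : ∀ x, c (E.next x) = c x
  · rw [tensorTerm_component ⟨c, h⟩, LinearMap.lTensor_tmul, moyalCounit_coll]
    simp only [Diagram.collection_eq_zero_iff]
    by_cases h1 : c = 0
    · have : IsEmpty {x // c x = 1} := ⟨fun x => absurd (x.2.symm.trans (congrFun h1 x.1)) fun h => by simp at h⟩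
      rw [if_pos this, if_pos h1, collection_part_const ⟨c, h⟩ 0 (congrFun h1)]
    · rw [if_neg h1, if_neg, TensorProduct.tmul_zero]
      refine fun h' => h1 (funext fun x => ?_)
      have : ¬ c x = 1 := fun hx => h'.false ⟨x, hx⟩
      change c x = 0
      omega
  · rw [tensorTerm_of_not h, map_zero, if_neg]
    rintro rfl
    exact h fun _ => rfl

omit [Fintype ι] in
theorem compWeight_const (i : Fin 2) : compWeight (k := k) (fun _ : ι => i) = 0 := by
  funext x y
  simp [compWeight]

/-- The counit on the first factor leaves only the colouring that puts everything into the second. A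
constant colouring has coproduct weight zero, so only the empty cutting remains. -/
theorem rTensor_counit_comulSum (D : Diagram (DEdge V) ι) :
    (moyalCounit k).rTensor (SymL k V) (comulSum D) = (1 : k[X]) ⊗ₜ[k[X]] coll k D.collection := by
  classical
  rw [comulSum_eq_sum, map_sum]
  unfold Diagram.cutSum
  simp only [map_sum, map_smul, rTensor_counit_tensorTerm]
  rw [Finset.sum_eq_single (1 : ι → Fin 2)]
  · have h := D.cutSum_zero (R := k[X])
      fun φ => (1 : k[X]) ⊗ₜ[k[X]] coll k (D.cutAt φ).collection
    have e : D.cutAt ⟨1, D.isCutting_one⟩ = D := Diagram.cut_one _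
    rw [e] at h
    refine Eq.trans ?_ h
    have hw : compWeight (k := k) (1 : ι → Fin 2) = 0 := compWeight_const 1
    rw [hw]
    simp only [if_true]
    rfl
  · intro c _ hc
    simp only [if_neg hc, smul_zero, Finset.sum_const_zero]
  · exact fun h => absurd (Finset.mem_univ _) h

theorem rTensor_counit_comp_moyalComul : (moyalCounit k).rTensor (SymL k V) ∘ₗ moyalComul k =
    TensorProduct.mk k[X] k[X] (SymL k V) 1 := by
  refine linearMap_ext_coll (k := k) (M := k[X] ⊗[k[X]] SymL k V) fun s => ?_
  rw [LinearMap.comp_apply, ← collection_diagram s, moyalComul_coll, rTensor_counit_comulSum]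
  rfl

theorem lTensor_counit_comulSum (D : Diagram (DEdge V) ι) :
    (moyalCounit k).lTensor (SymL k V) (comulSum D) = coll k D.collection ⊗ₜ[k[X]] (1 : k[X]) := by
  classical
  rw [comulSum_eq_sum, map_sum]
  unfold Diagram.cutSum
  simp only [map_sum, map_smul, lTensor_counit_tensorTerm]
  rw [Finset.sum_eq_single (0 : ι → Fin 2)]
  · have h := D.cutSum_zero (R := k[X])
      fun φ => coll k (D.cutAt φ).collection ⊗ₜ[k[X]] (1 : k[X])
    have e : D.cutAt ⟨1, D.isCutting_one⟩ = D := Diagram.cut_one _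
    rw [e] at h
    refine Eq.trans ?_ h
    have hw : compWeight (k := k) (0 : ι → Fin 2) = 0 := compWeight_const 0
    rw [hw]
    simp only [if_true]
    rfl
  · intro c _ hc
    simp only [if_neg hc, smul_zero, Finset.sum_const_zero]
  · exact fun h => absurd (Finset.mem_univ _) h

theorem lTensor_counit_comp_moyalComul : (moyalCounit k).lTensor (SymL k V) ∘ₗ moyalComul k =
    (TensorProduct.mk k[X] (SymL k V) k[X]).flip 1 := by
  refine linearMap_ext_coll (k := k) (M := SymL k V ⊗[k[X]] k[X]) fun s => ?_
  rw [LinearMap.comp_apply, ← collection_diagram s, moyalComul_coll, lTensor_counit_comulSum]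
  rfl

end Counit

/-! ### Coassociativity via colourings by three factors -/

section Coassociativity

variable {k : Type w} [Field k] {V : Type u} [Quiver.{v} V] {ι : Type}

namespace Diagram

/-- The extension by the identity of a cutting of the part of a diagram over a stable set. -/
noncomputable def Cutting.extend {D : Diagram (DEdge V) ι} {p : ι → Prop} [DecidablePred p]
    {hp : ∀ x, p (D.next x) ↔ p x} (φ : (D.restrict p hp).Cutting) : D.Cutting where
  val := Equiv.Perm.ofSubtype φ.1
  property := by
    constructor
    · intro x
      by_cases hx : p x
      · rw [Equiv.Perm.ofSubtype_apply_of_mem _ hx, Equiv.Perm.ofSubtype_apply_of_mem _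
          (φ.1 ⟨x, hx⟩).2]
        exact congrArg Subtype.val (φ.2.invol ⟨x, hx⟩)
      · rw [Equiv.Perm.ofSubtype_apply_of_not_mem _ hx, Equiv.Perm.ofSubtype_apply_of_not_mem _ hx]
    · intro x h
      by_cases hx : p x
      · rw [Equiv.Perm.ofSubtype_apply_of_mem _ hx] at h ⊢
        exact φ.2.rev ⟨x, hx⟩ fun h' => h (congrArg Subtype.val h')
      · exact absurd (Equiv.Perm.ofSubtype_apply_of_not_mem _ hx) h

section

variable {D : Diagram (DEdge V) ι} {p : ι → Prop} [DecidablePred p]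
  {hp : ∀ x, p (D.next x) ↔ p x}

theorem Cutting.extend_coe (φ : (D.restrict p hp).Cutting) (x : {x // p x}) :
    φ.extend.1 x.1 = (φ.1 x).1 := Equiv.Perm.ofSubtype_apply_coe _ _

theorem Cutting.extend_of_not (φ : (D.restrict p hp).Cutting) {x : ι} (hx : ¬ p x) :
    φ.extend.1 x = x := Equiv.Perm.ofSubtype_apply_of_not_mem _ hx

theorem Cutting.extend_coe_eq_iff (φ : (D.restrict p hp).Cutting) (x : {x // p x}) :
    φ.extend.1 x.1 = x.1 ↔ φ.1 x = x := by
  rw [φ.extend_coe, Subtype.ext_iff]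

theorem Cutting.exists_extend_eq (θ : D.Cutting) (h : ∀ x, θ.1 x ≠ x → p x) :
    ∃ φ : (D.restrict p hp).Cutting, φ.extend = θ := by
  have hs : ∀ x, p (θ.1 x) ↔ p x := by
    intro x
    by_cases hx : θ.1 x = x
    · rw [hx]
    · exact iff_of_true (h _ (θ.2.apply_ne hx)) (h _ hx)
  refine ⟨⟨θ.1.subtypePerm hs, fun x => Subtype.ext (θ.2.invol x.1), fun x hx =>
    θ.2.rev x.1 fun h' => hx (Subtype.ext h')⟩, Subtype.ext ?_⟩
  exact Equiv.Perm.ofSubtype_subtypePerm hs h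

variable [Fintype ι] {R : Type*} [CommRing R]

theorem weight_extend (φ : (D.restrict p hp).Cutting) (A : ι → ι → R) :
    D.weight A φ.extend.1 = (D.restrict p hp).weight (fun x y => A x.1 y.1) φ.1 := by
  symm
  refine Finset.prod_bij (fun x _ => x.1) ?_ (fun _ _ _ _ h => Subtype.ext h) ?_ ?_
  · intro x hx
    rw [mem_cutQ] at hx ⊢
    rwa [Ne, φ.extend_coe_eq_iff]
  · intro x hx
    rw [mem_cutQ] at hx
    have hpx : p x := by
      by_contra h
      exact hx.1 (φ.extend_of_not h)
    refine ⟨⟨x, hpx⟩, ?_, rfl⟩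
    rw [mem_cutQ]
    rwa [Ne, ← φ.extend_coe_eq_iff]
  · intro x _
    rw [φ.extend_coe]

/-- A sum over all cuttings whose weights vanish on the pairs outside a stable set of places. -/
theorem cutSum_restrict {M : Type*} [AddCommGroup M] [Module R M] (A : ι → ι → R)
    (h : ∀ x y, ¬ p x → A x y = 0) (h' : ∀ x y, ¬ p y → A x y = 0) (T : D.Cutting → M) :
    D.cutSum A T = (D.restrict p hp).cutSum (fun x y => A x.1 y.1) fun φ => T φ.extend := by
  symm
  refine Fintype.sum_of_injective (fun φ : (D.restrict p hp).Cutting => φ.extend) ?_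
    (fun φ => (D.restrict p hp).weight (fun x y => A x.1 y.1) φ.1 • T φ.extend)
    (fun φ => D.weight A φ.1 • T φ) ?_ fun φ => by rw [weight_extend]
  · intro φ ψ hφ
    exact Subtype.ext (Equiv.Perm.ofSubtype_injective (congrArg Subtype.val hφ))
  · intro θ hθ
    have : ∃ x, θ.1 x ≠ x ∧ ¬ p x := by
      by_contra! hc
      exact hθ (θ.exists_extend_eq hc)
    obtain ⟨x, hx, hpx⟩ := this
    rw [show D.weight A θ.1 = 0 from ?_, zero_smul]
    rcases θ.2.mem_cutQ_or hx with hq | hq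
    · exact weight_eq_zero hq (h _ _ hpx)
    · exact weight_eq_zero hq (by rw [θ.2.invol]; exact h' _ _ hpx)

omit [Fintype ι] in
theorem collection_restrict_cutAt_extend (φ : (D.restrict p hp).Cutting) {q : ι → Prop}
    {r : {x // p x} → Prop} (hq : ∀ x, q ((D.cutAt φ.extend).next x) ↔ q x)
    (hr : ∀ x, r (((D.restrict p hp).cutAt φ).next x) ↔ r x) (hqp : ∀ x, q x → p x)
    (hqr : ∀ x, r x ↔ q x.1) [Finite {x // q x}] [Finite {x // r x}] :
    ((D.cutAt φ.extend).restrict q hq).collection =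
      (((D.restrict p hp).cutAt φ).restrict r hr).collection := by
  have C : Contraction (((D.restrict p hp).cutAt φ).restrict r hr)
      ((D.cutAt φ.extend).restrict q hq) :=
    .ofEquiv
      { toFun := fun x => ⟨x.1.1, (hqr _).1 x.2⟩
        invFun := fun x => ⟨⟨x.1, hqp _ x.2⟩, (hqr _).2 x.2⟩
        left_inv := fun _ => rfl
        right_inv := fun _ => rfl }
      (fun x => by
        change D.cutLabel _ _ = (D.restrict p hp).cutLabel _ _
        by_cases hx : φ.1 x.1 = x.1
        · exact (cutLabel_of_eq _ ((φ.extend_coe_eq_iff _).2 hx)).trans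
            (cutLabel_of_eq (D.restrict p hp) hx).symm
        · exact (cutLabel_of_ne _ (mt (φ.extend_coe_eq_iff _).1 hx)).trans
            (cutLabel_of_ne (D.restrict p hp) hx).symm)
      fun x => Subtype.ext (congrArg D.next (φ.extend_coe x.1))
  exact C.collection_eq

omit [Fintype ι] in
theorem collection_restrict_cutAt_extend_of_disjoint (φ : (D.restrict p hp).Cutting)
    {q r : ι → Prop} (hq : ∀ x, q ((D.cutAt φ.extend).next x) ↔ q x)
    (hr : ∀ x, r (D.next x) ↔ r x) (hqp : ∀ x, q x → ¬ p x)
    (hqr : ∀ x, r x ↔ q x) [Finite {x // q x}] [Finite {x // r x}] :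
    ((D.cutAt φ.extend).restrict q hq).collection = (D.restrict r hr).collection := by
  have C : Contraction (D.restrict r hr) ((D.cutAt φ.extend).restrict q hq) :=
    .ofEquiv (Equiv.subtypeEquivRight hqr)
      (fun x => cutLabel_of_eq _ (φ.extend_of_not (hqp _ ((hqr _).1 x.2))))
      fun x => Subtype.ext (congrArg D.next (φ.extend_of_not (hqp _ ((hqr _).1 x.2))))
  exact C.collection_eq

end

end Diagram

/-- The part of a sum with values in a triple tensor product that belongs to an assignment of
places to the three factors. -/
noncomputable def tripleTerm (E : Diagram (DEdge V) ι) [Finite ι] (d : ι → Fin 3) :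
    SymL k V ⊗[k[X]] (SymL k V ⊗[k[X]] SymL k V) :=
  open scoped Classical in
  if h : ∀ x, d (E.next x) = d x then
    coll k (E.restrict (fun x => d x = 0) fun x => by rw [h]).collection ⊗ₜ[k[X]]
      (coll k (E.restrict (fun x => d x = 1) fun x => by rw [h]).collection ⊗ₜ[k[X]]
        coll k (E.restrict (fun x => d x = 2) fun x => by rw [h]).collection)
  else 0

/-- Refine an assignment to two factors by an assignment of the first part to two factors. -/
def leftColor (c : ι → Fin 2) (e : {x // c x = 0} → Fin 2) (x : ι) : Fin 3 :=
  if h : c x = 0 then (e ⟨x, h⟩).castSucc else 2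

/-- Refine an assignment to two factors by an assignment of the second part to two factors. -/
def rightColor (c : ι → Fin 2) (e : {x // c x = 1} → Fin 2) (x : ι) : Fin 3 :=
  if h : c x = 1 then (e ⟨x, h⟩).succ else 0

theorem leftColor_coe (c : ι → Fin 2) (e : {x // c x = 0} → Fin 2) (x : {x // c x = 0}) :
    leftColor c e x.1 = (e x).castSucc := dif_pos x.2

theorem leftColor_of_not {c : ι → Fin 2} (e : {x // c x = 0} → Fin 2) {x : ι} (h : ¬ c x = 0) :
    leftColor c e x = 2 := dif_neg h

theorem rightColor_coe (c : ι → Fin 2) (e : {x // c x = 1} → Fin 2) (x : {x // c x = 1}) :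
    rightColor c e x.1 = (e x).succ := dif_pos x.2

theorem rightColor_of_not {c : ι → Fin 2} (e : {x // c x = 1} → Fin 2) {x : ι} (h : ¬ c x = 1) :
    rightColor c e x = 0 := dif_neg h

theorem leftColor_eq_two_iff {c : ι → Fin 2} {e : {x // c x = 0} → Fin 2} {x : ι} :
    leftColor c e x = 2 ↔ c x = 1 := by
  by_cases h : c x = 0
  · rw [leftColor_coe c e ⟨x, h⟩, h]
    have : ∀ i : Fin 2, i.castSucc = 2 ↔ (0 : Fin 2) = 1 := by decide
    exact this _
  · rw [leftColor_of_not e h]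
    exact iff_of_true rfl (by omega)

theorem rightColor_eq_zero_iff {c : ι → Fin 2} {e : {x // c x = 1} → Fin 2} {x : ι} :
    rightColor c e x = 0 ↔ c x = 0 := by
  by_cases h : c x = 1
  · rw [rightColor_coe c e ⟨x, h⟩, h]
    have : ∀ i : Fin 2, i.succ = 0 ↔ (1 : Fin 2) = 0 := by decide
    exact this _
  · rw [rightColor_of_not e h]
    exact iff_of_true rfl (by omega)

/-- Merging the colours 0 and 1 recovers the coarse colouring, and the colours within the merged
part recover the refinement. -/
theorem leftColor_bijective :
    Function.Bijective fun p : Σ c : ι → Fin 2, {x // c x = 0} → Fin 2 => leftColor p.1 p.2 := by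
  constructor
  · rintro ⟨c, e⟩ ⟨c', e'⟩ h
    have h : leftColor c e = leftColor c' e' := h
    have hc : c = c' := by
      funext x
      have h1 := leftColor_eq_two_iff (c := c) (e := e) (x := x)
      rw [h, leftColor_eq_two_iff] at h1
      omega
    subst hc
    refine congrArg _ (funext fun x => Fin.castSucc_injective _ ?_)
    rw [← leftColor_coe, ← leftColor_coe, h]
  · intro d
    refine ⟨⟨fun x => if d x = 2 then 1 else 0, fun x => if d x.1 = 0 then 0 else 1⟩,
      funext fun x => ?_⟩
    change leftColor _ _ x = d x
    unfold leftColor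
    have : d x = 0 ∨ d x = 1 ∨ d x = 2 := by omega
    rcases this with h | h | h <;> simp [h]

theorem rightColor_bijective :
    Function.Bijective fun p : Σ c : ι → Fin 2, {x // c x = 1} → Fin 2 => rightColor p.1 p.2 := by
  constructor
  · rintro ⟨c, e⟩ ⟨c', e'⟩ h
    have h : rightColor c e = rightColor c' e' := h
    have hc : c = c' := by
      funext x
      have h1 := rightColor_eq_zero_iff (c := c) (e := e) (x := x)
      rw [h, rightColor_eq_zero_iff] at h1
      omega
    subst hc
    refine congrArg _ (funext fun x => Fin.succ_injective _ ?_)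
    rw [← rightColor_coe, ← rightColor_coe, h]
  · intro d
    refine ⟨⟨fun x => if d x = 0 then 0 else 1, fun x => if d x.1 = 1 then 0 else 1⟩,
      funext fun x => ?_⟩
    change rightColor _ _ x = d x
    unfold rightColor
    have : d x = 0 ∨ d x = 1 ∨ d x = 2 := by omega
    rcases this with h | h | h <;> simp [h]

section

variable [Fintype ι]

omit [Fintype ι] in
theorem component_cutAt_extend {E : Diagram (DEdge V) ι} (c : Components E) {i : Fin 2}
    (φ : (E.part c i).Cutting) (x : ι) : c.1 (φ.extend.1 x) = c.1 x := by
  by_cases hx : c.1 x = i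
  · exact (congrArg c.1 (φ.extend_coe ⟨x, hx⟩)).trans ((φ.1 ⟨x, hx⟩).2.trans hx.symm)
  · rw [φ.extend_of_not hx]

/-- A cutting supported on the first part leaves the second part and its colour untouched, so the
three parts after cutting are the two refined parts and the old second part. -/
theorem tripleTerm_leftColor {E : Diagram (DEdge V) ι} (c : Components E)
    (e : {x // c.1 x = 0} → Fin 2) (φ : (E.part c 0).Cutting) :
    tripleTerm (k := k) (E.cutAt φ.extend) (leftColor c.1 e) =
      TensorProduct.assoc k[X] _ _ _ (tensorTerm ((E.part c 0).cutAt φ) e ⊗ₜ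
        coll k (E.part c 1).collection) := by
  have hext : ∀ x : {x // c.1 x = 0}, (E.cutAt φ.extend).next x.1 =
      (((E.part c 0).cutAt φ).next x).1 := fun x => congrArg E.next (φ.extend_coe x)
  have hiff : (∀ x, leftColor c.1 e ((E.cutAt φ.extend).next x) = leftColor c.1 e x) ↔
      ∀ x, e (((E.part c 0).cutAt φ).next x) = e x := by
    constructor
    · intro h x
      have := h x.1
      rw [hext, leftColor_coe, leftColor_coe] at this
      exact Fin.castSucc_injective _ this
    · intro h x
      by_cases hx : c.1 x = 0
      · rw [hext ⟨x, hx⟩, leftColor_coe, h, leftColor_coe c.1 e ⟨x, hx⟩]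
      · have : ¬ c.1 ((E.cutAt φ.extend).next x) = 0 := by
          refine fun h' => hx ((component_cutAt_extend c φ x).symm.trans ((c.2 _).symm.trans h'))
        rw [leftColor_of_not e hx, leftColor_of_not e this]
  by_cases h : ∀ x, e (((E.part c 0).cutAt φ).next x) = e x
  · rw [tripleTerm, dif_pos (hiff.2 h), tensorTerm_component ⟨e, h⟩, TensorProduct.assoc_tmul]
    have h0 : ∀ x, leftColor c.1 e x ≠ 2 → c.1 x = 0 := by
      intro x hx
      by_contra h'
      exact hx (leftColor_of_not e h')
    refine congrArg₂ _ ?_ (congrArg₂ _ ?_ ?_)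
    · refine congrArg (coll k) (Diagram.collection_restrict_cutAt_extend φ _ _
        (fun x hx => h0 x (by rw [hx]; decide)) fun x => ?_)
      rw [leftColor_coe]
      exact (Fin.castSucc_injective _).eq_iff (b := (0 : Fin 2)).symm
    · refine congrArg (coll k) (Diagram.collection_restrict_cutAt_extend φ _ _
        (fun x hx => h0 x (by rw [hx]; decide)) fun x => ?_)
      rw [leftColor_coe]
      exact (Fin.castSucc_injective _).eq_iff (b := (1 : Fin 2)).symm
    · refine congrArg (coll k) (Diagram.collection_restrict_cutAt_extend_of_disjoint φ _ _
        (fun x hx h' => ?_) fun x => leftColor_eq_two_iff.symm)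
      rw [leftColor_eq_two_iff, h'] at hx
      exact absurd hx (by decide)
  · rw [tripleTerm, dif_neg (mt hiff.1 h), tensorTerm_of_not h, TensorProduct.zero_tmul, map_zero]

theorem tripleTerm_rightColor {E : Diagram (DEdge V) ι} (c : Components E)
    (e : {x // c.1 x = 1} → Fin 2) (φ : (E.part c 1).Cutting) :
    tripleTerm (k := k) (E.cutAt φ.extend) (rightColor c.1 e) =
      coll k (E.part c 0).collection ⊗ₜ tensorTerm ((E.part c 1).cutAt φ) e := by
  have hext : ∀ x : {x // c.1 x = 1}, (E.cutAt φ.extend).next x.1 =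
      (((E.part c 1).cutAt φ).next x).1 := fun x => congrArg E.next (φ.extend_coe x)
  have hiff : (∀ x, rightColor c.1 e ((E.cutAt φ.extend).next x) = rightColor c.1 e x) ↔
      ∀ x, e (((E.part c 1).cutAt φ).next x) = e x := by
    constructor
    · intro h x
      have := h x.1
      rw [hext, rightColor_coe, rightColor_coe] at this
      exact Fin.succ_injective _ this
    · intro h x
      by_cases hx : c.1 x = 1
      · rw [hext ⟨x, hx⟩, rightColor_coe, h, rightColor_coe c.1 e ⟨x, hx⟩]
      · have : ¬ c.1 ((E.cutAt φ.extend).next x) = 1 := by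
          refine fun h' => hx ((component_cutAt_extend c φ x).symm.trans ((c.2 _).symm.trans h'))
        rw [rightColor_of_not e hx, rightColor_of_not e this]
  by_cases h : ∀ x, e (((E.part c 1).cutAt φ).next x) = e x
  · rw [tripleTerm, dif_pos (hiff.2 h), tensorTerm_component ⟨e, h⟩]
    have h0 : ∀ x, rightColor c.1 e x ≠ 0 → c.1 x = 1 := by
      intro x hx
      by_contra h'
      exact hx (rightColor_of_not e h')
    refine congrArg₂ _ ?_ (congrArg₂ _ ?_ ?_)
    · refine congrArg (coll k) (Diagram.collection_restrict_cutAt_extend_of_disjoint φ _ _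
        (fun x hx h' => ?_) fun x => rightColor_eq_zero_iff.symm)
      rw [rightColor_eq_zero_iff, h'] at hx
      exact absurd hx (by decide)
    · refine congrArg (coll k) (Diagram.collection_restrict_cutAt_extend φ _ _
        (fun x hx => h0 x (by rw [hx]; decide)) fun x => ?_)
      rw [rightColor_coe]
      exact (Fin.succ_injective _).eq_iff (b := (0 : Fin 2)).symm
    · refine congrArg (coll k) (Diagram.collection_restrict_cutAt_extend φ _ _
        (fun x hx => h0 x (by rw [hx]; decide)) fun x => ?_)
      rw [rightColor_coe]
      exact (Fin.succ_injective _).eq_iff (b := (1 : Fin 2)).symm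
  · rw [tripleTerm, dif_neg (mt hiff.1 h), tensorTerm_of_not h, TensorProduct.tmul_zero]

/-- The weights of a second coproduct that is applied to the part with `c x = i`. -/
noncomputable def partWeight (c : ι → Fin 2) (i : Fin 2) (d : ι → Fin 3) (x y : ι) : k[X] :=
  if c x = i ∧ c y = i then halfH k * (((d y : ℕ) : k[X]) - ((d x : ℕ) : k[X])) else 0

/-- A nonzero weight forces all cut pairs to lie within one coarse part. Since `f` recovers the
coarse colour from the fine one, constancy of `d` after cutting would imply constancy of `c` before.
-/
theorem cutSum_partWeight_eq_zero {E : Diagram (DEdge V) ι} {c : ι → Fin 2}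
    (hc : ¬ ∀ x, c (E.next x) = c x) {i : Fin 2} {d : ι → Fin 3} {f : Fin 3 → Fin 2}
    (hf : ∀ x, f (d x) = c x) :
    E.cutSum (partWeight (k := k) c i d) (fun φ => tripleTerm (k := k) (E.cutAt φ) d) = 0 := by
  refine Finset.sum_eq_zero fun φ _ => ?_
  by_cases h : E.weight (partWeight (k := k) c i d) φ.1 = 0
  · rw [h, zero_smul]
  · beta_reduce
    rw [tripleTerm, dif_neg, smul_zero]
    refine fun h' => hc fun x => ?_
    have h1 := congrArg f (h' (φ.1 x))
    have h1 : f (d (E.next (φ.1 (φ.1 x)))) = f (d (φ.1 x)) := h1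
    rw [φ.2.invol, hf, hf] at h1
    rw [h1]
    by_cases hx : φ.1 x = x
    · rw [hx]
    · by_contra hne
      rcases φ.2.mem_cutQ_or hx with hq | hq
      · exact h (Diagram.weight_eq_zero hq (if_neg fun h => hne (h.2.trans h.1.symm)))
      · refine h (Diagram.weight_eq_zero hq (if_neg ?_))
        rw [φ.2.invol]
        exact fun h => hne (h.1.trans h.2.symm)

theorem Diagram.cutSum_sum_right {R M κ : Type*} [CommRing R] [AddCommGroup M] [Module R M]
    {E : Diagram (DEdge V) ι} (A : ι → ι → R) (s : Finset κ) (T : κ → E.Cutting → M) :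
    E.cutSum A (fun φ => ∑ e ∈ s, T e φ) = ∑ e ∈ s, E.cutSum A (T e) := by
  unfold cutSum
  simp only [Finset.smul_sum]
  exact Finset.sum_comm

open scoped Classical in
theorem assoc_rTensor_moyalComul_tensorTerm (E : Diagram (DEdge V) ι) (c : ι → Fin 2) :
    TensorProduct.assoc k[X] _ _ _ ((moyalComul k).rTensor (SymL k V) (tensorTerm E c)) =
      ∑ e : {x // c x = 0} → Fin 2, E.cutSum (partWeight (k := k) c 0 (leftColor c e)) fun φ =>
        tripleTerm (k := k) (E.cutAt φ) (leftColor c e) := by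
  by_cases h : ∀ x, c (E.next x) = c x
  · rw [tensorTerm_component ⟨c, h⟩, LinearMap.rTensor_tmul, moyalComul_coll, comulSum_eq_sum,
      TensorProduct.sum_tmul, map_sum]
    refine Finset.sum_congr (Finset.ext fun e => by simp) fun e _ => ?_
    have h1 := Diagram.cutSum_restrict (D := E) (p := fun x => c x = 0)
      (hp := fun x => by rw [h]) (partWeight (k := k) c 0 (leftColor c e))
      (fun x y hx => if_neg fun h => hx h.1) (fun x y hy => if_neg fun h => hy h.2)
      fun φ => tripleTerm (k := k) (E.cutAt φ) (leftColor c e)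
    rw [h1]
    unfold Diagram.cutSum
    rw [TensorProduct.sum_tmul, map_sum]
    refine Finset.sum_congr rfl fun φ _ => ?_
    rw [← TensorProduct.smul_tmul', map_smul]
    refine congrArg₂ _ (Diagram.weight_congr fun x _ => ?_)
      (tripleTerm_leftColor ⟨c, h⟩ e φ).symm
    unfold partWeight compWeight
    rw [if_pos ⟨x.2, (φ.1 x).2⟩, leftColor_coe, leftColor_coe]
    rfl
  · rw [tensorTerm_of_not h, map_zero, LinearEquiv.map_zero, Finset.sum_eq_zero]
    intro e _
    refine cutSum_partWeight_eq_zero h (f := fun i => if i = 2 then 1 else 0) fun x => ?_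
    rw [if_congr leftColor_eq_two_iff rfl rfl]
    split_ifs <;> omega

open scoped Classical in
theorem lTensor_moyalComul_tensorTerm (E : Diagram (DEdge V) ι) (c : ι → Fin 2) :
    (moyalComul k).lTensor (SymL k V) (tensorTerm E c) =
      ∑ e : {x // c x = 1} → Fin 2, E.cutSum (partWeight (k := k) c 1 (rightColor c e)) fun φ =>
        tripleTerm (k := k) (E.cutAt φ) (rightColor c e) := by
  by_cases h : ∀ x, c (E.next x) = c x
  · rw [tensorTerm_component ⟨c, h⟩, LinearMap.lTensor_tmul, moyalComul_coll, comulSum_eq_sum,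
      TensorProduct.tmul_sum]
    refine Finset.sum_congr (Finset.ext fun e => by simp) fun e _ => ?_
    have h1 := Diagram.cutSum_restrict (D := E) (p := fun x => c x = 1)
      (hp := fun x => by rw [h]) (partWeight (k := k) c 1 (rightColor c e))
      (fun x y hx => if_neg fun h => hx h.1) (fun x y hy => if_neg fun h => hy h.2)
      fun φ => tripleTerm (k := k) (E.cutAt φ) (rightColor c e)
    rw [h1]
    unfold Diagram.cutSum
    rw [TensorProduct.tmul_sum]
    refine Finset.sum_congr rfl fun φ _ => ?_
    rw [TensorProduct.tmul_smul]
    refine congrArg₂ _ (Diagram.weight_congr fun x _ => ?_)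
      (tripleTerm_rightColor ⟨c, h⟩ e φ).symm
    unfold partWeight compWeight
    rw [if_pos ⟨x.2, (φ.1 x).2⟩, rightColor_coe, rightColor_coe]
    simp
  · rw [tensorTerm_of_not h, map_zero, Finset.sum_eq_zero]
    intro e _
    refine cutSum_partWeight_eq_zero h (f := fun i => if i = 0 then 0 else 1) fun x => ?_
    rw [if_congr rightColor_eq_zero_iff rfl rfl]
    split_ifs <;> omega

/-- The weights of the iterated coproduct. -/
noncomputable def tripleWeight (d : ι → Fin 3) (x y : ι) : k[X] :=
  if d x < d y then halfH k else if d y < d x then -halfH k else 0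

-- A pair between the coarse parts gets its weight from the first coproduct, a pair within the
-- refined part from the second, never from both. Hence the total is h/2, -h/2 or 0 by the order of
-- the fine colours, not by their difference.
omit [Fintype ι] in
theorem compWeight_add_partWeight_leftColor (c : ι → Fin 2) (e : {x // c x = 0} → Fin 2) :
    compWeight c + partWeight c 0 (leftColor c e) = tripleWeight (k := k) (leftColor c e) := by
  funext x y
  simp only [Pi.add_apply, compWeight, partWeight, tripleWeight, leftColor]
  have h2 : ∀ i : Fin 2, i = 0 ∨ i = 1 := by decide
  rcases h2 (c x) with hx | hx <;> rcases h2 (c y) with hy | hy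
  · rcases h2 (e ⟨x, hx⟩) with ex | ex <;> rcases h2 (e ⟨y, hy⟩) with ey | ey <;>
      simp [hx, hy, ex, ey]
  · rcases h2 (e ⟨x, hx⟩) with ex | ex <;> simp [hx, hy, ex]
  · rcases h2 (e ⟨y, hy⟩) with ey | ey <;> simp [hx, hy, ey]
  · simp [hx, hy]

omit [Fintype ι] in
theorem compWeight_add_partWeight_rightColor (c : ι → Fin 2) (e : {x // c x = 1} → Fin 2) :
    compWeight c + partWeight c 1 (rightColor c e) = tripleWeight (k := k) (rightColor c e) := by
  funext x y
  simp only [Pi.add_apply, compWeight, partWeight, tripleWeight, rightColor]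
  have h2 : ∀ i : Fin 2, i = 0 ∨ i = 1 := by decide
  rcases h2 (c x) with hx | hx <;> rcases h2 (c y) with hy | hy
  · simp [hx, hy]
  · rcases h2 (e ⟨y, hy⟩) with ey | ey <;> simp [hx, hy, ey]
  · rcases h2 (e ⟨x, hx⟩) with ex | ex <;> simp [hx, hy, ex]
  · rcases h2 (e ⟨x, hx⟩) with ex | ex <;> rcases h2 (e ⟨y, hy⟩) with ey | ey <;>
      simp [hx, hy, ex, ey] <;> ring

/-- The common form of both bracketings: whichever part is refined, the iterated coproduct is the
same sum over colourings by three factors. -/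
theorem sum_cutSum_comp {κ : (ι → Fin 2) → Type} [∀ c, Fintype (κ c)] (D : Diagram (DEdge V) ι)
    (d : ∀ c, κ c → ι → Fin 3) (hd : Function.Bijective fun p : Σ c, κ c => d p.1 p.2)
    (B : ∀ c, κ c → ι → ι → k[X])
    (hB : ∀ c e, compWeight c + B c e = tripleWeight (d c e)) [Fintype (ι → Fin 2)]
    [Fintype (ι → Fin 3)] :
    ∑ c : ι → Fin 2, D.cutSum (compWeight (k := k) c) (fun φ => ∑ e,
      (D.cutAt φ).cutSum (B c e) fun ψ => tripleTerm (k := k) ((D.cutAt φ).cutAt ψ) (d c e)) =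
    ∑ d : ι → Fin 3, D.cutSum (tripleWeight (k := k) d) fun φ =>
      tripleTerm (k := k) (D.cutAt φ) d := by
  rw [← hd.sum_comp fun d : ι → Fin 3 => D.cutSum (tripleWeight (k := k) d)
    fun φ => tripleTerm (k := k) (D.cutAt φ) d, Fintype.sum_sigma]
  refine Finset.sum_congr rfl fun c _ => ?_
  rw [Diagram.cutSum_sum_right]
  refine Finset.sum_congr rfl fun e _ => ?_
  rw [← hB, ← Diagram.cutSum_cutSum]
  simp only [Diagram.cutAt_comp]

open scoped Classical in
theorem assoc_rTensor_moyalComul_comulSum (D : Diagram (DEdge V) ι) :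
    (TensorProduct.assoc k[X] _ _ _).toLinearMap
      ((moyalComul k).rTensor (SymL k V) (comulSum D)) =
      ∑ d : ι → Fin 3, D.cutSum (tripleWeight (k := k) d) fun φ =>
        tripleTerm (k := k) (D.cutAt φ) d := by
  rw [← sum_cutSum_comp D leftColor leftColor_bijective
    (fun c e => partWeight c 0 (leftColor c e)) compWeight_add_partWeight_leftColor,
    comulSum_eq_sum, map_sum, map_sum]
  refine Finset.sum_congr rfl fun c _ => ?_
  unfold Diagram.cutSum
  rw [map_sum, map_sum]
  refine Finset.sum_congr rfl fun φ _ => ?_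
  rw [map_smul, map_smul]
  exact congrArg _ (assoc_rTensor_moyalComul_tensorTerm (D.cutAt φ) c)

open scoped Classical in
theorem lTensor_moyalComul_comulSum (D : Diagram (DEdge V) ι) :
    (moyalComul k).lTensor (SymL k V) (comulSum D) =
      ∑ d : ι → Fin 3, D.cutSum (tripleWeight (k := k) d) fun φ =>
        tripleTerm (k := k) (D.cutAt φ) d := by
  rw [← sum_cutSum_comp D rightColor rightColor_bijective
    (fun c e => partWeight c 1 (rightColor c e)) compWeight_add_partWeight_rightColor,
    comulSum_eq_sum, map_sum]
  refine Finset.sum_congr rfl fun c _ => ?_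
  unfold Diagram.cutSum
  rw [map_sum]
  refine Finset.sum_congr rfl fun φ _ => ?_
  rw [map_smul]
  exact congrArg _ (lTensor_moyalComul_tensorTerm (D.cutAt φ) c)

theorem moyalComul_coassoc :
    (TensorProduct.assoc k[X] _ _ _).toLinearMap ∘ₗ (moyalComul k).rTensor (SymL k V) ∘ₗ
      moyalComul k = (moyalComul k).lTensor (SymL k V) ∘ₗ moyalComul k :=
  linearMap_ext_coll (k := k) (M := SymL k V ⊗[k[X]] (SymL k V ⊗[k[X]] SymL k V)) fun s => by
    rw [LinearMap.comp_apply, LinearMap.comp_apply, LinearMap.comp_apply, ← collection_diagram s,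
      moyalComul_coll, assoc_rTensor_moyalComul_comulSum, lTensor_moyalComul_comulSum]

end

end Coassociativity

/-! ### Signs of permutations and alternating two-colourings -/

section Permutations

variable {α : Type*} [Fintype α]

open scoped Classical in
/-- The product of `-1` over the elements that satisfy `p`. -/
noncomputable def parity (p : α → Prop) : ℤˣ := ∏ x, if p x then -1 else 1

theorem parity_eq (p : α → Prop) : parity p = (-1) ^ Nat.card {x // p x} := by
  classical
  rw [parity, Finset.prod_ite, Finset.prod_const_one, mul_one, Finset.prod_const,
    Nat.card_eq_fintype_card, Fintype.card_subtype]

theorem parity_mul_of_xor {p q r : α → Prop} (h : ∀ x, r x ↔ (p x ↔ ¬ q x)) :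
    parity r = parity p * parity q := by
  classical
  rw [parity, parity, parity, ← Finset.prod_mul_distrib]
  refine Finset.prod_congr rfl fun x _ => ?_
  by_cases hp : p x <;> by_cases hq : q x <;> simp [h, hp, hq]

-- A cycle of length n has sign -(-1)^n; this includes n = 1, where `cycleOf` is the identity.
open scoped Classical in
theorem sign_cycleOf (σ : Equiv.Perm α) (x : α) :
    Equiv.Perm.sign (σ.cycleOf x) = -parity (σ.SameCycle x) := by
  rw [parity_eq, Nat.card_eq_fintype_card, Fintype.card_subtype]
  by_cases h : σ x = x
  · rw [(Equiv.Perm.cycleOf_eq_one_iff σ).2 h, Equiv.Perm.sign_one]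
    have : (Finset.univ.filter (σ.SameCycle x)) = {x} := by
      ext y
      simp only [Finset.mem_filter, Finset.mem_univ, true_and, Finset.mem_singleton]
      exact ⟨fun hy => (hy.eq_of_left h).symm, fun hy => hy ▸ Equiv.Perm.SameCycle.refl _ _⟩
    rw [this, Finset.card_singleton, pow_one, neg_neg]
  · rw [(σ.isCycle_cycleOf h).sign]
    congr 3
    ext y
    rw [Equiv.Perm.mem_support_cycleOf_iff' h, Finset.mem_filter]
    exact (and_iff_right (Finset.mem_univ _)).symm

open scoped Classical in
theorem sign_eq_prod_cycleOf (σ : Equiv.Perm α) :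
    Equiv.Perm.sign σ = ∏ o : Quotient (Equiv.Perm.SameCycle.setoid σ),
      Equiv.Perm.sign (σ.cycleOf o.out) := by
  have h1 : Equiv.Perm.sign σ = ∏ c ∈ σ.cycleFactorsFinset, Equiv.Perm.sign c := by
    conv_lhs => rw [← σ.cycleFactorsFinset_noncommProd]
    rw [Finset.map_noncommProd, Finset.noncommProd_eq_prod]
    rfl
  rw [h1]
  symm
  refine Finset.prod_bij_ne_one (fun o _ _ => σ.cycleOf o.out) ?_ ?_ ?_ fun _ _ _ => rfl
  · intro o _ ho
    rw [Equiv.Perm.cycleOf_mem_cycleFactorsFinset_iff, Equiv.Perm.mem_support]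
    intro h
    rw [(Equiv.Perm.cycleOf_eq_one_iff σ).2 h, Equiv.Perm.sign_one] at ho
    exact ho rfl
  · intro o _ ho o' _ ho' h
    have hne : σ o.out ≠ o.out := by
      intro h
      rw [(Equiv.Perm.cycleOf_eq_one_iff σ).2 h, Equiv.Perm.sign_one] at ho
      exact ho rfl
    have h2 : o.out ∈ (σ.cycleOf o'.out).support := by
      have h : σ.cycleOf o.out = σ.cycleOf o'.out := h
      rw [← h, Equiv.Perm.mem_support_cycleOf_iff' hne]
    have h3 := (Equiv.Perm.mem_support_cycleOf_iff.1 h2).1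
    rw [← o.out_eq, ← o'.out_eq]
    exact Quotient.sound h3.symm
  · intro c hc hc1
    obtain ⟨x, hx⟩ := (Equiv.Perm.mem_cycleFactorsFinset_iff.1 hc).1.nonempty_support
    have h2 := Equiv.Perm.cycle_is_cycleOf hx hc
    have h3 : σ.SameCycle (Quotient.mk (Equiv.Perm.SameCycle.setoid σ) x).out x :=
      Quotient.exact (Quotient.out_eq (Quotient.mk (Equiv.Perm.SameCycle.setoid σ) x))
    have h4 : σ.cycleOf (Quotient.mk (Equiv.Perm.SameCycle.setoid σ) x).out = c := by
      rw [h2, h3.cycleOf_eq]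
    exact ⟨_, Finset.mem_univ _, by rwa [h4], h4⟩

/-- Multiply the signs -(-1)^n over all orbits, fixed points included. This expresses (-1)^m, with m
the number of necklaces, through the sign of the successor permutation. -/
theorem neg_one_pow_card_orbits [DecidableEq α] (σ : Equiv.Perm α) :
    (-1 : ℤˣ) ^ Nat.card (Quotient (Equiv.Perm.SameCycle.setoid σ)) =
      Equiv.Perm.sign σ * (-1) ^ Nat.card α := by
  classical
  have h1 := sign_eq_prod_cycleOf σ
  have h2 : ∀ o : Quotient (Equiv.Perm.SameCycle.setoid σ),
      parity (σ.SameCycle o.out) = ∏ x : α, if Quotient.mk _ x = o then -1 else 1 := by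
    intro o
    refine Finset.prod_congr rfl fun x _ => ?_
    have : σ.SameCycle o.out x ↔ Quotient.mk (Equiv.Perm.SameCycle.setoid σ) x = o := by
      rw [Quotient.mk_eq_iff_out]
      exact Equiv.Perm.sameCycle_comm
    by_cases h : σ.SameCycle o.out x
    · rw [if_pos h, if_pos (this.1 h)]
    · rw [if_neg h, if_neg (mt this.2 h)]
  simp only [sign_cycleOf, h2] at h1
  have h3 : (Equiv.Perm.sign σ : ℤˣ) = (-1) ^ Nat.card (Quotient (Equiv.Perm.SameCycle.setoid σ)) *
      (-1) ^ Nat.card α := by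
    refine Eq.trans (Eq.trans (by congr!) h1) ?_
    rw [Finset.prod_neg, Finset.prod_comm]
    simp [Nat.card_eq_fintype_card]
  rw [h3, mul_assoc, Int.units_mul_self, mul_one]

/-- The set `q` contains one element of each pair of `θ`, and `t` is the product of the
transpositions of the pairs inside `K`. -/
theorem sign_of_involutive [DecidableEq α] {θ : Equiv.Perm α} (hθ : ∀ x, θ (θ x) = x)
    {K : α → Prop} (hK : ∀ x, K (θ x) ↔ K x) {q : Finset α}
    (hq : ∀ x, θ x ≠ x → (θ x ∈ q ↔ x ∉ q)) (hq' : ∀ x ∈ q, θ x ≠ x)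
    {t : Equiv.Perm α} (ht : ∀ x, K x → t x = θ x) (ht' : ∀ x, ¬ K x → t x = x)
    [DecidablePred K] :
    Equiv.Perm.sign t = ∏ x ∈ q, if K x then -1 else 1 := by
  have key : ∀ (r : Finset α) (t : Equiv.Perm α), (∀ x ∈ r, θ x ≠ x) → (∀ x ∈ r, θ x ∉ r) →
      (∀ x, x ∈ r ∨ θ x ∈ r → t x = θ x) → (∀ x, ¬ (x ∈ r ∨ θ x ∈ r) → t x = x) →
      Equiv.Perm.sign t = (-1) ^ r.card := by
    intro r
    induction r using Finset.induction_on with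
    | empty =>
      intro t _ _ _ h
      have : t = 1 := Equiv.ext fun x => h x (by simp)
      rw [this, Equiv.Perm.sign_one, Finset.card_empty, pow_zero]
    | insert a r ha ih =>
      intro t h1 h2 h3 h4
      have hta : t a = θ a := h3 a (.inl (Finset.mem_insert_self _ _))
      have hta' : t (θ a) = a := (h3 (θ a) (.inr (by rw [hθ]; exact Finset.mem_insert_self _ _))).trans (hθ a)
      have hne : θ a ≠ a := h1 a (Finset.mem_insert_self _ _)
      have hra : θ a ∉ r := fun h => h2 a (Finset.mem_insert_self _ _) (Finset.mem_insert_of_mem h)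
      have hs : t = Equiv.swap a (θ a) * (Equiv.swap a (θ a) * t) := by
        rw [← mul_assoc, Equiv.swap_mul_self, one_mul]
      rw [hs, Equiv.Perm.sign_mul, Equiv.Perm.sign_swap hne.symm,
        ih (Equiv.swap a (θ a) * t) (fun x hx => h1 x (Finset.mem_insert_of_mem hx))
          (fun x hx h => h2 x (Finset.mem_insert_of_mem hx) (Finset.mem_insert_of_mem h)) ?_ ?_,
        Finset.card_insert_of_notMem ha, pow_succ, mul_comm]
      · intro x hx
        have hxa : x ≠ a := by rintro rfl; exact hx.elim ha hra
        have hxa' : x ≠ θ a := by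
          rintro rfl
          rw [hθ] at hx
          exact hx.elim hra ha
        rw [Equiv.Perm.mul_apply, h3 x (hx.imp Finset.mem_insert_of_mem Finset.mem_insert_of_mem),
          Equiv.swap_apply_of_ne_of_ne]
        · exact fun h => hxa' (by rw [← h, hθ])
        · exact fun h => hxa (θ.injective h)
      · intro x hx
        rw [Equiv.Perm.mul_apply]
        by_cases hxa : x = a
        · rw [hxa, hta, Equiv.swap_apply_right]
        · by_cases hxa' : x = θ a
          · rw [hxa', hta', Equiv.swap_apply_left]
          · rw [h4 x ?_, Equiv.swap_apply_of_ne_of_ne hxa hxa']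
            rw [Finset.mem_insert, Finset.mem_insert]
            rintro ((h | h) | (h | h))
            · exact hxa h
            · exact hx (.inl h)
            · exact hxa' (by rw [← h, hθ])
            · exact hx (.inr h)
  rw [key (q.filter K) t, Finset.prod_ite, Finset.prod_const, Finset.prod_const_one, mul_one]
  · exact fun x hx => hq' x (Finset.mem_filter.1 hx).1
  · intro x hx h
    exact (hq x (hq' x (Finset.mem_filter.1 hx).1)).1 (Finset.mem_filter.1 h).1
      (Finset.mem_filter.1 hx).1
  · intro x hx
    refine ht x ?_
    rcases hx with h | h
    · exact (Finset.mem_filter.1 h).2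
    · exact (hK x).1 (Finset.mem_filter.1 h).2
  · intro x hx
    by_cases hKx : K x
    · rw [ht x hKx]
      by_contra hne
      rw [Finset.mem_filter, Finset.mem_filter, hK, hq x hne] at hx
      tauto
    · exact ht' x hKx

/-- A two-colouring of the elements that is alternating along the pairs of the involution `θ`, on
both sides, and is otherwise constant along `n`. -/
structure Alternating (n θ : Equiv.Perm α) (P : α → Prop) : Prop where
  next_iff : ∀ x, θ x = x → (P (n x) ↔ P x)
  apply_iff : ∀ x, θ x ≠ x → (P (θ x) ↔ ¬ P x)
  next_apply_iff : ∀ x, θ x ≠ x → (P (n (θ x)) ↔ ¬ P (n x))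

open scoped Classical in
/-- One of the two neighbours of `x` in the graph whose edges are the constraints of
`Alternating`. -/
noncomputable def linkFun (n θ : Equiv.Perm α) (P : α → Prop) (x : α) : α :=
  if P x then (if θ x = x then n x else θ x)
  else if θ (n.symm x) = n.symm x then n.symm x else n (θ (n.symm x))

section

variable {n θ : Equiv.Perm α} {P : α → Prop}

omit [Fintype α] in
theorem linkFun_congr {P' : α → Prop} {x : α} (h : P x ↔ P' x) :
    linkFun n θ P x = linkFun n θ P' x := by
  unfold linkFun
  by_cases hp : P x
  · rw [if_pos hp, if_pos (h.1 hp)]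
  · rw [if_neg hp, if_neg fun hp' => hp (h.2 hp')]

omit [Fintype α] in
theorem Alternating.compl (h : Alternating n θ P) : Alternating n θ fun x => ¬ P x where
  next_iff x hx := not_congr (h.next_iff x hx)
  apply_iff x hx := not_congr (h.apply_iff x hx)
  next_apply_iff x hx := not_congr (h.next_apply_iff x hx)

-- Each place is subject to two constraints: one on it as a current place, one on it as a successor.
-- Its colour decides through which of them the walk leaves. Alternation guarantees that the next
-- place is left through its other constraint, so the walk does not turn back; the complementary
-- colouring walks in reverse.
omit [Fintype α] in
theorem Alternating.linkFun_linkFun (h : Alternating n θ P) (hθ : ∀ x, θ (θ x) = x) (x : α) :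
    linkFun n θ (fun x => ¬ P x) (linkFun n θ P x) = x := by
  by_cases hx : P x
  · by_cases hf : θ x = x
    · have h1 := h.next_iff x hf
      simp [linkFun, hx, hf, h1]
    · have h1 := h.apply_iff x hf
      simp [linkFun, hx, hf, h1, hθ, Ne.symm hf]
  · obtain ⟨z, rfl⟩ := n.surjective x
    by_cases hf : θ z = z
    · have h1 := h.next_iff z hf
      rw [h1] at hx
      simp [linkFun, hx, hf, h1]
    · have h1 := h.next_apply_iff z hf
      simp [linkFun, hx, hf, h1, hθ, Ne.symm hf]

/-- The permutation that moves along the cycles of the graph of constraints. -/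
noncomputable def Alternating.link (h : Alternating n θ P) (hθ : ∀ x, θ (θ x) = x) :
    Equiv.Perm α where
  toFun := linkFun n θ P
  invFun := linkFun n θ fun x => ¬ P x
  left_inv := h.linkFun_linkFun hθ
  right_inv x := by
    have := h.compl.linkFun_linkFun hθ x
    simpa only [not_not] using this

omit [Fintype α] in
theorem Alternating.link_apply (h : Alternating n θ P) (hθ : ∀ x, θ (θ x) = x) (x : α) :
    h.link hθ x = linkFun n θ P x := rfl

omit [Fintype α] in
theorem Alternating.link_symm_apply (h : Alternating n θ P) (hθ : ∀ x, θ (θ x) = x) (x : α) :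
    (h.link hθ).symm x = linkFun n θ (fun x => ¬ P x) x := rfl

/-- A set of elements that is a union of connected components of the graph of constraints. -/
structure LinkClosed (n θ : Equiv.Perm α) (K : α → Prop) : Prop where
  next_iff : ∀ x, θ x = x → (K (n x) ↔ K x)
  apply_iff : ∀ x, θ x ≠ x → (K (θ x) ↔ K x)
  next_apply_iff : ∀ x, θ x ≠ x → (K (n (θ x)) ↔ K (n x))

omit [Fintype α] in
theorem Alternating.linkClosed (h : Alternating n θ P) (hθ : ∀ x, θ (θ x) = x) (x₀ : α) :
    LinkClosed n θ ((h.link hθ).SameCycle x₀) := by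
  have h1 : ∀ x, (h.link hθ).SameCycle x₀ (linkFun n θ P x) ↔ (h.link hθ).SameCycle x₀ x :=
    fun x => Equiv.Perm.sameCycle_apply_right
  have h2 : ∀ x, (h.link hθ).SameCycle x₀ (linkFun n θ (fun x => ¬ P x) x) ↔
      (h.link hθ).SameCycle x₀ x := fun x => by
    rw [← h1 (linkFun n θ (fun x => ¬ P x) x)]
    have := (h.link hθ).apply_symm_apply x
    rw [h.link_symm_apply, h.link_apply] at this
    rw [this]
  constructor
  · intro x hx
    by_cases hp : P x
    · have := h1 x
      rwa [linkFun, if_pos hp, if_pos hx] at this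
    · have := h2 x
      rwa [linkFun, if_pos hp, if_pos hx] at this
  · intro x hx
    by_cases hp : P x
    · have := h1 x
      rwa [linkFun, if_pos hp, if_neg hx] at this
    · have := h2 x
      rwa [linkFun, if_pos hp, if_neg hx] at this
  · intro x hx
    by_cases hp : P (n x)
    · have := h2 (n x)
      rwa [linkFun, if_neg (not_not.2 hp), n.symm_apply_apply, if_neg hx] at this
    · have := h1 (n x)
      rwa [linkFun, if_neg hp, n.symm_apply_apply, if_neg hx] at this

-- No constraint links `K` to its complement, so reversing the colours on `K` preserves all of them.
omit [Fintype α] in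
theorem LinkClosed.alternating {K : α → Prop} (hK : LinkClosed n θ K) (h : Alternating n θ P) :
    Alternating n θ fun x => P x ↔ ¬ K x where
  next_iff x hx := by rw [hK.next_iff x hx, h.next_iff x hx]
  apply_iff x hx := by rw [hK.apply_iff x hx, h.apply_iff x hx]; tauto
  next_apply_iff x hx := by rw [hK.next_apply_iff x hx, h.next_apply_iff x hx]; tauto

theorem sameCycle_iff_of_eq_inv {σ τ : Equiv.Perm α} {x₀ : α}
    (h : ∀ y, σ.SameCycle x₀ y → τ y = σ⁻¹ y) (y : α) :
    τ.SameCycle x₀ y ↔ σ.SameCycle x₀ y := by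
  have hpow : ∀ m : ℕ, (τ ^ m) x₀ = (σ⁻¹ ^ m) x₀ := by
    intro m
    induction m with
    | zero => rfl
    | succ m ih =>
      rw [pow_succ', pow_succ', Equiv.Perm.mul_apply, Equiv.Perm.mul_apply, ih, h]
      rw [← Equiv.Perm.sameCycle_inv]
      exact ⟨m, by rw [zpow_natCast]⟩
  rw [← Equiv.Perm.sameCycle_inv (f := σ)]
  constructor
  · intro hy
    obtain ⟨m, -, hm⟩ := hy.exists_pow_eq'
    exact ⟨m, by rw [zpow_natCast, ← hpow, hm]⟩
  · intro hy
    obtain ⟨m, -, hm⟩ := hy.exists_pow_eq'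
    exact ⟨m, by rw [zpow_natCast, hpow, hm]⟩

/-- Flipping the colours on a component does not change the component. -/
theorem Alternating.sameCycle_flip (h : Alternating n θ P) (hθ : ∀ x, θ (θ x) = x) (x₀ : α)
    (h' : Alternating n θ fun x => P x ↔ ¬ (h.link hθ).SameCycle x₀ x) (y : α) :
    (h'.link hθ).SameCycle x₀ y ↔ (h.link hθ).SameCycle x₀ y := by
  refine sameCycle_iff_of_eq_inv (fun y hy => ?_) y
  change linkFun n θ (fun x => P x ↔ ¬ (h.link hθ).SameCycle x₀ x) y =
    linkFun n θ (fun x => ¬ P x) y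
  have e : (P y ↔ ¬ (h.link hθ).SameCycle x₀ y) ↔ ¬ P y :=
    ⟨fun e hp => e.1 hp hy, fun e => ⟨fun hp => (e hp).elim, fun hn => (hn hy).elim⟩⟩
  exact linkFun_congr e

/-- Here `g` is the successor map of the coloured part, extended by the identity. Flipping a
component `K` turns `g` into `g'` up to a cycle running through `K`, of sign -(-1)^#K, and the
transpositions of `θ` in `K`. The parity of the coloured set changes by (-1)^#K as well, so a single
minus sign is left. -/
theorem Alternating.sign_flip [DecidableEq α] (h : Alternating n θ P) (hθ : ∀ x, θ (θ x) = x)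
    (x₀ : α) {q : Finset α} (hq : ∀ x, θ x ≠ x → (θ x ∈ q ↔ x ∉ q)) (hq' : ∀ x ∈ q, θ x ≠ x)
    {P' : α → Prop} (hP' : ∀ x, P' x ↔ (P x ↔ ¬ (h.link hθ).SameCycle x₀ x))
    [DecidablePred ((h.link hθ).SameCycle x₀)]
    {g g' : Equiv.Perm α} (hg₁ : ∀ x, ¬ P x → g x = x)
    (hg₂ : ∀ x, P x → P (n x) → g x = n x) (hg₃ : ∀ x, P x → ¬ P (n x) → g x = n (θ x))
    (hg₁' : ∀ x, ¬ P' x → g' x = x)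
    (hg₂' : ∀ x, P' x → P' (n x) → g' x = n x)
    (hg₃' : ∀ x, P' x → ¬ P' (n x) → g' x = n (θ x)) :
    Equiv.Perm.sign g' * parity P' * (∏ x ∈ q, if (h.link hθ).SameCycle x₀ x then -1 else 1) =
      -(Equiv.Perm.sign g * parity P) := by
  classical
  have hK := h.linkClosed hθ x₀
  have hc := sign_cycleOf (h.link hθ)⁻¹ x₀
  have hcyc : ∀ y, ((h.link hθ)⁻¹.cycleOf x₀) y =
      if (h.link hθ).SameCycle x₀ y then linkFun n θ (fun x => ¬ P x) y else y := by
    intro y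
    rw [Equiv.Perm.cycleOf_apply]
    exact if_congr Equiv.Perm.sameCycle_inv rfl rfl
  have hKc : parity ((h.link hθ)⁻¹.SameCycle x₀) = parity ((h.link hθ).SameCycle x₀) := by
    congr 1
    funext y
    exact propext Equiv.Perm.sameCycle_inv
  rw [hKc] at hc
  generalize hKdef : (h.link hθ).SameCycle x₀ = K at *
  have hKθ : ∀ x, K (θ x) ↔ K x := fun x => by
    by_cases hx : θ x = x
    · rw [hx]
    · exact hK.apply_iff x hx
  let tf : α → α := fun x => if K x then θ x else x
  have htf : Function.Involutive tf := by
    intro x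
    by_cases hx : K x
    · have e : tf x = θ x := if_pos hx
      rw [e]
      exact (if_pos ((hKθ x).2 hx)).trans (hθ x)
    · have e : tf x = x := if_neg hx
      rw [e, e]
  have ht := sign_of_involutive hθ hKθ hq hq' (t := htf.toPerm) (fun x hx => if_pos hx)
    fun x hx => if_neg hx
  -- The identity that carries the sign computation. It is checked place by place, according to the
  -- colours of `x` and its successor, their membership in `K`, and whether `θ` moves `x`.
  have hmul : (h.link hθ)⁻¹.cycleOf x₀ * g = g' * htf.toPerm := by
    ext x
    rw [Equiv.Perm.mul_apply, Equiv.Perm.mul_apply, hcyc]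
    change _ = g' (if K x then θ x else x)
    have g1 := hg₁ x
    have g2 := hg₂ x
    have g3 := hg₃ x
    have g1' := hg₁' x
    have g2' := hg₂' x
    have g3' := hg₃' x
    rw [hP'] at g1' g2' g3'
    rw [hP'] at g2' g3'
    by_cases hf : θ x = x
    · have e1 := h.next_iff x hf
      have e2 := hK.next_iff x hf
      by_cases hp : P x <;> by_cases hk : K x <;> simp_all [linkFun]
    · have hf' := Ne.symm hf
      have e1 := h.apply_iff x hf
      have e2 := hK.apply_iff x hf
      have e3 := h.next_apply_iff x hf
      have e4 := hK.next_apply_iff x hf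
      have k1 := hg₁' (θ x)
      have k2 := hg₂' (θ x)
      have k3 := hg₃' (θ x)
      rw [hP'] at k1 k2 k3
      rw [hP'] at k2 k3
      rw [hθ] at k3
      by_cases hp : P x <;> by_cases hk : K x <;> by_cases hpn : P (n x) <;>
        by_cases hkn : K (n x) <;>
        simp only [hp, hk, hpn, hkn, e1, e2, e3, e4, not_true, not_false_iff, iff_true, iff_false,
          forall_true_left, IsEmpty.forall_iff, if_true, if_false] at g1 g2 g3 g1' g2' g3' k1 k2 k3 ⊢ <;>
        simp [*, linkFun]
  have hs := congrArg Equiv.Perm.sign hmul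
  rw [Equiv.Perm.sign_mul, Equiv.Perm.sign_mul, ht] at hs
  replace hs := (congrArg (· * Equiv.Perm.sign g) (hc.symm.trans (by congr!))).trans hs
  rw [parity_mul_of_xor hP']
  calc _ = (Equiv.Perm.sign g' * ∏ x ∈ q, if K x then -1 else 1) * parity P * parity K := by
        ac_rfl
    _ = -(parity K * parity K * (Equiv.Perm.sign g * parity P)) := by
        rw [← hs, neg_mul, neg_mul, neg_mul]
        congr 1
        ac_rfl
    _ = _ := by rw [Int.units_mul_self, one_mul]

end

end Permutations

/-! ### The sign-reversing involution behind the antipode -/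

section Antipode

variable {k : Type w} [Field k] {V : Type u} [Quiver.{v} V] {ι : Type}

theorem fin_two_eq_iff (i : Fin 2) {a b : Fin 2} : a = b ↔ (a = i ↔ b = i) := by
  revert a b i
  decide

theorem fin_two_add_one_eq_iff {a i : Fin 2} : a + 1 = i ↔ ¬ a = i := by
  revert a i
  decide

theorem fin_two_add_one_cast {R : Type*} [CommRing R] (a : Fin 2) :
    (((a + 1 : Fin 2) : ℕ) : R) = 1 - ((a : ℕ) : R) := by
  fin_cases a <;> simp

open scoped Classical in
variable (k) in
/-- The sign `(-1)^m`, where `m` is the number of necklaces of `E` in the component `i`; it is zero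
if `c` is not a component assignment. -/
noncomputable def partSign [Finite ι] (i : Fin 2) (E : Diagram (DEdge V) ι) (c : ι → Fin 2) : k[X] :=
  if h : ∀ x, c (E.next x) = c x then (-1) ^ (E.part ⟨c, h⟩ i).collection.card else 0

/-- The necklaces of a part are the orbits of its successor map, so `neg_one_pow_card_orbits`
applies; extension by the identity preserves the sign. -/
theorem exists_perm_partSign [Fintype ι] [DecidableEq ι] (i : Fin 2) {E : Diagram (DEdge V) ι} {c : ι → Fin 2}
    (h : ∀ x, c (E.next x) = c x) :
    ∃ g : Equiv.Perm ι, (∀ x, c x ≠ i → g x = x) ∧ (∀ x, c x = i → g x = E.next x) ∧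
      partSign k i E c = (((Equiv.Perm.sign g * parity fun x => c x = i : ℤˣ) : ℤ) : k[X]) := by
  refine ⟨Equiv.Perm.ofSubtype (E.part ⟨c, h⟩ i).next,
    fun x hx => Equiv.Perm.ofSubtype_apply_of_not_mem _ hx, fun x hx => ?_, ?_⟩
  · exact (Equiv.Perm.ofSubtype_apply_of_mem (p := fun x => c x = i) _ hx).trans rfl
  · rw [partSign, dif_pos h, Equiv.Perm.sign_ofSubtype, parity_eq, Diagram.card_collection,
      ← neg_one_pow_card_orbits]
    push_cast
    rfl

theorem compSign_ne [Fintype ι] {D : Diagram (DEdge V) ι} {θ : D.Cutting} {c : ι → Fin 2}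
    (h : D.weight (compWeight (k := k) c) θ.1 ≠ 0) {x : ι} (hx : θ.1 x ≠ x) : c (θ.1 x) ≠ c x := by
  intro hc
  rcases θ.2.mem_cutQ_or hx with hq | hq
  · exact h (Diagram.weight_eq_zero hq (by rw [compWeight, hc, sub_self, mul_zero]))
  · exact h (Diagram.weight_eq_zero hq (by rw [compWeight, θ.2.invol, hc, sub_self, mul_zero]))

theorem component_next_eq {D : Diagram (DEdge V) ι} {φ : D.Cutting} {c : ι → Fin 2}
    (h : ∀ x, c ((D.cutAt φ).next x) = c x) (x : ι) : c (D.next x) = c (φ.1 x) := by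
  rw [← h (φ.1 x)]
  exact congrArg (fun y => c (D.next y)) (φ.2.invol x).symm

theorem Diagram.Cutting.Sub.apply_apply {D : Diagram (DEdge V) ι} {φ θ : D.Cutting} (h : φ.Sub θ)
    {x : ι} (hx : φ.1 x = x) : φ.1 (θ.1 x) = θ.1 x := by
  by_contra hne
  have := h _ hne
  rw [θ.2.invol] at this
  have e : θ.1 x = x := by rw [← φ.2.invol (θ.1 x), ← this, hx]
  exact hne (by rw [e, hx])

/-- Only alternating colourings contribute to the antipode relation. -/
theorem alternating_of_ne_zero [Fintype ι] {D : Diagram (DEdge V) ι} (i : Fin 2) {φ θ : D.Cutting}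
    (hφ : φ.Sub θ) {c : ι → Fin 2} (hw : D.weight (compWeight (k := k) c) θ.1 ≠ 0)
    (h : ∀ x, c ((D.cutAt φ).next x) = c x) : Alternating D.next θ.1 fun x => c x = i := by
  have hn := component_next_eq h
  have hθ : ∀ x, θ.1 x ≠ x → ¬ (c (θ.1 x) = i ↔ c x = i) := fun x hx h' =>
    compSign_ne hw hx ((fin_two_eq_iff i).2 h')
  have hfix : ∀ x, θ.1 x = x → φ.1 x = x := fun x hx => by
    by_contra hne
    exact hne (by rw [← hφ x hne, hx])
  constructor
  · intro x hx
    rw [hn, hfix x hx]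
  · intro x hx
    have := hθ x hx
    tauto
  · intro x hx
    have := hθ x hx
    rw [hn, hn]
    -- The sub-cutting `φ` either fixes both edges of the pair or exchanges them. In both cases the
    -- colours after the two edges are those of the edges themselves, in one order or the other.
    by_cases hx' : φ.1 x = x
    · rw [hφ.apply_apply hx', hx']
      tauto
    · have e := hφ x hx'
      rw [← e, e, φ.2.invol, ← e]
      tauto

open scoped Classical in
/-- The part of a cutting along which the colours change. -/
noncomputable def Alternating.cutting {D : Diagram (DEdge V) ι} {i : Fin 2} {θ : D.Cutting}
    {c : ι → Fin 2} (h : Alternating D.next θ.1 fun x => c x = i) : D.Cutting where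
  val := Function.Involutive.toPerm (fun x => if c (D.next x) = c x then x else θ.1 x) <| by
    intro x
    beta_reduce
    by_cases hx : c (D.next x) = c x
    · rw [if_pos hx, if_pos hx]
    · have hne : θ.1 x ≠ x := fun he => hx ((fin_two_eq_iff i).2 (h.next_iff x he))
      have h1 := h.apply_iff x hne
      have h2 := h.next_apply_iff x hne
      rw [if_neg hx, if_neg, θ.2.invol]
      rw [fin_two_eq_iff i] at hx ⊢
      tauto
  property := by
    constructor
    · exact Function.Involutive.toPerm_involutive _
    · intro x hx
      change (if c (D.next x) = c x then x else θ.1 x) ≠ x at hx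
      by_cases hc : c (D.next x) = c x
      · exact absurd (if_pos hc) hx
      · rw [if_neg hc] at hx
        obtain ⟨a, h1, h2⟩ := θ.2.rev x hx
        refine ⟨a, h1, ?_⟩
        rw [← h2]
        exact congrArg D.label (if_neg hc)

theorem Alternating.cutting_of_eq {D : Diagram (DEdge V) ι} {i : Fin 2} {θ : D.Cutting}
    {c : ι → Fin 2} (h : Alternating D.next θ.1 fun x => c x = i) {x : ι}
    (hx : c (D.next x) = c x) : h.cutting.1 x = x :=
  if_pos hx

theorem Alternating.cutting_of_ne {D : Diagram (DEdge V) ι} {i : Fin 2} {θ : D.Cutting}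
    {c : ι → Fin 2} (h : Alternating D.next θ.1 fun x => c x = i) {x : ι}
    (hx : c (D.next x) ≠ c x) : h.cutting.1 x = θ.1 x :=
  if_neg hx

theorem Alternating.cutting_sub {D : Diagram (DEdge V) ι} {i : Fin 2} {θ : D.Cutting}
    {c : ι → Fin 2} (h : Alternating D.next θ.1 fun x => c x = i) : h.cutting.Sub θ := by
  intro x hx
  by_cases hc : c (D.next x) = c x
  · exact absurd (h.cutting_of_eq hc) hx
  · exact (h.cutting_of_ne hc).symm

theorem Alternating.next_eq_cutting {D : Diagram (DEdge V) ι} {i : Fin 2} {θ : D.Cutting}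
    {c : ι → Fin 2} (h : Alternating D.next θ.1 fun x => c x = i) (x : ι) :
    c (D.next x) = c (h.cutting.1 x) := by
  by_cases hc : c (D.next x) = c x
  · rw [h.cutting_of_eq hc, hc]
  · have hne : θ.1 x ≠ x := fun he => hc ((fin_two_eq_iff i).2 (h.next_iff x he))
    have h1 := h.apply_iff x hne
    rw [h.cutting_of_ne hc]
    rw [fin_two_eq_iff i] at hc ⊢
    tauto

theorem Alternating.component_cutting {D : Diagram (DEdge V) ι} {i : Fin 2} {θ : D.Cutting}
    {c : ι → Fin 2} (h : Alternating D.next θ.1 fun x => c x = i) (x : ι) :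
    c ((D.cutAt h.cutting).next x) = c x :=
  (h.next_eq_cutting (h.cutting.1 x)).trans (congrArg c (h.cutting.2.invol x))

/-- The colour after `x` is that of `φ x`, so comparing it with the colour of `x` tells whether `φ`
moves `x`. The colouring thus determines the sub-cutting. -/
theorem Alternating.eq_cutting {D : Diagram (DEdge V) ι} {i : Fin 2} {φ θ : D.Cutting}
    {c : ι → Fin 2} (h : Alternating D.next θ.1 fun x => c x = i) (hφ : φ.Sub θ)
    (hc : ∀ x, c ((D.cutAt φ).next x) = c x) : φ = h.cutting := by
  refine Subtype.ext (Equiv.ext fun x => ?_)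
  have hn := component_next_eq hc x
  by_cases hx : φ.1 x = x
  · rw [hx] at hn
    rw [hx, h.cutting_of_eq hn]
  · have e := hφ x hx
    rw [h.cutting_of_ne, e]
    rw [← e] at hn hx
    have h1 := h.apply_iff x hx
    rw [hn]
    rw [Ne, fin_two_eq_iff i]
    tauto

-- The sum over sub-cuttings collapses to the unique one for which `c` is constant on necklaces. The
-- resulting permutation is described by the colouring alone, in the form required by
-- `Alternating.sign_flip`.
open scoped Classical in
theorem Alternating.exists_perm_sum_partSign [Fintype ι] {D : Diagram (DEdge V) ι}
    {i : Fin 2} {θ : D.Cutting} {c : ι → Fin 2} (h : Alternating D.next θ.1 fun x => c x = i) :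
    ∃ g : Equiv.Perm ι, (∀ x, ¬ c x = i → g x = x) ∧
      (∀ x, c x = i → c (D.next x) = i → g x = D.next x) ∧
      (∀ x, c x = i → ¬ c (D.next x) = i → g x = D.next (θ.1 x)) ∧
      ∑ φ ∈ Finset.univ.filter fun φ : D.Cutting => φ.Sub θ, partSign k i (D.cutAt φ) c =
        (((Equiv.Perm.sign g * parity fun x => c x = i : ℤˣ) : ℤ) : k[X]) := by
  obtain ⟨g, h1, h2, h3⟩ := exists_perm_partSign (k := k) i h.component_cutting
  refine ⟨g, h1, fun x hx hn => ?_, fun x hx hn => ?_, ?_⟩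
  · rw [h2 x hx]
    exact congrArg D.next (h.cutting_of_eq (hn.trans hx.symm))
  · rw [h2 x hx]
    exact congrArg D.next (h.cutting_of_ne fun e => hn (e.trans hx))
  · rw [← h3]
    refine Finset.sum_eq_single_of_mem _
      (Finset.mem_filter.2 ⟨Finset.mem_univ _, h.cutting_sub⟩) fun φ hφ hne => ?_
    rw [partSign, dif_neg]
    exact fun hc => hne (h.eq_cutting (Finset.mem_filter.1 hφ).2 hc)

open scoped Classical in
/-- Exchanging the two components on one connected component of the graph of constraints. -/
noncomputable def flipColour {n θ : Equiv.Perm ι} (hθ : ∀ x, θ (θ x) = x) (x₀ : ι) (i : Fin 2)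
    (c : ι → Fin 2) : ι → Fin 2 :=
  if h : Alternating n θ fun x => c x = i then
    fun x => if (h.link hθ).SameCycle x₀ x then c x + 1 else c x
  else c

section

variable {n θ : Equiv.Perm ι} {hθ : ∀ x, θ (θ x) = x} {x₀ : ι} {i : Fin 2} {c : ι → Fin 2}

theorem flipColour_of_sameCycle (h : Alternating n θ fun x => c x = i) {x : ι}
    (hx : (h.link hθ).SameCycle x₀ x) : flipColour (n := n) hθ x₀ i c x = c x + 1 := by
  rw [flipColour, dif_pos h]
  exact if_pos hx

theorem flipColour_of_not (h : Alternating n θ fun x => c x = i) {x : ι}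
    (hx : ¬ (h.link hθ).SameCycle x₀ x) : flipColour (n := n) hθ x₀ i c x = c x := by
  rw [flipColour, dif_pos h]
  exact if_neg hx

theorem flipColour_eq_iff (h : Alternating n θ fun x => c x = i) (x : ι) :
    flipColour (n := n) hθ x₀ i c x = i ↔ (c x = i ↔ ¬ (h.link hθ).SameCycle x₀ x) := by
  by_cases hx : (h.link hθ).SameCycle x₀ x
  · rw [flipColour_of_sameCycle h hx, fin_two_add_one_eq_iff]
    tauto
  · rw [flipColour_of_not h hx]
    tauto

theorem alternating_flipColour (h : Alternating n θ fun x => c x = i) :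
    Alternating n θ fun x => flipColour (n := n) hθ x₀ i c x = i := by
  have := (h.linkClosed hθ x₀).alternating h
  convert this using 2 with x
  exact flipColour_eq_iff h x

theorem sameCycle_flipColour [Fintype ι] (h : Alternating n θ fun x => c x = i)
    (h' : Alternating n θ fun x => flipColour (n := n) hθ x₀ i c x = i) (x : ι) :
    (h'.link hθ).SameCycle x₀ x ↔ (h.link hθ).SameCycle x₀ x := by
  have e : (fun x => flipColour (n := n) hθ x₀ i c x = i) =
      fun x => c x = i ↔ ¬ (h.link hθ).SameCycle x₀ x :=
    funext fun x => propext (flipColour_eq_iff h x)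
  have key : ∀ (P : ι → Prop) (hP : Alternating n θ P),
      P = (fun x => c x = i ↔ ¬ (h.link hθ).SameCycle x₀ x) →
      ((hP.link hθ).SameCycle x₀ x ↔ (h.link hθ).SameCycle x₀ x) := by
    rintro P hP rfl
    exact h.sameCycle_flip hθ x₀ hP x
  exact key _ h' e

/-- The flip walks the same component backwards, so the second flip acts on the same set of places.
-/
theorem flipColour_flipColour [Fintype ι] :
    flipColour (n := n) hθ x₀ i (flipColour (n := n) hθ x₀ i c) = c := by
  by_cases h : Alternating n θ fun x => c x = i
  · have h' := alternating_flipColour (hθ := hθ) (x₀ := x₀) h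
    funext x
    by_cases hx : (h.link hθ).SameCycle x₀ x
    · rw [flipColour_of_sameCycle h' ((sameCycle_flipColour h h' x).2 hx),
        flipColour_of_sameCycle h hx, add_assoc]
      exact add_zero _
    · rw [flipColour_of_not h' (mt (sameCycle_flipColour h h' x).1 hx), flipColour_of_not h hx]
  · have e : flipColour (n := n) hθ x₀ i c = c := dif_neg h
    rw [e, e]

end

-- A pair of `θ` lies entirely inside or outside the component. Flipping both ends negates c y - c
-- x, giving one sign for each pair inside.
open scoped Classical in
theorem weight_flipColour [Fintype ι] {D : Diagram (DEdge V) ι} {i : Fin 2} {θ : D.Cutting}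
    {c : ι → Fin 2} (h : Alternating D.next θ.1 fun x => c x = i) (x₀ : ι) :
    D.weight (compWeight (k := k) (flipColour (n := D.next) θ.2.invol x₀ i c)) θ.1 =
      D.weight (compWeight (k := k) c) θ.1 * (((∏ x ∈ D.cutQ θ.1,
        if (h.link θ.2.invol).SameCycle x₀ x then -1 else 1 : ℤˣ) : ℤ) : k[X]) := by
  unfold Diagram.weight
  push_cast
  rw [← Finset.prod_mul_distrib]
  refine Finset.prod_congr rfl fun x hx => ?_
  have hne := (Diagram.mem_cutQ.1 hx).1
  have hK := (h.linkClosed θ.2.invol x₀).apply_iff x hne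
  unfold compWeight
  by_cases hx : (h.link θ.2.invol).SameCycle x₀ x
  · rw [flipColour_of_sameCycle h hx, flipColour_of_sameCycle h (hK.2 hx), if_pos hx,
      fin_two_add_one_cast, fin_two_add_one_cast]
    push_cast
    ring
  · rw [flipColour_of_not h hx, flipColour_of_not h (mt hK.1 hx), if_neg hx]
    push_cast
    ring

open scoped Classical in
/-- The cancellation behind the formula for the antipode. -/
theorem sum_weight_mul_partSign [Fintype ι] [Nonempty ι] {D : Diagram (DEdge V) ι} (i : Fin 2)
    (θ : D.Cutting) :
    ∑ c : ι → Fin 2, D.weight (compWeight (k := k) c) θ.1 *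
      ∑ φ ∈ Finset.univ.filter fun φ : D.Cutting => φ.Sub θ, partSign k i (D.cutAt φ) c = 0 := by
  -- The component to be flipped is always the one through the same place `x₀`, independently of the
  -- colouring. This is where nonemptiness is needed.
  obtain ⟨x₀⟩ := ‹Nonempty ι›
  have halt : ∀ c : ι → Fin 2, D.weight (compWeight (k := k) c) θ.1 *
      ∑ φ ∈ Finset.univ.filter fun φ : D.Cutting => φ.Sub θ, partSign k i (D.cutAt φ) c ≠ 0 →
      Alternating D.next θ.1 fun x => c x = i := by
    intro c hc
    obtain ⟨φ, hφ, h⟩ := Finset.exists_ne_zero_of_sum_ne_zero (right_ne_zero_of_mul hc)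
    refine alternating_of_ne_zero (k := k) i (Finset.mem_filter.1 hφ).2 (left_ne_zero_of_mul hc) ?_
    by_contra hn
    exact h (dif_neg hn)
  refine Finset.sum_involution (fun c _ => flipColour (n := D.next) θ.2.invol x₀ i c)
    (fun c _ => ?_) (fun c _ hc he => ?_) (fun _ _ => Finset.mem_univ _)
    fun _ _ => flipColour_flipColour
  · by_cases h : Alternating D.next θ.1 fun x => c x = i
    · have h' := alternating_flipColour (hθ := θ.2.invol) (x₀ := x₀) h
      obtain ⟨g, hg₁, hg₂, hg₃, hg⟩ := h.exists_perm_sum_partSign (k := k)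
      obtain ⟨g', hg₁', hg₂', hg₃', hg'⟩ := h'.exists_perm_sum_partSign (k := k)
      rw [hg, hg', weight_flipColour h]
      have key := h.sign_flip θ.2.invol x₀ (q := D.cutQ θ.1)
        (fun x hx => ?_) (fun x hx => (Diagram.mem_cutQ.1 hx).1) (flipColour_eq_iff h)
        hg₁ hg₂ hg₃ hg₁' hg₂' hg₃'
      · have key' := congrArg (fun u : ℤˣ => ((u : ℤ) : k[X])) key
        push_cast at key' ⊢
        linear_combination D.weight (compWeight (k := k) c) θ.1 * key'
      · have := θ.2.isQ_apply_iff hx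
        have := θ.2.apply_ne hx
        rw [Diagram.mem_cutQ, Diagram.mem_cutQ]
        tauto
    · have h0 := not_not.1 (mt (halt c) h)
      have e : flipColour (n := D.next) θ.2.invol x₀ i c = c := dif_neg h
      rw [e, h0, add_zero]
  -- The involution has no fixed points among the contributing colourings, since it changes the
  -- colour of `x₀`.
  · have := congrFun he x₀
    rw [flipColour_of_sameCycle (halt c hc) (Equiv.Perm.SameCycle.refl _ _)] at this
    generalize c x₀ = a at this
    revert a
    decide

end Antipode

/-! ### The antipode relations -/

section AntipodeRelation

variable {k : Type w} [Field k] {V : Type u} [Quiver.{v} V] {ι : Type}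

variable (k V) in
/-- The antipode of the Moyal bialgebra. -/
noncomputable def moyalAntipode : SymL k V →ₗ[k[X]] SymL k V :=
  linExt k fun s => (-1 : k[X]) ^ s.card • coll k s

theorem moyalAntipode_coll (s : Multiset (Necklace (DEdge V))) :
    moyalAntipode k V (coll k s) = (-1 : k[X]) ^ s.card • coll k s := by
  rw [moyalAntipode, linExt_coll]

theorem moyalAntipode_moyalAntipode (a : SymL k V) :
    moyalAntipode k V (moyalAntipode k V a) = a := by
  refine LinearMap.congr_fun (linearMap_ext_coll (k := k)
    (f := moyalAntipode k V ∘ₗ moyalAntipode k V) (g := LinearMap.id) fun s => ?_) a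
  rw [LinearMap.comp_apply, moyalAntipode_coll, map_smul, moyalAntipode_coll, smul_smul,
    ← mul_pow, neg_mul_neg, one_mul, one_pow, one_smul]
  rfl

variable (k V) in
/-- Apply the antipode to the tensor factor `i` and multiply. -/
noncomputable def mulAntipode (i : Fin 2) : SymL k V ⊗[k[X]] SymL k V →ₗ[k[X]] SymL k V :=
  TensorProduct.lift
    (if i = 0 then moyalMul k ∘ₗ moyalAntipode k V else (moyalMul k).compl₂ (moyalAntipode k V))

theorem mulAntipode_tmul (i : Fin 2) (p : Fin 2 → Multiset (Necklace (DEdge V))) :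
    mulAntipode k V i (coll k (p 0) ⊗ₜ coll k (p 1)) =
      (-1 : k[X]) ^ (p i).card • moyalMul k (coll k (p 0)) (coll k (p 1)) := by
  rw [mulAntipode, TensorProduct.lift.tmul]
  by_cases h : i = 0
  · subst h
    rw [if_pos rfl, LinearMap.comp_apply, moyalAntipode_coll, LinearMap.map_smul₂]
  · obtain rfl : i = 1 := by omega
    rw [if_neg h, LinearMap.compl₂_apply, moyalAntipode_coll, map_smul]

/-- On the juxtaposition of the parts coloured 0 and 1, the weight of the product is h/2 (c y - c
x): the weights of product and coproduct coincide. -/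
theorem moyalMul_part [Fintype ι] {E : Diagram (DEdge V) ι} (c : Components E) :
    moyalMul k (coll k (E.part c 0).collection) (coll k (E.part c 1).collection) =
      E.cutColl (compWeight c.1) := by
  rw [moyalMul_coll, (E.contractionParts c).cutColl_eq]
  congr 1
  funext x y
  have h : ∀ z, c.1 ((E.contractionParts c).emb z) = Sum.elim (fun _ => 0) (fun _ => 1) z := by
    rintro (z | z)
    · exact z.2
    · exact z.2
  rw [compWeight, h, h]
  rcases x with x | x <;> rcases y with y | y <;> simp [crossWeight]

theorem mulAntipode_tensorTerm [Fintype ι] (i : Fin 2) (E : Diagram (DEdge V) ι) (c : ι → Fin 2) :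
    mulAntipode k V i (tensorTerm E c) = partSign k i E c • E.cutColl (compWeight c) := by
  by_cases h : ∀ x, c (E.next x) = c x
  · rw [tensorTerm_component ⟨c, h⟩, partSign, dif_pos h, ← moyalMul_part ⟨c, h⟩]
    exact mulAntipode_tmul i fun j => (E.part ⟨c, h⟩ j).collection
  · rw [tensorTerm_of_not h, partSign, dif_neg h, map_zero, zero_smul]

/-- The cutting `φ` of the coproduct and the cutting `ψ` of the product back carry the same weight
function, so the weight of their composite `θ` does not depend on `φ`. The coefficient of `θ` is the
signed sum that `sum_weight_mul_partSign` shows to vanish. -/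
theorem mulAntipode_comulSum [Fintype ι] [Nonempty ι] (i : Fin 2) (D : Diagram (DEdge V) ι) :
    mulAntipode k V i (comulSum D) = 0 := by
  classical
  have h : ∀ c : ι → Fin 2,
      mulAntipode k V i (D.cutSum (compWeight (k := k) c) fun φ => tensorTerm (D.cutAt φ) c) =
      ∑ θ : D.Cutting, (D.weight (compWeight (k := k) c) θ.1 *
        ∑ φ ∈ Finset.univ.filter fun φ : D.Cutting => φ.Sub θ, partSign k i (D.cutAt φ) c) •
          coll k (D.cutAt θ).collection := by
    intro c
    have := Diagram.sum_comp (D := D) fun φ θ => (D.weight (compWeight (k := k) c) θ.1 *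
      partSign k i (D.cutAt φ) c) • coll k (D.cutAt θ).collection
    unfold Diagram.cutSum
    rw [map_sum]
    simp only [Finset.mul_sum, Finset.sum_smul]
    refine Eq.trans ?_ this
    refine Finset.sum_congr rfl fun φ _ => ?_
    rw [map_smul, mulAntipode_tensorTerm, Diagram.cutColl, Diagram.cutSum, Finset.smul_sum,
      Finset.smul_sum]
    refine Finset.sum_congr rfl fun ψ _ => ?_
    rw [smul_smul, smul_smul, Diagram.weight_comp, Diagram.cutAt_comp]
    congr 1
    ring
  rw [comulSum_eq_sum, map_sum]
  simp only [h]
  rw [Finset.sum_comm]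
  refine Finset.sum_eq_zero fun θ _ => ?_
  rw [← Finset.sum_smul, sum_weight_mul_partSign, zero_smul]

theorem mulAntipode_moyalComul (i : Fin 2) (a : SymL k V) :
    mulAntipode k V i (moyalComul k a) = moyalCounit k a • 1 := by
  classical
  refine LinearMap.congr_fun (linearMap_ext_coll (k := k)
    (f := mulAntipode k V i ∘ₗ moyalComul k)
    (g := (moyalCounit k).smulRight (1 : SymL k V)) fun s => ?_) a
  rw [LinearMap.comp_apply, LinearMap.smulRight_apply, moyalCounit_coll]
  split_ifs with h
  · subst h
    rw [coll_zero, moyalComul_one, ← coll_zero,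
      mulAntipode_tmul i fun _ => (0 : Multiset (Necklace (DEdge V))), coll_zero, one_moyalMul,
      Multiset.card_zero, pow_zero]
  -- A nonempty collection has at least one place, because vertex idempotents occupy places too.
  · have : Nonempty (Places s) := by
      rw [← not_isEmpty_iff, ← Diagram.collection_eq_zero_iff (diagram s), collection_diagram]
      exact h
    rw [← collection_diagram s, moyalComul_coll, mulAntipode_comulSum, zero_smul]

end AntipodeRelation

/-! ### Packaging structure maps as Hopf algebras -/

section HopfAlgebras

/-- The axioms of a Hopf algebra in terms of linear maps. -/
structure HopfAxioms {R : Type v} [CommRing R] {M : Type u} [AddCommGroup M] [Module R M]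
    (mul : M →ₗ[R] M →ₗ[R] M) (one : M) (comul : M →ₗ[R] M ⊗[R] M) (counit : M →ₗ[R] R)
    (S : M →ₗ[R] M) : Prop where
  mul_assoc : ∀ a b c, mul (mul a b) c = mul a (mul b c)
  one_mul : ∀ a, mul one a = a
  mul_one : ∀ a, mul a one = a
  coassoc : (TensorProduct.assoc R M M M).toLinearMap ∘ₗ comul.rTensor M ∘ₗ comul =
    comul.lTensor M ∘ₗ comul
  rTensor_counit : counit.rTensor M ∘ₗ comul = TensorProduct.mk R R M 1
  lTensor_counit : counit.lTensor M ∘ₗ comul = (TensorProduct.mk R M R).flip 1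
  counit_one : counit one = 1
  counit_mul : ∀ a b, counit (mul a b) = counit a * counit b
  comul_one : comul one = one ⊗ₜ one
  comul_mul : ∀ a b, comul (mul a b) = TensorProduct.map₂ mul mul (comul a) (comul b)
  antipode_left : ∀ a, TensorProduct.lift (mul ∘ₗ S) (comul a) = counit a • one
  antipode_right : ∀ a, TensorProduct.lift (mul.compl₂ S) (comul a) = counit a • one

namespace HopfAxioms

variable {R : Type v} [CommRing R] {M : Type u} [AddCommGroup M] [Module R M]
  {mul : M →ₗ[R] M →ₗ[R] M} {one : M} {comul : M →ₗ[R] M ⊗[R] M} {counit : M →ₗ[R] R}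
  {S : M →ₗ[R] M}

/-- The ring structure given by the product. -/
abbrev ring (h : HopfAxioms mul one comul counit S) : Ring M where
  __ := (inferInstance : AddCommGroup M)
  mul a b := mul a b
  one := one
  mul_assoc := h.mul_assoc
  one_mul := h.one_mul
  mul_one := h.mul_one
  left_distrib a b c := map_add (mul a) b c
  right_distrib a b c := LinearMap.map_add₂ mul a b c
  zero_mul a := LinearMap.map_zero₂ mul a
  mul_zero a := map_zero (mul a)

/-- The algebra structure given by the product. -/
abbrev algebra (h : HopfAxioms mul one comul counit S) :
    letI := h.ring
    Algebra R M :=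
  letI := h.ring
  Algebra.ofModule (fun r a b => LinearMap.map_smul₂ mul r a b) fun r a b => map_smul (mul a) r b

/-- The coalgebra structure given by the coproduct and the counit. -/
abbrev coalgebra (h : HopfAxioms mul one comul counit S) : Coalgebra R M where
  comul := comul
  counit := counit
  coassoc := h.coassoc
  rTensor_counit_comp_comul := h.rTensor_counit
  lTensor_counit_comp_comul := h.lTensor_counit

theorem tensor_mul (h : HopfAxioms mul one comul counit S) (x y : M ⊗[R] M) :
    letI := h.ring
    letI := h.algebra
    x * y = TensorProduct.map₂ mul mul x y := by
  let := h.ring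
  let := h.algebra
  induction x with
  | zero => rw [zero_mul, LinearMap.map_zero₂]
  | add x₁ x₂ h₁ h₂ => rw [add_mul, LinearMap.map_add₂, h₁, h₂]
  | tmul a b =>
    induction y with
    | zero => rw [mul_zero, map_zero]
    | add y₁ y₂ h₁ h₂ => rw [mul_add, map_add, h₁, h₂]
    | tmul c d => rw [Algebra.TensorProduct.tmul_mul_tmul]; rfl

/-- The bialgebra structure given by the structure maps. -/
abbrev bialgebra (h : HopfAxioms mul one comul counit S) :
    letI := h.ring
    Bialgebra R M :=
  letI := h.ring
  letI := h.algebra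
  letI := h.coalgebra
  Bialgebra.mk' R M h.counit_one (h.counit_mul _ _) h.comul_one
    ((h.comul_mul _ _).trans (h.tensor_mul _ _).symm)

/-- The Hopf algebra structure given by the structure maps. -/
abbrev hopfAlgebra (h : HopfAxioms mul one comul counit S) :
    letI := h.ring
    HopfAlgebra R M :=
  letI := h.ring
  { h.bialgebra with
    antipode := S
    mul_antipode_rTensor_comul := by
      refine LinearMap.ext fun a => Eq.trans ?_ (h.antipode_left a)
      let := h.algebra
      exact LinearMap.congr_fun (f := LinearMap.mul' R M ∘ₗ S.rTensor M)
        (g := TensorProduct.lift (mul ∘ₗ S))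
        (TensorProduct.ext' fun _ _ => rfl) (comul a)
    mul_antipode_lTensor_comul := by
      refine LinearMap.ext fun a => Eq.trans ?_ (h.antipode_right a)
      let := h.algebra
      exact LinearMap.congr_fun (f := LinearMap.mul' R M ∘ₗ S.lTensor M)
        (g := TensorProduct.lift (mul.compl₂ S))
        (TensorProduct.ext' fun _ _ => rfl) (comul a) }

theorem isHopf (h : HopfAxioms mul one comul counit S) : IsHopf mul one comul counit S :=
  letI := h.ring
  letI := h.hopfAlgebra
  ⟨M, h.ring, h.hopfAlgebra, LinearEquiv.refl R M, fun _ _ => rfl, rfl,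
    fun x => (LinearMap.congr_fun TensorProduct.map_id (comul x)).symm, fun _ => rfl, fun _ => rfl⟩

end HopfAxioms

theorem IsHopf.transport {R : Type v} [CommRing R] {M M' : Type u} [AddCommGroup M] [Module R M]
    [AddCommGroup M'] [Module R M'] {mul : M →ₗ[R] M →ₗ[R] M} {one : M} {comul : M →ₗ[R] M ⊗[R] M}
    {counit : M →ₗ[R] R} {S : M →ₗ[R] M} (h : IsHopf mul one comul counit S) (f : M ≃ₗ[R] M')
    {mul' : M' →ₗ[R] M' →ₗ[R] M'} {one' : M'} {comul' : M' →ₗ[R] M' ⊗[R] M'}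
    {counit' : M' →ₗ[R] R} {S' : M' →ₗ[R] M'} (hmul : ∀ x y, f (mul x y) = mul' (f x) (f y))
    (hone : f one = one') (hcomul : ∀ x, comul' (f x) = TensorProduct.map f.toLinearMap f.toLinearMap (comul x))
    (hcounit : ∀ x, counit' (f x) = counit x) (hS : ∀ x, S' (f x) = f (S x)) :
    IsHopf mul' one' comul' counit' S' := by
  obtain ⟨H, _, _, e, h1, h2, h3, h4, h5⟩ := h
  refine ⟨H, inferInstance, inferInstance, f.symm.trans e, fun x y => ?_, ?_, fun x => ?_,
    fun x => ?_, fun x => ?_⟩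
  · obtain ⟨x, rfl⟩ := f.surjective x
    obtain ⟨y, rfl⟩ := f.surjective y
    simp only [LinearEquiv.trans_apply, ← hmul, f.symm_apply_apply, h1]
  · rw [LinearEquiv.trans_apply, ← hone, f.symm_apply_apply, h2]
  · obtain ⟨x, rfl⟩ := f.surjective x
    rw [LinearEquiv.trans_apply, f.symm_apply_apply, h3, hcomul]
    refine Eq.trans ?_ (LinearMap.congr_fun (TensorProduct.map_comp _ _ _ _) _)
    have : (f.symm.trans e).toLinearMap ∘ₗ f.toLinearMap = e.toLinearMap :=
      LinearMap.ext fun x => congrArg e (f.symm_apply_apply x)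
    rw [this]
  · obtain ⟨x, rfl⟩ := f.surjective x
    rw [LinearEquiv.trans_apply, f.symm_apply_apply, h4, hcounit]
  · obtain ⟨x, rfl⟩ := f.surjective x
    rw [LinearEquiv.trans_apply, LinearEquiv.trans_apply, hS, f.symm_apply_apply,
      f.symm_apply_apply, h5]

end HopfAlgebras

/-! ### Eigenspaces of a diagonal endomorphism -/

section Eigenspaces

variable {R M σ : Type*} [CommRing R] [AddCommGroup M] [Module R M]

theorem repr_apply_of_diagonal (b : Module.Basis σ R M) {S : M →ₗ[R] M} {e : σ → R}
    (hS : ∀ s, S (b s) = e s • b s) (x : M) (s : σ) : b.repr (S x) s = e s * b.repr x s := by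
  classical
  have : b.coord s ∘ₗ S = e s • b.coord s := b.ext fun t => by
    rw [LinearMap.comp_apply, hS, map_smul, LinearMap.smul_apply, Module.Basis.coord_apply,
      Module.Basis.repr_self, Finsupp.single_apply]
    split_ifs with h
    · rw [h]
    · rw [smul_zero, smul_zero]
  exact LinearMap.congr_fun this x

/-- Compare coordinates: over a domain, a nonzero coordinate at `s` forces `e s = μ`. -/
theorem eigenspace_eq_span_of_diagonal [IsDomain R] (b : Module.Basis σ R M) {S : M →ₗ[R] M}
    {e : σ → R} (hS : ∀ s, S (b s) = e s • b s) (μ : R) :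
    Module.End.eigenspace S μ = Submodule.span R (b '' {s | e s = μ}) := by
  ext x
  rw [Module.End.mem_eigenspace_iff, b.mem_span_image]
  constructor
  · intro hx s hs
    have h := repr_apply_of_diagonal b hS x s
    rw [hx, map_smul, Finsupp.smul_apply, smul_eq_mul] at h
    exact (mul_right_cancel₀ (Finsupp.mem_support_iff.1 hs) h).symm
  · intro hx
    refine b.repr.injective (Finsupp.ext fun s => ?_)
    rw [repr_apply_of_diagonal b hS, map_smul, Finsupp.smul_apply, smul_eq_mul]
    by_cases hs : b.repr x s = 0
    · rw [hs, mul_zero, mul_zero]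
    · rw [show e s = μ from hx (Finsupp.mem_support_iff.2 hs)]

theorem hasEigenvalue_iff_of_diagonal [IsDomain R] (b : Module.Basis σ R M) {S : M →ₗ[R] M}
    {e : σ → R} (hS : ∀ s, S (b s) = e s • b s) (μ : R) :
    Module.End.HasEigenvalue S μ ↔ ∃ s, e s = μ := by
  rw [Module.End.hasEigenvalue_iff, eigenspace_eq_span_of_diagonal b hS, Ne, Submodule.span_eq_bot]
  constructor
  · intro h
    by_contra! h'
    refine h ?_
    rintro _ ⟨s, hs, rfl⟩
    exact absurd hs (h' s)
  · rintro ⟨s, hs⟩ h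
    exact b.ne_zero s (h _ ⟨s, hs, rfl⟩)

end Eigenspaces

/-! ### Assembly: spectrum of the antipode and transport to `A_h(Q)` -/

section Final

variable {k : Type w} [Field k] {V : Type u} [Quiver.{v} V]

variable (k V) in
open scoped Classical in
/-- The basis of `(Sym L)[h]` that consists of the collections of necklaces. -/
noncomputable def collBasis : Module.Basis (Multiset (Necklace (DEdge V))) k[X] (SymL k V) :=
  (MvPolynomial.basisMonomials (Necklace (DEdge V)) k[X]).reindex Multiset.toFinsupp.symm.toEquiv

theorem collBasis_apply (s : Multiset (Necklace (DEdge V))) : collBasis k V s = coll k s := by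
  classical
  rw [collBasis, Module.Basis.reindex_apply, basisMonomials_eq_coll]
  exact congrArg (coll k) (Multiset.toFinsupp_toMultiset s)

theorem moyalAntipode_collBasis (s : Multiset (Necklace (DEdge V))) :
    moyalAntipode k V (collBasis k V s) = (-1 : k[X]) ^ s.card • collBasis k V s := by
  rw [collBasis_apply, moyalAntipode_coll]

/-- Every necklace has a base vertex; conversely a single vertex idempotent is a collection with one
necklace. Hence -1 is an eigenvalue exactly when there are vertices. -/
theorem exists_card_odd_iff :
    (∃ s : Multiset (Necklace (DEdge V)), Odd s.card) ↔ Nonempty V := by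
  constructor
  · rintro ⟨s, hs⟩
    obtain ⟨p, -⟩ := Multiset.card_pos_iff_exists_mem.1 hs.pos
    exact ⟨p.out.base⟩
  · rintro ⟨a⟩
    exact ⟨{Necklace.mk ⟨a, [], rfl⟩}, by rw [Multiset.card_singleton]; exact odd_one⟩

theorem hasEigenvalue_moyalAntipode_iff (μ : k[X]) :
    Module.End.HasEigenvalue (moyalAntipode k V) μ ↔ μ = 1 ∨ (μ = -1 ∧ Nonempty V) := by
  rw [hasEigenvalue_iff_of_diagonal (collBasis k V) moyalAntipode_collBasis]
  constructor
  · rintro ⟨s, rfl⟩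
    rcases Nat.even_or_odd s.card with h | h
    · exact .inl h.neg_one_pow
    · exact .inr ⟨h.neg_one_pow, exists_card_odd_iff.1 ⟨s, h⟩⟩
  · rintro (rfl | ⟨rfl, hV⟩)
    · exact ⟨0, by rw [Multiset.card_zero, pow_zero]⟩
    · obtain ⟨s, hs⟩ := exists_card_odd_iff.2 hV
      exact ⟨s, hs.neg_one_pow⟩

theorem moyal_hopfAxioms : HopfAxioms (moyalMul k) (1 : SymL k V) (moyalComul k) (moyalCounit k)
    (moyalAntipode k V) where
  mul_assoc := moyalMul_assoc
  one_mul := one_moyalMul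
  mul_one := moyalMul_one
  coassoc := moyalComul_coassoc
  rTensor_counit := rTensor_counit_comp_moyalComul
  lTensor_counit := lTensor_counit_comp_moyalComul
  counit_one := moyalCounit_one
  counit_mul := moyalCounit_mul
  comul_one := moyalComul_one
  comul_mul := moyalComul_mul
  antipode_left := mulAntipode_moyalComul 0
  antipode_right := mulAntipode_moyalComul 1

variable [CharZero k]

theorem neg_one_ne_one : (-1 : k[X]) ≠ 1 := fun h => by
  have h2 : (2 : k[X]) = 0 := by linear_combination -h
  exact two_ne_zero h2

theorem phiW_one : phiEquiv k V 1 = Ah.one k V := by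
  rw [← (phiEquiv k V).apply_symm_apply (Ah.one k V), Ah.one, phiEquiv_symm_cls, one_eq_cutColl,
    HDiagram.wick]
  congr 2

theorem phiW_moyalMul (x y : SymL k V) :
    phiEquiv k V (moyalMul k x y) = Ah.mul k V (phiEquiv k V x) (phiEquiv k V y) := by
  change _ = phiEquiv k V (moyalMul k ((phiEquiv k V).symm _) ((phiEquiv k V).symm _))
  rw [LinearEquiv.symm_apply_apply, LinearEquiv.symm_apply_apply]

theorem comul_phiW (x : SymL k V) : Ah.comul k V (phiEquiv k V x) =
    TensorProduct.map (phiEquiv k V).toLinearMap (phiEquiv k V).toLinearMap (moyalComul k x) := by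
  change TensorProduct.map _ _ (moyalComul k ((phiEquiv k V).symm (phiEquiv k V x))) = _
  rw [LinearEquiv.symm_apply_apply]
  rfl

theorem counit_phiW (x : SymL k V) : Ah.counit k V (phiEquiv k V x) = moyalCounit k x := by
  change moyalCounit k ((phiEquiv k V).symm (phiEquiv k V x)) = _
  rw [LinearEquiv.symm_apply_apply]

variable (k V) in
/-- The antipode of `A_h(Q)`. -/
noncomputable def Ah.antipode : Ah k V →ₗ[k[X]] Ah k V :=
  phiW k ∘ₗ moyalAntipode k V ∘ₗ wickMap k V

theorem antipode_phiW (x : SymL k V) :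
    Ah.antipode k V (phiEquiv k V x) = phiEquiv k V (moyalAntipode k V x) := by
  change phiEquiv k V (moyalAntipode k V ((phiEquiv k V).symm (phiEquiv k V x))) = _
  rw [LinearEquiv.symm_apply_apply]

end Final

end NecklaceMoyal

theorem mainTheorem6 (k : Type w) [Field k] [CharZero k] (V : Type u) [Quiver.{v} V] :
    ∃ (mulA : Ah k V →ₗ[k[X]] Ah k V →ₗ[k[X]] Ah k V)
      (comulA : Ah k V →ₗ[k[X]] Ah k V ⊗[k[X]] Ah k V)
      (counitA : Ah k V →ₗ[k[X]] k[X])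
      (antipodeA : Ah k V →ₗ[k[X]] Ah k V)
      (Φ : SymL k V ≃ₗ[k[X]] Ah k V)
      (S : SymL k V →ₗ[k[X]] SymL k V),
      -- `A_h(Q)` is a Hopf algebra with antipode `antipodeA`
      IsAhStructure k mulA comulA counitA ∧
      IsHopf mulA (Ah.one k V) comulA counitA antipodeA ∧
      -- the symmetrization map is an isomorphism from the Moyal bialgebra to `A_h(Q)`
      (∀ x, Φ x = phiW k x) ∧
      (∀ x y, Φ (moyalMul k x y) = mulA (Φ x) (Φ y)) ∧
      Φ 1 = Ah.one k V ∧
      (∀ x, comulA (Φ x) =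
        TensorProduct.map (Φ : SymL k V →ₗ[k[X]] Ah k V) (Φ : SymL k V →ₗ[k[X]] Ah k V)
          (moyalComul k x)) ∧
      (∀ x, counitA (Φ x) = moyalCounit k x) ∧
      -- `S` is the antipode of `A_h(Q)` transported via the symmetrization map
      (∀ x, S x = Φ.symm (antipodeA (Φ x))) ∧
      (∀ s : Multiset (Necklace (DEdge V)), S (coll k s) = (-1 : k[X]) ^ s.card • coll k s) ∧
      -- the Moyal bialgebra is a Hopf algebra with antipode `S`, and `S² = Id`
      IsHopf (moyalMul k) (1 : SymL k V) (moyalComul k) (moyalCounit k) S ∧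
      (∀ x, S (S x) = x) ∧
      -- `S` is diagonalizable: the collections of necklaces form a basis of eigenvectors
      (∃ b : Module.Basis (Multiset (Necklace (DEdge V))) k[X] (SymL k V), ∀ s, b s = coll k s) ∧
      (∀ μ : k[X], Module.End.HasEigenvalue S μ ↔ μ = 1 ∨ (μ = -1 ∧ Nonempty V)) ∧
      Module.End.eigenspace S 1 = Submodule.span k[X] {x | ∃ s, Even s.card ∧ x = coll k s} ∧
      Module.End.eigenspace S (-1) = Submodule.span k[X] {x | ∃ s, Odd s.card ∧ x = coll k s} := by
  refine ⟨Ah.mul k V, Ah.comul k V, Ah.counit k V, Ah.antipode k V, phiEquiv k V,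
    moyalAntipode k V, isAhStructure k V,
    -- The axioms are verified only on the Moyal side; `A_h(Q)` inherits them through the
    -- symmetrization isomorphism.
    moyal_hopfAxioms.isHopf.transport (phiEquiv k V) phiW_moyalMul phiW_one comul_phiW counit_phiW
      antipode_phiW,
    phiEquiv_apply, phiW_moyalMul, phiW_one, comul_phiW, counit_phiW, fun x => ?_,
    moyalAntipode_coll, moyal_hopfAxioms.isHopf, moyalAntipode_moyalAntipode,
    ⟨collBasis k V, collBasis_apply⟩, hasEigenvalue_moyalAntipode_iff, ?_, ?_⟩
  · rw [antipode_phiW, LinearEquiv.symm_apply_apply]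
  · rw [eigenspace_eq_span_of_diagonal (collBasis k V) moyalAntipode_collBasis]
    congr 1
    ext x
    simp only [neg_one_pow_eq_one_iff_even neg_one_ne_one, Set.mem_image, Set.mem_ofPred_eq, collBasis_apply,
      eq_comm (a := x)]
  · rw [eigenspace_eq_span_of_diagonal (collBasis k V) moyalAntipode_collBasis]
    congr 1
    ext x
    simp only [neg_one_pow_eq_neg_one_iff_odd neg_one_ne_one, Set.mem_image, Set.mem_ofPred_eq, collBasis_apply,
      eq_comm (a := x)]
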